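/- Let $G$ be a finite undirected multigraph with $n$ vertices and $m$ edges, let $\mathcal T\subseteq V(G)$ be a set of $k$ terminals, let $Q_0,Q_1\subseteq V(G)$, and let $c_0,c_1,\ell\ge 0$ be integers. For disjoint $A,B\subseteq V(G)$ let $E_G(A,B)$ be the set of edges with one end in $A$ and the other in $B$. A partition $(A_0,A_1)$ of $V(G)$ into two (possibly empty) sides is a *valid $(Q_0,Q_1,c_0,c_1,\ell)$-constrained cut* if - $Q_0\subseteq A_0\setminus\mathcal T$ and $Q_1\subseteq A_1\setminus\mathcal T$, - $|A_0\cap\mathcal T|\ge c_0$ and $|A_1\cap\mathcal T|\ge c_1$, - $|E_G(A_0,A_1)|\le\ell$. **Lemma.** There is a deterministic algorithm which, given $(G,\mathcal T)$, $Q_0$, $Q_1$ and integers $0\le \ell\le c$, finds a valid $(Q_0,Q_1,0,c,\ell)$-constrained cut or correctly reports that none exists, and, analogously, finds a valid $(Q_0,Q_1,c,0,\ell)$-constrained cut or correctly reports that none exists, in time $2^{O(c^2)}\cdot k^2\cdot m$ whenever $k\ge 1$ and $G$ has no isolated vertices. Without these two assumptions the running time is $2^{O(c^2)}\cdot(k^2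 m+n+m+1)$. Here $2^{O(c^2)}$ stands for $K\cdot 2^{Kc^2}$ with an absolute constant $K$, and time is the number of steps of a random access machine with assignment, addition, truncated subtraction, indirect addressing and tests for zero as unit-cost operations, working on words of $O(c^2+\log (n+m+2))$ bits. The input consists of $n,m,c_0,c_1,\ell$, the list of the edges, and the indicator vectors of $\mathcal T$, $Q_0$, $Q_1$, where $(c_0,c_1)=(0,c)$ or $(c_0,c_1)=(c,0)$. -/

import Mathlib

namespace ConstrainedCut

/-! ### Multigraphs with terminals and constrained cuts -/

/-- A finite undirected multigraph on the vertices `Fin n` with edges `Fin m`, given by its edge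
list (parallel edges and loops are allowed; the order of the two ends of an edge is irrelevant),
together with a set `T` of terminals. -/
structure TerminalGraph (n m : ℕ) where
  fst : Fin m → Fin n
  snd : Fin m → Fin n
  T : Finset (Fin n)

namespace TerminalGraph

variable {n m : ℕ} (G : TerminalGraph n m)

/-- `E_G(A, B)`: the edges with one end in `A` and the other one in `B`. -/
def edgesBetween (A B : Finset (Fin n)) : Finset (Fin m) :=
  Finset.univ.filter fun e =>
    (G.fst e ∈ A ∧ G.snd e ∈ B) ∨ (G.fst e ∈ B ∧ G.snd e ∈ A)

/-- `(A₀, A₁)` is a valid `(Q₀, Q₁, c₀, c₁, ℓ)`-constrained cut of `G`. A cut is a partition of the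
vertex set into two (possibly empty) sides. -/
structure IsValidCut (Q₀ Q₁ : Finset (Fin n)) (c₀ c₁ ℓ : ℕ) (A₀ A₁ : Finset (Fin n)) : Prop where
  disjoint : Disjoint A₀ A₁
  cover : A₀ ∪ A₁ = Finset.univ
  left_subset : Q₀ ⊆ A₀ \ G.T
  right_subset : Q₁ ⊆ A₁ \ G.T
  left_card : c₀ ≤ (A₀ ∩ G.T).card
  right_card : c₁ ≤ (A₁ ∩ G.T).card
  size_le : (G.edgesBetween A₀ A₁).card ≤ ℓ

/-- Every vertex is an end of some edge. -/
def NoIsolated : Prop := ∀ v : Fin n, ∃ e : Fin m, G.fst e = v ∨ G.snd e = v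

end TerminalGraph

/-! ### A random access machine with a step count -/

/-- The memory: scalar registers and arrays, all numbered. A program mentions only finitely many
registers and arrays; array cells are addressed indirectly, by the content of a register. -/
structure State where
  reg : ℕ → ℕ
  arr : ℕ → ℕ → ℕ

namespace State

/-- Overwrite register `r` by `v`. -/
def setReg (s : State) (r v : ℕ) : State :=
  { s with reg := Function.update s.reg r v }

/-- Overwrite cell `i` of array `A` by `v`. -/
def setArr (s : State) (A i v : ℕ) : State :=
  { s with arr := Function.update s.arr A (Function.update (s.arr A) i v) }

end State

/-- Programs of the random access machine. In the constructors `r a b i` are register numbers, `A`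
is an array number and `v` is a constant. -/
inductive Prog : Type
  /-- do nothing -/
  | skip : Prog
  /-- `r := v` -/
  | const (r v : ℕ) : Prog
  /-- `r := a` -/
  | copy (r a : ℕ) : Prog
  /-- `r := a + b` -/
  | add (r a b : ℕ) : Prog
  /-- `r := max (a - b) 0` -/
  | sub (r a b : ℕ) : Prog
  /-- `r := A[i]` -/
  | load (r A i : ℕ) : Prog
  /-- `A[i] := r` -/
  | store (A i r : ℕ) : Prog
  /-- `p; q` -/
  | seq (p q : Prog) : Prog
  /-- `if r ≠ 0 then p else q` -/
  | ite (r : ℕ) (p q : Prog) : Prog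
  /-- `while r ≠ 0 do p` -/
  | loop (r : ℕ) (p : Prog) : Prog

/-- `Exec W p s s' t`: started in memory `s`, the program `p` halts in memory `s'` after exactly
`t` steps, and every number that it creates is less than `W` (it fits into one machine word). Each
elementary instruction and each evaluation of a test costs one step. -/
inductive Exec (W : ℕ) : Prog → State → State → ℕ → Prop
  | skip (s : State) : Exec W .skip s s 1
  | const (s : State) (r v : ℕ) (h : v < W) :
      Exec W (.const r v) s (s.setReg r v) 1
  | copy (s : State) (r a : ℕ) :
      Exec W (.copy r a) s (s.setReg r (s.reg a)) 1
  | add (s : State) (r a b : ℕ) (h : s.reg a + s.reg b < W) :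
      Exec W (.add r a b) s (s.setReg r (s.reg a + s.reg b)) 1
  | sub (s : State) (r a b : ℕ) :
      Exec W (.sub r a b) s (s.setReg r (s.reg a - s.reg b)) 1
  | load (s : State) (r A i : ℕ) :
      Exec W (.load r A i) s (s.setReg r (s.arr A (s.reg i))) 1
  | store (s : State) (A i r : ℕ) :
      Exec W (.store A i r) s (s.setArr A (s.reg i) (s.reg r)) 1
  | seq {p q : Prog} {s s' s'' : State} {t t' : ℕ}
      (hp : Exec W p s s' t) (hq : Exec W q s' s'' t') :
      Exec W (.seq p q) s s'' (t + t')
  | iteTrue {r : ℕ} {p q : Prog} {s s' : State} {t : ℕ}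
      (h : s.reg r ≠ 0) (hp : Exec W p s s' t) :
      Exec W (.ite r p q) s s' (t + 1)
  | iteFalse {r : ℕ} {p q : Prog} {s s' : State} {t : ℕ}
      (h : s.reg r = 0) (hq : Exec W q s s' t) :
      Exec W (.ite r p q) s s' (t + 1)
  | loopDone {r : ℕ} {p : Prog} {s : State} (h : s.reg r = 0) :
      Exec W (.loop r p) s s 1
  | loopStep {r : ℕ} {p : Prog} {s s' s'' : State} {t t' : ℕ}
      (h : s.reg r ≠ 0) (hp : Exec W p s s' t) (hl : Exec W (.loop r p) s' s'' t') :
      Exec W (.loop r p) s s'' (t + t' + 1)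

/-! ### Input and output conventions -/

/-- The array holding the values of `f : Fin N → ℕ`, followed by zeros. -/
def tabulate {N : ℕ} (f : Fin N → ℕ) (i : ℕ) : ℕ :=
  if h : i < N then f ⟨i, h⟩ else 0

/-- The initial memory. Registers `0, …, 4` hold `n, m, c₀, c₁, ℓ`; arrays `0, 1` hold the first and
second ends of the edges; arrays `2, 3, 4` hold the indicator vectors of the terminal set, of `Q₀`
and of `Q₁`. Everything else is zero. -/
def inputState {n m : ℕ} (G : TerminalGraph n m) (Q₀ Q₁ : Finset (Fin n)) (c₀ c₁ ℓ : ℕ) :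
    State where
  reg r := match r with
    | 0 => n
    | 1 => m
    | 2 => c₀
    | 3 => c₁
    | 4 => ℓ
    | _ => 0
  arr A := match A with
    | 0 => tabulate fun e => (G.fst e : ℕ)
    | 1 => tabulate fun e => (G.snd e : ℕ)
    | 2 => tabulate fun v => if v ∈ G.T then 1 else 0
    | 3 => tabulate fun v => if v ∈ Q₀ then 1 else 0
    | 4 => tabulate fun v => if v ∈ Q₁ then 1 else 0
    | _ => fun _ => 0

/-- The vertex set whose indicator vector is left in array `0`. -/
def outputSet (n : ℕ) (s : State) : Finset (Fin n) :=
  Finset.univ.filter fun v => s.arr 0 v = 1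

/-- The final memory `s` answers the search problem correctly: either register `0` is `1` and array
`0` describes the side `A₀` of a valid constrained cut, or register `0` is `0` and there is no valid
constrained cut. -/
def CorrectOutput {n m : ℕ} (G : TerminalGraph n m) (Q₀ Q₁ : Finset (Fin n)) (c₀ c₁ ℓ : ℕ)
    (s : State) : Prop :=
  (s.reg 0 = 1 ∧ G.IsValidCut Q₀ Q₁ c₀ c₁ ℓ (outputSet n s) (outputSet n s)ᶜ) ∨
  (s.reg 0 = 0 ∧ ¬ ∃ A₀ A₁ : Finset (Fin n), G.IsValidCut Q₀ Q₁ c₀ c₁ ℓ A₀ A₁)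

end ConstrainedCut

namespace ConstrainedCut

/-! ### Reading from updated memories -/

namespace State

/-! Only one side `A` has to be found, the one that must hold `c` terminals. Labels record
decisions: `1` puts a vertex into `A`, `2` keeps it out. By submodularity the smallest cuts that
respect the labels have a largest member, `Net.far`; write `M` for it and `Net.conn` for its size.

Outer search (`Inst.exists_finds`). If `Net.conn` is at most `l` and `M` holds `c` terminals, then
`M` is an answer. Otherwise every side that contains `M` has a terminal outside `M`, and giving such
a terminal label `1` strictly raises `Net.conn`. As `Net.conn` may not exceed `l`, at most `l + 1`
levels are needed. The point is to find a good terminal among few candidates.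

Exchange (`Inst.exists_cand`). Take a side `A ⊇ M` with as few terminals as possible, a terminal `s`
in `A \ M`, and let `C` be the component of `s` in `A \ M`. By minimality `A \ C` has fewer than `c`
terminals. With `d` the cut of `M ∪ C`, uncrossing shows that `C` may be replaced by any cut `S` of
at most `d` edges: `(A \ C) ∪ S` still cuts at most `l` edges. With `t` the smaller of `c` and the
number of terminals of `C`, candidates are collected greedily in disjoint blocks of `t` terminals
outside `M`, each block inside one cut of at most `d` edges. Among `c` blocks one avoids `A \ C`,
and its cut makes up for the loss of `C`. If there are fewer blocks, then a cut that swallows `C`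
contributes a candidate, and exchanging `C` for that cut only enlarges `A`. Either way a good
candidate is among the first `c * c`.

Enumeration (`Net.exists_ext`). A cut that swallows `C` is found by repeatedly taking an edge that
leaves `Net.far` to an undecided vertex and deciding on that vertex. Acceptance raises `Net.conn`;
rejection raises the number `Net.closed` of edges from `Net.far` to forbidden vertices. The sum is
below `2 * d` while an undecided frontier edge exists, so `2 * d` decisions suffice.

All choices are digits in base `c * c + 2`, and a number with `3 * c + 3` digits encodes the choices
of the whole outer search or of one enumeration. The deterministic program runs through all such
numbers, of which there are `2^{O(c^2)}`; in the inner loops it works only on ends of edges, so that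
`n` enters additively. Smallest cuts come from augmenting paths, broken off after `d + 1` units
(`Layout.tri_flow`). Running times are derived together with correctness from a clocked weakest
precondition, and word sizes follow from the running time because the program adds only ones
(`Run.exec`). -/

@[simp] theorem reg_setReg (s : State) (r v x : ℕ) :
    (s.setReg r v).reg x = if x = r then v else s.reg x := by
  simp [setReg, Function.update_apply]

@[simp] theorem arr_setReg (s : State) (r v : ℕ) : (s.setReg r v).arr = s.arr := rfl

@[simp] theorem reg_setArr (s : State) (A i v : ℕ) : (s.setArr A i v).reg = s.reg := rfl

@[simp] theorem arr_setArr (s : State) (A i v x : ℕ) :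
    (s.setArr A i v).arr x = if x = A then Function.update (s.arr A) i v else s.arr x := by
  simp only [setArr, Function.update_apply]

end State

/-! ### Runs without a bound on the word size -/

/-- `Run p s s' t`: started in `s`, the program `p` halts in `s'` after `t` steps. -/
inductive Run : Prog → State → State → ℕ → Prop
  | skip (s : State) : Run .skip s s 1
  | const (s : State) (r v : ℕ) : Run (.const r v) s (s.setReg r v) 1
  | copy (s : State) (r a : ℕ) : Run (.copy r a) s (s.setReg r (s.reg a)) 1
  | add (s : State) (r a b : ℕ) : Run (.add r a b) s (s.setReg r (s.reg a + s.reg b)) 1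
  | sub (s : State) (r a b : ℕ) : Run (.sub r a b) s (s.setReg r (s.reg a - s.reg b)) 1
  | load (s : State) (r A i : ℕ) : Run (.load r A i) s (s.setReg r (s.arr A (s.reg i))) 1
  | store (s : State) (A i r : ℕ) : Run (.store A i r) s (s.setArr A (s.reg i) (s.reg r)) 1
  | seq {p q : Prog} {s s' s'' : State} {t t' : ℕ}
      (hp : Run p s s' t) (hq : Run q s' s'' t') : Run (.seq p q) s s'' (t + t')
  | iteTrue {r : ℕ} {p q : Prog} {s s' : State} {t : ℕ}
      (h : s.reg r ≠ 0) (hp : Run p s s' t) : Run (.ite r p q) s s' (t + 1)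
  | iteFalse {r : ℕ} {p q : Prog} {s s' : State} {t : ℕ}
      (h : s.reg r = 0) (hq : Run q s s' t) : Run (.ite r p q) s s' (t + 1)
  | loopDone {r : ℕ} {p : Prog} {s : State} (h : s.reg r = 0) : Run (.loop r p) s s 1
  | loopStep {r : ℕ} {p : Prog} {s s' s'' : State} {t₁ t₂ : ℕ}
      (h : s.reg r ≠ 0) (hp : Run p s s' t₁) (hl : Run (.loop r p) s' s'' t₂) :
      Run (.loop r p) s s'' (t₁ + t₂ + 1)

/-- The program may write to register `x`. -/
def Prog.writesReg : Prog → ℕ → Bool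
  | .skip, _ => false
  | .const r _, x | .copy r _, x | .add r _ _, x | .sub r _ _, x | .load r _ _, x => x == r
  | .store _ _ _, _ => false
  | .seq p q, x | .ite _ p q, x => p.writesReg x || q.writesReg x
  | .loop _ p, x => p.writesReg x

/-- The program may write to array `x`. -/
def Prog.writesArr : Prog → ℕ → Bool
  | .store A _ _, x => x == A
  | .seq p q, x | .ite _ p q, x => p.writesArr x || q.writesArr x
  | .loop _ p, x => p.writesArr x
  | _, _ => false

/-- What the program cannot write to has not changed from `s` to `s'`. -/
structure Frame (p : Prog) (s s' : State) : Prop where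
  reg : ∀ r, p.writesReg r = false → s'.reg r = s.reg r
  arr : ∀ A, p.writesArr A = false → s'.arr A = s.arr A

/-- Written registers and arrays are computed syntactically, so for a concrete program the side
conditions are closed by `rfl`. This carries all unrelated facts across a subprogram. -/
theorem Run.frame {p : Prog} {s s' : State} {t : ℕ} (h : Run p s s' t) : Frame p s s' := by
  induction h with
  | skip => exact ⟨fun _ _ => rfl, fun _ _ => rfl⟩
  | seq _ _ h1 h2 =>
    constructor
    · intro r hr
      simp only [Prog.writesReg, Bool.or_eq_false_iff] at hr
      rw [h2.reg r hr.2, h1.reg r hr.1]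
    · intro r hr
      simp only [Prog.writesArr, Bool.or_eq_false_iff] at hr
      rw [h2.arr r hr.2, h1.arr r hr.1]
  | iteTrue _ _ h1 | iteFalse _ _ h1 =>
    constructor
    · intro r hr
      simp only [Prog.writesReg, Bool.or_eq_false_iff] at hr
      exact h1.reg r (by simp [hr])
    · intro r hr
      simp only [Prog.writesArr, Bool.or_eq_false_iff] at hr
      exact h1.arr r (by simp [hr])
  | loopDone => exact ⟨fun _ _ => rfl, fun _ _ => rfl⟩
  | loopStep _ _ _ h1 h2 =>
    constructor
    · intro r hr
      rw [h2.reg r hr]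
      exact h1.reg r hr
    · intro r hr
      rw [h2.arr r hr]
      exact h1.arr r hr
  | _ =>
    constructor
    · intro r hr
      simp_all [Prog.writesReg]
    · intro r hr
      simp_all [Prog.writesArr]

/-- The program never writes to register `5`, creates only constants up to `3`, and adds only the
content of register `5`. -/
def Prog.increments : Prog → Bool
  | .const r v => r != 5 && decide (v ≤ 3)
  | .copy r _ | .sub r _ _ | .load r _ _ => r != 5
  | .add r _ b => r != 5 && b == 5
  | .seq p q | .ite _ p q => p.increments && q.increments
  | .loop _ p => p.increments
  | _ => true

/-- Every number in the memory is at most `N`. -/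
structure State.Bounded (s : State) (N : ℕ) : Prop where
  reg : ∀ r, s.reg r ≤ N
  arr : ∀ A i, s.arr A i ≤ N

theorem State.Bounded.setReg {s : State} {N N' v : ℕ} (h : s.Bounded N) (hN : N ≤ N')
    (hv : v ≤ N') (r : ℕ) : (s.setReg r v).Bounded N' := by
  refine ⟨fun x => ?_, fun A i => (h.arr A i).trans hN⟩
  rw [State.reg_setReg]
  split_ifs
  · exact hv
  · exact (h.reg x).trans hN

/-- A program that only increments creates no number larger than its running time plus what is in
the memory at the start, so its runs are executions on words of that size. -/
theorem Run.exec {p : Prog} {s s' : State} {t : ℕ} (h : Run p s s' t) (hp : p.increments = true)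
    (h1 : s.reg 5 = 1) {N : ℕ} (hN : 3 ≤ N) (hb : s.Bounded N) :
    s'.reg 5 = 1 ∧ s'.Bounded (N + t) ∧ ∀ W, N + t < W → Exec W p s s' t := by
  induction h generalizing N with
  | skip s =>
    exact ⟨h1, ⟨fun r => (hb.reg r).trans (by omega), fun A i => (hb.arr A i).trans (by omega)⟩,
      fun W _ => .skip s⟩
  | const s r v =>
    simp only [Prog.increments, Bool.and_eq_true, bne_iff_ne, decide_eq_true_eq] at hp
    exact ⟨by simp [h1, hp.1.symm], hb.setReg (by omega) (by omega) r,
      fun W hW => .const s r v (by omega)⟩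
  | copy s r a =>
    simp only [Prog.increments, bne_iff_ne] at hp
    exact ⟨by simp [h1, hp.symm], hb.setReg (by omega) ((hb.reg a).trans (by omega)) r,
      fun W _ => .copy s r a⟩
  | add s r a b =>
    simp only [Prog.increments, Bool.and_eq_true, bne_iff_ne, beq_iff_eq] at hp
    obtain ⟨hr, rfl⟩ := hp
    -- The second summand is register `5`, which holds `1`, so the sum exceeds an old number by at
    -- most one, which is also the cost of the instruction.
    have ha := hb.reg a
    exact ⟨by simp [h1, hr.symm], hb.setReg (by omega) (by omega) r,
      fun W _ => .add s r a 5 (by omega)⟩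
  | sub s r a b =>
    simp only [Prog.increments, bne_iff_ne] at hp
    have ha := hb.reg a
    exact ⟨by simp [h1, hp.symm], hb.setReg (by omega) (by omega) r, fun W _ => .sub s r a b⟩
  | load s r A i =>
    simp only [Prog.increments, bne_iff_ne] at hp
    exact ⟨by simp [h1, hp.symm], hb.setReg (by omega) ((hb.arr A _).trans (by omega)) r,
      fun W _ => .load s r A i⟩
  | store s A i r =>
    refine ⟨h1, ⟨fun x => (hb.reg x).trans (by omega), fun A' j => ?_⟩, fun W _ => .store s A i r⟩
    have h2 := hb.reg r
    have h3 := hb.arr A' j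
    have h4 := hb.arr A j
    rw [State.arr_setArr]
    split_ifs
    · rw [Function.update_apply]
      split_ifs <;> omega
    · omega
  | @seq p q s s' s'' t t' _ _ ih1 ih2 =>
    simp only [Prog.increments, Bool.and_eq_true] at hp
    obtain ⟨a1, a2, a3⟩ := ih1 hp.1 h1 hN hb
    obtain ⟨b1, b2, b3⟩ := ih2 hp.2 a1 (by omega) a2
    exact ⟨b1, by rwa [← add_assoc], fun W hW => .seq (a3 W (by omega)) (b3 W (by omega))⟩
  | @iteTrue r p q s s' t h _ ih =>
    simp only [Prog.increments, Bool.and_eq_true] at hp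
    obtain ⟨a1, a2, a3⟩ := ih hp.1 h1 hN hb
    exact ⟨a1, ⟨fun r => (a2.reg r).trans (by omega), fun A i => (a2.arr A i).trans (by omega)⟩,
      fun W hW => .iteTrue h (a3 W (by omega))⟩
  | @iteFalse r p q s s' t h _ ih =>
    simp only [Prog.increments, Bool.and_eq_true] at hp
    obtain ⟨a1, a2, a3⟩ := ih hp.2 h1 hN hb
    exact ⟨a1, ⟨fun r => (a2.reg r).trans (by omega), fun A i => (a2.arr A i).trans (by omega)⟩,
      fun W hW => .iteFalse h (a3 W (by omega))⟩
  | @loopDone r p s h =>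
    exact ⟨h1, ⟨fun r => (hb.reg r).trans (by omega), fun A i => (hb.arr A i).trans (by omega)⟩,
      fun W _ => .loopDone h⟩
  | @loopStep r p s s' s'' t t' h _ _ ih1 ih2 =>
    obtain ⟨a1, a2, a3⟩ := ih1 hp h1 hN hb
    obtain ⟨b1, b2, b3⟩ := ih2 hp a1 (by omega) a2
    exact ⟨b1, ⟨fun r => (b2.reg r).trans (by omega), fun A i => (b2.arr A i).trans (by omega)⟩,
      fun W hW => .loopStep h (a3 W (by omega)) (b3 W (by omega))⟩

/-! ### Weakest preconditions with a clock -/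

/-- Started in `s` at time `t`, the program halts in a state and at a time that satisfy `Q`. -/
def wp (p : Prog) (Q : State → ℕ → Prop) (s : State) (t : ℕ) : Prop :=
  ∃ s' u, Run p s s' u ∧ Q s' (t + u)

/-- Started in `s`, the program halts within `b` steps in a state that satisfies `Q`. -/
def Tri (p : Prog) (s : State) (b : ℕ) (Q : State → Prop) : Prop :=
  ∃ s' t, Run p s s' t ∧ t ≤ b ∧ Q s'

section wp

variable {Q : State → ℕ → Prop} {s : State} {t : ℕ}

@[simp] theorem wp_skip : wp .skip Q s t ↔ Q s (t + 1) :=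
  ⟨fun ⟨_, _, h, hQ⟩ => by cases h; exact hQ, fun h => ⟨_, _, .skip s, h⟩⟩

@[simp] theorem wp_const {r v : ℕ} : wp (.const r v) Q s t ↔ Q (s.setReg r v) (t + 1) :=
  ⟨fun ⟨_, _, h, hQ⟩ => by cases h; exact hQ, fun h => ⟨_, _, .const s r v, h⟩⟩

@[simp] theorem wp_copy {r a : ℕ} : wp (.copy r a) Q s t ↔ Q (s.setReg r (s.reg a)) (t + 1) :=
  ⟨fun ⟨_, _, h, hQ⟩ => by cases h; exact hQ, fun h => ⟨_, _, .copy s r a, h⟩⟩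

@[simp] theorem wp_add {r a b : ℕ} :
    wp (.add r a b) Q s t ↔ Q (s.setReg r (s.reg a + s.reg b)) (t + 1) :=
  ⟨fun ⟨_, _, h, hQ⟩ => by cases h; exact hQ, fun h => ⟨_, _, .add s r a b, h⟩⟩

@[simp] theorem wp_sub {r a b : ℕ} :
    wp (.sub r a b) Q s t ↔ Q (s.setReg r (s.reg a - s.reg b)) (t + 1) :=
  ⟨fun ⟨_, _, h, hQ⟩ => by cases h; exact hQ, fun h => ⟨_, _, .sub s r a b, h⟩⟩

@[simp] theorem wp_load {r A i : ℕ} :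
    wp (.load r A i) Q s t ↔ Q (s.setReg r (s.arr A (s.reg i))) (t + 1) :=
  ⟨fun ⟨_, _, h, hQ⟩ => by cases h; exact hQ, fun h => ⟨_, _, .load s r A i, h⟩⟩

@[simp] theorem wp_store {A i r : ℕ} :
    wp (.store A i r) Q s t ↔ Q (s.setArr A (s.reg i) (s.reg r)) (t + 1) :=
  ⟨fun ⟨_, _, h, hQ⟩ => by cases h; exact hQ, fun h => ⟨_, _, .store s A i r, h⟩⟩

@[simp] theorem wp_seq {p q : Prog} :
    wp (.seq p q) Q s t ↔ wp p (wp q Q) s t := by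
  constructor
  · rintro ⟨s', _, h, hQ⟩
    cases h with
    | seq h1 h2 => exact ⟨_, _, h1, _, _, h2, by rwa [add_assoc]⟩
  · rintro ⟨s', t', h1, s'', t'', h2, hQ⟩
    exact ⟨_, _, .seq h1 h2, by rwa [← add_assoc]⟩

@[simp] theorem wp_ite {r : ℕ} {p q : Prog} :
    wp (.ite r p q) Q s t ↔
      (s.reg r ≠ 0 → wp p Q s (t + 1)) ∧ (s.reg r = 0 → wp q Q s (t + 1)) := by
  constructor
  · rintro ⟨s', _, h, hQ⟩
    cases h with
    | @iteTrue _ _ _ _ _ t' h1 h2 =>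
      exact ⟨fun _ => ⟨_, _, h2, by rwa [add_assoc, add_comm 1]⟩, fun h => absurd h h1⟩
    | @iteFalse _ _ _ _ _ t' h1 h2 =>
      exact ⟨fun h => absurd h1 h, fun _ => ⟨_, _, h2, by rwa [add_assoc, add_comm 1]⟩⟩
  · rintro ⟨h1, h2⟩
    by_cases h : s.reg r = 0
    · obtain ⟨s', t', hr, hQ⟩ := h2 h
      exact ⟨_, _, .iteFalse h hr, by rwa [add_assoc, add_comm 1] at hQ⟩
    · obtain ⟨s', t', hr, hQ⟩ := h1 h
      exact ⟨_, _, .iteTrue h hr, by rwa [add_assoc, add_comm 1] at hQ⟩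

/-- Runs a list of programs one after the other. -/
def Prog.block : List Prog → Prog
  | [] => .skip
  | p :: ps => .seq p (block ps)

@[simp] theorem wp_block_nil : wp (.block []) Q s t ↔ Q s (t + 1) := wp_skip

@[simp] theorem wp_block_cons {p : Prog} {ps : List Prog} :
    wp (.block (p :: ps)) Q s t ↔ wp p (wp (.block ps) Q) s t := wp_seq

end wp

theorem Tri.of_wp {p : Prog} {s : State} {b : ℕ} {Q : State → Prop}
    (h : wp p (fun s' t => Q s' ∧ t ≤ b) s 0) : Tri p s b Q := by
  obtain ⟨s', t, hr, hQ, ht⟩ := h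
  exact ⟨s', t, hr, by omega, hQ⟩

/-- The rule for calling a verified subprogram: what follows may use its postcondition, its frame
and the advanced clock, but not its code. -/
theorem Tri.wp {p : Prog} {s : State} {b t : ℕ} {R : State → Prop} {Q : State → ℕ → Prop}
    (h : Tri p s b R) (hQ : ∀ s' t', R s' → Frame p s s' → t' ≤ t + b → Q s' t') :
    wp p Q s t := by
  obtain ⟨s', t', hr, ht, hR⟩ := h
  exact ⟨s', t', hr, hQ s' _ hR hr.frame (by omega)⟩

theorem Tri.mono {p : Prog} {s : State} {b b' : ℕ} {R Q : State → Prop}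
    (h : Tri p s b R) (hb : b ≤ b') (hQ : ∀ s', R s' → Frame p s s' → Q s') : Tri p s b' Q := by
  obtain ⟨s', t', hr, ht, hR⟩ := h
  exact ⟨s', t', hr, ht.trans hb, hQ s' hR hr.frame⟩

theorem Frame.refl (p : Prog) (s : State) : Frame p s s := ⟨fun _ _ => rfl, fun _ _ => rfl⟩

theorem Frame.trans {p : Prog} {s s' s'' : State} (h : Frame p s s') (h' : Frame p s' s'') :
    Frame p s s'' :=
  ⟨fun r hr => (h'.reg r hr).trans (h.reg r hr), fun A hA => (h'.arr A hA).trans (h.arr A hA)⟩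

/-- A loop whose invariant carries a decreasing potential. -/
theorem Tri.loop {r : ℕ} {p : Prog} {b : ℕ} (I : ℕ → State → Prop) {k₀ : ℕ} {s₀ : State}
    (hI : ∀ k s, Frame p s₀ s → I k s → s.reg r ≠ 0 → Tri p s b fun s' => ∃ k' < k, I k' s')
    (h : I k₀ s₀) :
    Tri (.loop r p) s₀ (k₀ * (b + 1) + 1) fun s' => (∃ k', I k' s') ∧ s'.reg r = 0 := by
  suffices H : ∀ k s, Frame p s₀ s → I k s →
      Tri (.loop r p) s (k * (b + 1) + 1) fun s' => (∃ k', I k' s') ∧ s'.reg r = 0 from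
    H k₀ s₀ (.refl p s₀) h
  intro k
  induction k using Nat.strong_induction_on with
  | _ k ih =>
    intro s hf h
    by_cases hr : s.reg r = 0
    · exact ⟨s, 1, .loopDone hr, by omega, ⟨k, h⟩, hr⟩
    · obtain ⟨s', t, h1, h2, k', hk, h3⟩ := hI k s hf h hr
      obtain ⟨s'', t', h4, h5, h6⟩ := ih k' hk s' (hf.trans h1.frame) h3
      refine ⟨s'', _, .loopStep hr h1 h4, ?_, h6⟩
      -- A drop of the potential by one pays for one round and one evaluation of the test.
      have : (k' + 1) * (b + 1) ≤ k * (b + 1) := Nat.mul_le_mul_right _ hk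
      rw [add_mul] at this
      omega

/-- A loop that counts a register down to zero. -/
theorem Tri.down {r : ℕ} {p : Prog} {b : ℕ} (I : ℕ → State → Prop) {k₀ : ℕ} {s₀ : State}
    (hI : ∀ k s, Frame p s₀ s → I (k + 1) s → s.reg r = k + 1 →
      Tri p s b fun s' => I k s' ∧ s'.reg r = k)
    (hk : s₀.reg r = k₀) (h : I k₀ s₀) :
    Tri (.loop r p) s₀ (k₀ * (b + 1) + 1) (I 0) := by
  refine (Tri.loop (r := r) (p := p) (b := b) (fun k s => I k s ∧ s.reg r = k) ?_
    ⟨h, hk⟩).mono le_rfl ?_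
  · rintro k s hf ⟨h1, h2⟩ h3
    obtain _ | k := k
    · exact absurd h2 h3
    · exact (hI k s hf h1 h2).mono le_rfl fun s' h _ => ⟨k, by omega, h⟩
  · rintro s' ⟨⟨k', h1, h2⟩, h3⟩ _
    rw [h3] at h2
    subst h2
    exact h1

/-! ### Networks of half-edges and their cuts -/

/-- A network with the half-edges `1, …, N`. Each undirected edge is a pair of half-edges that are
exchanged by `rev`. -/
structure Net where
  N : ℕ
  src : ℕ → ℕ
  dst : ℕ → ℕ
  rev : ℕ → ℕ
  rev_mem : ∀ p ∈ Finset.Icc 1 N, rev p ∈ Finset.Icc 1 N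
  rev_ne : ∀ p ∈ Finset.Icc 1 N, rev p ≠ p
  rev_rev : ∀ p ∈ Finset.Icc 1 N, rev (rev p) = p
  src_rev : ∀ p ∈ Finset.Icc 1 N, src (rev p) = dst p

/-- `A` contains the vertices labelled `1` and avoids those labelled `2`. -/
def Sep (lab : ℕ → ℕ) (A : Set ℕ) : Prop := ∀ v, (lab v = 1 → v ∈ A) ∧ (lab v = 2 → v ∉ A)

theorem Sep.union {lab : ℕ → ℕ} {A B : Set ℕ} (hA : Sep lab A) (hB : Sep lab B) :
    Sep lab (A ∪ B) := fun v =>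
  ⟨fun h => Or.inl ((hA v).1 h), fun h h' => h'.elim ((hA v).2 h) ((hB v).2 h)⟩

theorem Sep.inter {lab : ℕ → ℕ} {A B : Set ℕ} (hA : Sep lab A) (hB : Sep lab B) :
    Sep lab (A ∩ B) := fun v =>
  ⟨fun h => ⟨(hA v).1 h, (hB v).1 h⟩, fun h h' => (hA v).2 h h'.1⟩

theorem sep_update_one {lab : ℕ → ℕ} {A : Set ℕ} {v : ℕ} (hA : Sep lab A) (hv : v ∈ A) :
    Sep (Function.update lab v 1) A := fun u => by
  have := hA u
  rw [Function.update_apply]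
  split_ifs with h
  · subst h; simpa using hv
  · exact this

theorem sep_update_two {lab : ℕ → ℕ} {A : Set ℕ} {v : ℕ} (hA : Sep lab A) (hv : v ∉ A) :
    Sep (Function.update lab v 2) A := fun u => by
  have := hA u
  rw [Function.update_apply]
  split_ifs with h
  · subst h; simpa using hv
  · exact this

theorem Sep.of_update_one {lab : ℕ → ℕ} {A : Set ℕ} {v : ℕ} (hv : lab v ≠ 2)
    (hA : Sep (Function.update lab v 1) A) : Sep lab A ∧ v ∈ A := by
  refine ⟨fun u => ?_, (hA v).1 (by simp)⟩
  by_cases h : u = v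
  · subst h
    exact ⟨fun _ => (hA u).1 (by simp), fun h => absurd h hv⟩
  · simpa [Function.update_apply, h] using hA u

theorem Sep.of_update_two {lab : ℕ → ℕ} {A : Set ℕ} {v : ℕ} (hv : lab v ≠ 1)
    (hA : Sep (Function.update lab v 2) A) : Sep lab A ∧ v ∉ A := by
  refine ⟨fun u => ?_, (hA v).2 (by simp)⟩
  by_cases h : u = v
  · subst h
    exact ⟨fun h => absurd h hv, fun _ => (hA u).2 (by simp)⟩
  · simpa [Function.update_apply, h] using hA u

namespace Net

variable (D : Net)

theorem dst_rev {p : ℕ} (hp : p ∈ Finset.Icc 1 D.N) : D.dst (D.rev p) = D.src p := by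
  rw [← D.src_rev _ (D.rev_mem p hp), D.rev_rev p hp]

/-- The vertices that are ends of edges. -/
def verts : Finset ℕ := (Finset.Icc 1 D.N).image D.src

theorem src_mem_verts {p : ℕ} (hp : p ∈ Finset.Icc 1 D.N) : D.src p ∈ D.verts :=
  Finset.mem_image_of_mem _ hp

theorem dst_mem_verts {p : ℕ} (hp : p ∈ Finset.Icc 1 D.N) : D.dst p ∈ D.verts :=
  D.src_rev p hp ▸ D.src_mem_verts (D.rev_mem p hp)

theorem card_verts_le : D.verts.card ≤ D.N := by
  simpa [verts] using (Finset.card_image_le (s := Finset.Icc 1 D.N) (f := D.src))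

open Classical in
/-- The total weight of the half-edges from `A` to `B`. -/
noncomputable def flux (w : ℕ → ℕ) (A B : Set ℕ) : ℕ :=
  ∑ p ∈ Finset.Icc 1 D.N, if D.src p ∈ A ∧ D.dst p ∈ B then w p else 0

/-- The number of edges between `A` and its complement. -/
noncomputable def cut (A : Set ℕ) : ℕ := D.flux 1 A Aᶜ

theorem flux_mono {w : ℕ → ℕ} {A B A' B' : Set ℕ} (hA : A ⊆ A') (hB : B ⊆ B') :
    D.flux w A B ≤ D.flux w A' B' := by
  classical
  refine Finset.sum_le_sum fun p _ => ?_
  split_ifs with h1 h2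
  · exact le_rfl
  · exact absurd ⟨hA h1.1, hB h1.2⟩ h2
  · exact Nat.zero_le _
  · exact le_rfl

theorem flux_eq_zero {w : ℕ → ℕ} {A B : Set ℕ} :
    D.flux w A B = 0 ↔ ∀ p ∈ Finset.Icc 1 D.N, D.src p ∈ A → D.dst p ∈ B → w p = 0 := by
  simp only [flux, Finset.sum_eq_zero_iff, ite_eq_right_iff, and_imp]

theorem cut_congr {A B : Set ℕ} (h : ∀ v ∈ D.verts, v ∈ A ↔ v ∈ B) : D.cut A = D.cut B := by
  classical
  unfold cut flux
  refine Finset.sum_congr rfl fun p hp => ?_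
  simp only [Set.mem_compl_iff, h _ (D.src_mem_verts hp), h _ (D.dst_mem_verts hp)]

/-- Submodularity, which holds already for each half-edge separately. -/
theorem cut_union_add_cut_inter (A B : Set ℕ) :
    D.cut (A ∪ B) + D.cut (A ∩ B) ≤ D.cut A + D.cut B := by
  classical
  simp only [cut, flux, ← Finset.sum_add_distrib]
  refine Finset.sum_le_sum fun p _ => ?_
  simp only [Set.mem_union, Set.mem_inter_iff, Set.mem_compl_iff, Pi.one_apply]
  by_cases h1 : D.src p ∈ A <;> by_cases h2 : D.src p ∈ B <;> by_cases h3 : D.dst p ∈ A <;>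
    by_cases h4 : D.dst p ∈ B <;> simp [h1, h2, h3, h4]

/-- If no edge joins `C` to `A \ (M ∪ C)`, then the cuts of `M ∪ C` and `A \ C` together use no
more edges than those of `A` and `M`. -/
theorem cut_union_add_cut_diff {A M C : Set ℕ} (hM : M ⊆ A) (hC : C ⊆ A) (hCM : Disjoint C M)
    (h : ∀ p ∈ Finset.Icc 1 D.N, D.src p ∈ C → D.dst p ∈ A → D.dst p ∉ M → D.dst p ∈ C) :
    D.cut (M ∪ C) + D.cut (A \ C) ≤ D.cut A + D.cut M := by
  classical
  simp only [cut, flux, ← Finset.sum_add_distrib]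
  refine Finset.sum_le_sum fun p hp => ?_
  have h1 := h p hp
  -- The hypothesis covers half-edges out of `C` only; the reverse half-edge brings in those that
  -- enter `C`.
  have h2 := h _ (D.rev_mem p hp)
  rw [D.src_rev p hp, D.dst_rev hp] at h2
  have m1 := @hM (D.src p)
  have m2 := @hM (D.dst p)
  have c1 := @hC (D.src p)
  have c2 := @hC (D.dst p)
  have d1 : D.src p ∈ C → D.src p ∉ M := fun x y => Set.disjoint_left.1 hCM x y
  have d2 : D.dst p ∈ C → D.dst p ∉ M := fun x y => Set.disjoint_left.1 hCM x y
  simp only [Set.mem_union, Set.mem_sdiff, Set.mem_compl_iff, Pi.one_apply]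
  by_cases a1 : D.src p ∈ A <;> by_cases a2 : D.dst p ∈ A <;> by_cases a3 : D.src p ∈ M <;>
    by_cases a4 : D.dst p ∈ M <;> by_cases a5 : D.src p ∈ C <;> by_cases a6 : D.dst p ∈ C <;>
    simp_all

/-- `M` is the largest among the smallest cuts that respect the labels. -/
structure IsFar (lab : ℕ → ℕ) (M : Set ℕ) : Prop where
  sep : Sep lab M
  le : ∀ A, Sep lab A → D.cut M ≤ D.cut A
  max : ∀ A, Sep lab A → D.cut A = D.cut M → A ⊆ M

/-- The union of the smallest cuts that respect the labels. -/
def far (lab : ℕ → ℕ) : Set ℕ :=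
  ⋃₀ {A | Sep lab A ∧ ∀ A', Sep lab A' → D.cut A ≤ D.cut A'}

variable {D}

/-- A smallest cut that contains all smallest cuts is their union. Hence any set computed by the
program and shown to be furthest is `Net.far`. -/
theorem IsFar.eq_far {lab : ℕ → ℕ} {M : Set ℕ} (h : D.IsFar lab M) : M = D.far lab := by
  apply Set.Subset.antisymm
  · exact Set.subset_sUnion_of_mem ⟨h.sep, h.le⟩
  · rintro v ⟨A, ⟨hA, hA'⟩, hv⟩
    exact h.max A hA (le_antisymm (hA' M h.sep) (h.le A hA)) hv

variable (D)

/-- By submodularity the union of two smallest cuts is again smallest, so one with the most vertices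
contains the others. Only the ends of edges form a finite set; the remaining vertices are added
afterwards at no cost. -/
theorem exists_isFar (lab : ℕ → ℕ) : ∃ M, D.IsFar lab M := by
  classical
  set g : Set ℕ → Finset ℕ := fun A => D.verts.filter (· ∈ A) with hg
  -- Lexicographic order in one number: first the size of the cut, then the number of ends of edges
  -- left out. The factor exceeds every value of the second term.
  set f : Set ℕ → ℕ := fun A =>
    D.cut A * (D.verts.card + 1) + (D.verts.card - (g A).card)
  obtain ⟨A, hA, hmin⟩ := WellFounded.has_min (measure f).wf {A | Sep lab A}
    ⟨{v | lab v ≠ 2}, fun v => ⟨fun h => by simp [h], fun h => by simp [h]⟩⟩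
  have hmin' : ∀ B, Sep lab B → f A ≤ f B := fun B hB => not_lt.1 (hmin B hB)
  have hle : ∀ B, Sep lab B → D.cut A ≤ D.cut B := by
    intro B hB
    by_contra! hlt
    have h1 := hmin' B hB
    have h2 : (D.cut B + 1) * (D.verts.card + 1) ≤ D.cut A * (D.verts.card + 1) :=
      Nat.mul_le_mul_right _ hlt
    simp only [f] at h1
    rw [add_mul] at h2
    omega
  set M := A ∪ {v | v ∉ D.verts ∧ lab v ≠ 2}
  have hcut : D.cut M = D.cut A := by
    refine D.cut_congr fun v hv => ?_
    simp [M, hv]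
  have hM : Sep lab M := by
    intro v
    refine ⟨fun h => Or.inl ((hA v).1 h), ?_⟩
    rintro h (h' | h')
    · exact (hA v).2 h h'
    · exact h'.2 h
  refine ⟨M, hM, fun B hB => hcut ▸ hle B hB, fun B hB hBM v hv => ?_⟩
  by_cases hv' : v ∈ D.verts
  · left
    have h1 : D.cut (A ∪ B) = D.cut A := by
      have a1 := D.cut_union_add_cut_inter A B
      have a2 := hle _ (hA.inter hB)
      have a3 := hle _ (hA.union hB)
      omega
    have h2 := hmin' _ (hA.union hB)
    simp only [f, h1] at h2
    have h3 : (g (A ∪ B)).card ≤ D.verts.card := by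
      refine Finset.card_le_card fun x hx => ?_
      simp only [hg, Finset.mem_filter] at hx
      exact hx.1
    have h4 : g A ⊆ g (A ∪ B) := by
      intro x hx
      simp only [hg, Finset.mem_filter] at hx ⊢
      exact ⟨hx.1, Or.inl hx.2⟩
    have h5 := Finset.eq_of_subset_of_card_le h4 (by omega)
    have h6 : v ∈ g (A ∪ B) := by
      simp only [hg, Finset.mem_filter]
      exact ⟨hv', Or.inr hv⟩
    rw [← h5] at h6
    exact (Finset.mem_filter.1 h6).2
  · exact Or.inr ⟨hv', fun h => (hB v).2 h hv⟩

theorem isFar_far (lab : ℕ → ℕ) : D.IsFar lab (D.far lab) := by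
  obtain ⟨M, hM⟩ := D.exists_isFar lab
  exact hM.eq_far ▸ hM

/-- The size of a smallest cut that respects the labels. -/
noncomputable def conn (lab : ℕ → ℕ) : ℕ := D.cut (D.far lab)

theorem conn_le {lab : ℕ → ℕ} {A : Set ℕ} (hA : Sep lab A) : D.conn lab ≤ D.cut A :=
  (D.isFar_far lab).le A hA

/-- A vertex outside the largest smallest cut lies in no smallest cut. This strict increase bounds
the depth of both the outer search and the enumeration. -/
theorem conn_lt {lab : ℕ → ℕ} {A : Set ℕ} {v : ℕ} (hA : Sep lab A) (hv : v ∈ A)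
    (hv' : v ∉ D.far lab) : D.conn lab < D.cut A :=
  lt_of_le_of_ne (D.conn_le hA) fun h => hv' ((D.isFar_far lab).max A hA h.symm hv)

/-- Adding an isolated vertex changes no cut. Consequently a terminal outside the furthest cut is an
end of an edge and occurs in the list `tl`. -/
theorem mem_far_of_notMem_verts {lab : ℕ → ℕ} {v : ℕ} (hv : v ∉ D.verts) (h : lab v ≠ 2) :
    v ∈ D.far lab := by
  classical
  have hM := D.isFar_far lab
  refine hM.max (insert v (D.far lab)) ?_ ?_ (Set.mem_insert _ _)
  · intro u
    refine ⟨fun h => Or.inr ((hM.sep u).1 h), ?_⟩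
    rintro h' (rfl | h'')
    · exact h h'
    · exact (hM.sep u).2 h' h''
  · refine D.cut_congr fun u hu => ?_
    have h1 : u ≠ v := fun h => hv (h ▸ hu)
    simp [h1]

/-- Pushing a cut out to the furthest smallest one. -/
theorem cut_union_far_le {lab : ℕ → ℕ} {A : Set ℕ} (hA : Sep lab A) :
    D.cut (A ∪ D.far lab) ≤ D.cut A := by
  have h1 := D.cut_union_add_cut_inter A (D.far lab)
  have h2 := D.conn_le (hA.inter (D.isFar_far lab).sep)
  unfold conn at h2
  omega

/-- If the union respects the stricter labels, submodularity makes it a smallest cut for them, since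
the intersection costs at least `conn lab`; maximality then absorbs it. -/
theorem far_mono {lab lab' : ℕ → ℕ} (h : ∀ A, Sep lab' A → Sep lab A) :
    D.far lab ⊆ D.far lab' ∨ ¬ Sep lab' (D.far lab ∪ D.far lab') := by
  by_cases hs : Sep lab' (D.far lab ∪ D.far lab')
  · left
    have h0 := (D.isFar_far lab').sep
    have h1 := D.cut_union_add_cut_inter (D.far lab') (D.far lab)
    have h2 := D.conn_le ((h _ h0).inter (D.isFar_far lab).sep)
    unfold conn at h2
    rw [Set.union_comm] at h1
    have h3 := (D.isFar_far lab').le _ hs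
    exact (Set.subset_union_left).trans ((D.isFar_far lab').max _ hs (by omega))
  · exact Or.inr hs

end Net

/-! ### The search for a constrained cut as a function of the guessed digits -/

/-- Iterates `f` along the indices `k, …, 1`. -/
def countdown {α : Type*} (f : ℕ → α → α) : ℕ → α → α
  | 0, a => a
  | k + 1, a => countdown f k (f (k + 1) a)

/-- The list `a k, …, a 1`. -/
def descList (a : ℕ → ℕ) : ℕ → List ℕ
  | 0 => []
  | k + 1 => a (k + 1) :: descList a k

theorem mem_descList {a : ℕ → ℕ} {k v : ℕ} : v ∈ descList a k ↔ ∃ i, 1 ≤ i ∧ i ≤ k ∧ a i = v := by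
  induction k with
  | zero => simp only [descList, List.not_mem_nil, false_iff]; omega
  | succ k ih =>
    simp only [descList, List.mem_cons, ih]
    constructor
    · rintro (rfl | ⟨i, h1, h2, h3⟩)
      · exact ⟨k + 1, by omega, le_rfl, rfl⟩
      · exact ⟨i, h1, by omega, h3⟩
    · rintro ⟨i, h1, h2, h3⟩
      obtain rfl | h := h2.eq_or_lt
      · exact Or.inl h3.symm
      · exact Or.inr ⟨i, h1, by omega, h3⟩

theorem nodup_descList {a : ℕ → ℕ} {k : ℕ}
    (h : ∀ i j, 1 ≤ i → i ≤ k → 1 ≤ j → j ≤ k → a i = a j → i = j) : (descList a k).Nodup := by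
  induction k with
  | zero => simp [descList]
  | succ k ih =>
    simp only [descList, List.nodup_cons, mem_descList, not_exists, not_and]
    refine ⟨fun i h1 h2 h3 => ?_, ih fun i j a b c d e => h i j a (by omega) c (by omega) e⟩
    have := h i (k + 1) h1 (by omega) (by omega) le_rfl h3
    omega

/-- A network with terminals and the parameters of the search. The terminals that are ends of edges
are listed as `tl 1, …, tl NT`. -/
structure Inst extends Net where
  T : Finset ℕ
  NT : ℕ
  tl : ℕ → ℕ
  c : ℕ
  l : ℕ
  base : ℕ
  len : ℕ
  tl_mem : ∀ i, 1 ≤ i → i ≤ NT → tl i ∈ T ∧ tl i ∈ toNet.verts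
  exists_tl : ∀ v ∈ T, v ∈ toNet.verts → ∃ i, 1 ≤ i ∧ i ≤ NT ∧ tl i = v
  tl_inj : ∀ i j, 1 ≤ i → i ≤ NT → 1 ≤ j → j ≤ NT → tl i = tl j → i = j
  l_le : l ≤ c
  base_eq : base = c * c + 2
  len_eq : len = 3 * c + 3

/-! ### Enumeration of cuts by branching on frontier edges -/

namespace Net

variable (D : Net)

/-- The half-edge `p` leaves the furthest smallest cut, to a vertex that may still be chosen. -/
def IsFront (lab : ℕ → ℕ) (p : ℕ) : Prop :=
  D.src p ∈ D.far lab ∧ D.dst p ∉ D.far lab ∧ lab (D.dst p) ≠ 2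

open Classical in
/-- Some half-edge that leaves the furthest smallest cut to a vertex that may still be chosen, or
`0`. -/
noncomputable def front (lab : ℕ → ℕ) : ℕ :=
  countdown (fun p f => if D.IsFront lab p then p else f) D.N 0

theorem front_spec (lab : ℕ → ℕ) :
    (D.front lab ≠ 0 → D.front lab ∈ Finset.Icc 1 D.N ∧ D.IsFront lab (D.front lab)) ∧
      (D.front lab = 0 → ∀ p ∈ Finset.Icc 1 D.N, ¬ D.IsFront lab p) := by
  classical
  -- The start value is generalised because the countdown hands on the half-edge found so far; `0`
  -- is free to mean that none was found, as half-edges are numbered from `1`.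
  suffices H : ∀ k ≤ D.N, ∀ f₀, (f₀ ≠ 0 → f₀ ∈ Finset.Icc 1 D.N ∧ D.IsFront lab f₀) →
      (countdown (fun p f => if D.IsFront lab p then p else f) k f₀ ≠ 0 →
        countdown (fun p f => if D.IsFront lab p then p else f) k f₀ ∈ Finset.Icc 1 D.N ∧
        D.IsFront lab (countdown (fun p f => if D.IsFront lab p then p else f) k f₀)) ∧
      (countdown (fun p f => if D.IsFront lab p then p else f) k f₀ = 0 →
        f₀ = 0 ∧ ∀ p ∈ Finset.Icc 1 k, ¬ D.IsFront lab p) by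
    obtain ⟨h1, h2⟩ := H D.N le_rfl 0 (by simp)
    exact ⟨h1, fun h => (h2 h).2⟩
  intro k
  induction k with
  | zero => intro _ f₀ h; exact ⟨h, fun h => ⟨h, by simp⟩⟩
  | succ k ih =>
    intro hk f₀ h
    simp only [countdown]
    split_ifs with hf
    · obtain ⟨h1, h2⟩ := ih (by omega) (k + 1) fun _ => ⟨by simp; omega, hf⟩
      exact ⟨h1, fun h => absurd (h2 h).1 (by omega)⟩
    · obtain ⟨h1, h2⟩ := ih (by omega) f₀ h
      refine ⟨h1, fun h => ⟨(h2 h).1, fun p hp => ?_⟩⟩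
      obtain rfl | hp' := eq_or_ne p (k + 1)
      · exact hf
      · exact (h2 h).2 p (by simp only [Finset.mem_Icc] at hp ⊢; omega)

open Classical in
/-- One step of the enumeration of cuts with at most `d` edges: decide on the end of a frontier
edge. -/
noncomputable def extStep (d : ℕ) (lab : ℕ → ℕ) (b : ℕ) : ℕ → ℕ :=
  if D.conn lab ≤ d ∧ D.front lab ≠ 0 then
    Function.update lab (D.dst (D.front lab)) (if b = 0 then 2 else 1)
  else lab

/-- Several steps of the enumeration, guided by the digits of `w`. -/
noncomputable def ext (B d : ℕ) : ℕ → (ℕ → ℕ) → ℕ → ℕ → ℕ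
  | 0, lab, _ => lab
  | k + 1, lab, w => ext B d k (D.extStep d lab (w % B)) (w / B)

/-- The vertex decided on lies outside `far`, so it does not have label `1`, and being on the
frontier it does not have label `2`. Nothing is overwritten and the labels only become stricter. -/
theorem sep_of_sep_extStep {d b : ℕ} {lab : ℕ → ℕ} {A : Set ℕ} (h : Sep (D.extStep d lab b) A) :
    Sep lab A := by
  unfold extStep at h
  split_ifs at h with h1 h2
  · refine (Sep.of_update_two ?_ h).1
    intro h3
    exact ((D.front_spec lab).1 h1.2).2.2.1 (((D.isFar_far lab).sep _).1 h3)
  · exact (Sep.of_update_one ((D.front_spec lab).1 h1.2).2.2.2 h).1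
  · exact h

theorem sep_of_sep_ext {B d : ℕ} {k : ℕ} {lab : ℕ → ℕ} {w : ℕ} {A : Set ℕ}
    (h : Sep (D.ext B d k lab w) A) : Sep lab A := by
  induction k generalizing lab w with
  | zero => exact h
  | succ k ih => exact D.sep_of_sep_extStep (ih h)

theorem ext_of_front_eq_zero {B d k w : ℕ} {lab : ℕ → ℕ} (h : D.front lab = 0) :
    D.ext B d k lab w = lab := by
  induction k generalizing w with
  | zero => rfl
  | succ k ih => simp only [ext, extStep, h, ne_eq, not_true_eq_false, and_false, if_false, ih]

/-- The number of edges from the furthest smallest cut to forbidden vertices. -/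
noncomputable def closed (lab : ℕ → ℕ) : ℕ := D.flux 1 (D.far lab) {v | lab v = 2}

theorem flux_lt {A B B' : Set ℕ} {p : ℕ} (hB : B ⊆ B') (hp : p ∈ Finset.Icc 1 D.N)
    (h1 : D.src p ∈ A) (h2 : D.dst p ∈ B') (h3 : D.dst p ∉ B) : D.flux 1 A B < D.flux 1 A B' := by
  classical
  refine Finset.sum_lt_sum (fun q _ => ?_) ⟨p, hp, by simp [h1, h2, h3]⟩
  split_ifs with a1 a2
  · exact le_rfl
  · exact absurd ⟨a1.1, hB a1.2⟩ a2
  · exact Nat.zero_le _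
  · exact le_rfl

/-- Edges to forbidden vertices are among those that leave `far`, and the frontier edge is one of
the latter only. -/
theorem closed_lt_conn {lab : ℕ → ℕ} (h : D.front lab ≠ 0) : D.closed lab < D.conn lab := by
  obtain ⟨h1, h2, h3, h4⟩ := (D.front_spec lab).1 h
  exact D.flux_lt (fun v hv => ((D.isFar_far lab).sep v).2 hv) h1 h2 h3 h4

/-- The enumeration reaches every target. -/
theorem exists_ext {B d : ℕ} (hB : 2 ≤ B) (k : ℕ) (lab : ℕ → ℕ) (S : Set ℕ) (hS : Sep lab S)
    (hd : D.cut S ≤ d) (hk : 2 * d ≤ k + D.conn lab + D.closed lab) :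
    ∃ w < B ^ k, ∃ S', S ⊆ S' ∧ Sep (D.ext B d k lab w) S' ∧ D.cut S' ≤ d ∧
      D.front (D.ext B d k lab w) = 0 ∧ ∀ v, lab v = 1 → D.ext B d k lab w v = 1 := by
  induction k generalizing lab S with
  | zero =>
    refine ⟨0, by simp, S, subset_rfl, hS, hd, ?_, fun v h => h⟩
    by_contra h
    -- With a frontier edge left, `closed < conn ≤ d` would keep the potential below `2 * d`.
    have h1 := D.closed_lt_conn (lab := lab) h
    have h2 := D.conn_le hS
    omega
  | succ k ih =>
    by_cases hf : D.front lab = 0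
    · refine ⟨0, by positivity, S, subset_rfl, ?_⟩
      rw [D.ext_of_front_eq_zero hf]
      exact ⟨hS, hd, hf, fun v h => h⟩
    · obtain ⟨hp, h1, h2, h3⟩ := (D.front_spec lab).1 hf
      set v := D.dst (D.front lab) with hv
      have hconn := (D.conn_le hS).trans hd
      have hv1 : lab v ≠ 1 := fun h => h2 (((D.isFar_far lab).sep v).1 h)
      -- Pushing the target out to `far` does not enlarge its cut, and the target has only to keep
      -- containing the given set.
      set S₁ := S ∪ D.far lab
      have hS₁ : Sep lab S₁ := hS.union (D.isFar_far lab).sep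
      have hS₁d : D.cut S₁ ≤ d := (D.cut_union_far_le hS).trans hd
      have key : ∃ b < 2, ∀ lab', lab' = Function.update lab v (if b = 0 then 2 else 1) →
          Sep lab' S₁ ∧ D.conn lab + D.closed lab + 1 ≤ D.conn lab' + D.closed lab' := by
        by_cases hvS : v ∈ S₁
        -- Acceptance: `conn` grows because the vertex lies outside `far`; `far` grows as well, so
        -- no closed edge is lost.
        · refine ⟨1, by omega, ?_⟩
          rintro lab' hlab
          rw [if_neg one_ne_zero] at hlab
          have hs : Sep lab' S₁ := hlab ▸ sep_update_one hS₁ hvS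
          refine ⟨hs, ?_⟩
          have a1 := (D.isFar_far lab').sep
          have a2 : Sep lab (D.far lab') ∧ v ∈ D.far lab' := Sep.of_update_one h3 (hlab ▸ a1)
          have a3 : D.conn lab < D.conn lab' := D.conn_lt a2.1 a2.2 h2
          have a4 : D.far lab ⊆ D.far lab' := by
            refine (D.far_mono fun A hA => (Sep.of_update_one h3 (hlab ▸ hA)).1).resolve_right ?_
            rw [not_not, hlab]
            exact sep_update_one ((D.isFar_far lab).sep.union (hlab ▸ a2.1)) (Or.inr (hlab ▸ a2.2))
          have a5 : D.closed lab ≤ D.closed lab' := by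
            refine D.flux_mono a4 fun u hu => ?_
            have : u ≠ v := fun h => h3 (h ▸ hu)
            simpa [hlab, Function.update_apply, this] using hu
          omega
        -- Rejection: `far` avoids the vertex and remains the furthest smallest cut, so `conn` is
        -- unchanged and the frontier edge becomes closed.
        · refine ⟨0, by omega, ?_⟩
          rintro lab' hlab
          rw [if_pos rfl] at hlab
          have hs : Sep lab' S₁ := hlab ▸ sep_update_two hS₁ hvS
          refine ⟨hs, ?_⟩
          have hfar : D.IsFar lab' (D.far lab) := by
            have hsub : ∀ A, Sep lab' A → Sep lab A := fun A hA =>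
              (Sep.of_update_two hv1 (hlab ▸ hA)).1
            exact ⟨hlab ▸ sep_update_two (D.isFar_far lab).sep h2,
              fun A hA => (D.isFar_far lab).le A (hsub A hA),
              fun A hA => (D.isFar_far lab).max A (hsub A hA)⟩
          have a3 : D.conn lab' = D.conn lab := by rw [conn, ← hfar.eq_far, conn]
          have a5 : D.closed lab < D.closed lab' := by
            rw [closed, closed, ← hfar.eq_far]
            refine D.flux_lt (fun u hu => ?_) hp h1 ?_ h3
            · have : u ≠ v := fun h => h3 (h ▸ hu)
              simpa [hlab, Function.update_apply, this] using hu
            · simp [hlab, ← hv]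
          omega
      obtain ⟨b, hb, hkey⟩ := key
      have hstep : D.extStep d lab b = Function.update lab v (if b = 0 then 2 else 1) := by
        rw [extStep, if_pos ⟨hconn, hf⟩]
      obtain ⟨hs, hle⟩ := hkey _ hstep
      obtain ⟨w, hw, S', c1, c2, c3, c4, c5⟩ := ih _ S₁ hs hS₁d (by omega)
      have e1 : (b + B * w) % B = b := by
        rw [Nat.add_mul_mod_self_left, Nat.mod_eq_of_lt (by omega)]
      have e2 : (b + B * w) / B = w := by
        rw [Nat.add_mul_div_left _ _ (by omega), Nat.div_eq_of_lt (by omega), zero_add]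
      refine ⟨b + B * w, ?_, S', Set.subset_union_left.trans c1, ?_⟩
      · have : B * (w + 1) ≤ B * B ^ k := Nat.mul_le_mul_left _ hw
        rw [pow_succ, mul_comm _ B]
        rw [mul_add] at this
        omega
      · simp only [ext, e1, e2]
        refine ⟨c2, c3, c4, fun u hu => c5 u ?_⟩
        rw [hstep, Function.update_apply, if_neg fun h : u = v => hv1 (h ▸ hu)]
        exact hu

end Net

/-! ### Candidate terminals, collected greedily in disjoint blocks -/

namespace Inst

variable (J : Inst)

/-- The number of possible guesses. -/
def guesses : ℕ := J.base ^ J.len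

open Classical in
/-- The number of terminals in `A`. -/
noncomputable def tcount (A : Set ℕ) : ℕ := (J.T.filter (· ∈ A)).card

/-- A terminal that can be added to the list `H` because of the cut `S`. -/
def IsCand (lab : ℕ → ℕ) (H : List ℕ) (S : Set ℕ) (v : ℕ) : Prop :=
  v ∈ S ∧ v ∉ J.far lab ∧ v ∉ H

open Classical in
/-- Adds `t` new terminals of `S` to the list `H`, if there are so many. -/
noncomputable def mark (lab : ℕ → ℕ) (t : ℕ) (H : List ℕ) (S : Set ℕ) : List ℕ :=
  if t ≤ ((descList J.tl J.NT).filter (J.IsCand lab H S)).length then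
    H ++ ((descList J.tl J.NT).filter (J.IsCand lab H S)).take t
  else H

/-- The labels at the end of the enumeration for the terminal `s` and the guess `w`. -/
noncomputable def leaf (lab : ℕ → ℕ) (d s w : ℕ) : ℕ → ℕ :=
  J.ext J.base d J.len (Function.update lab s 1) w

open Classical in
/-- Adds the terminals of the cut that belongs to the terminal `s` and the guess `w`. -/
noncomputable def attempt (lab : ℕ → ℕ) (d t s w : ℕ) (H : List ℕ) : List ℕ :=
  if J.conn (J.leaf lab d s w) ≤ d then J.mark lab t H (J.far (J.leaf lab d s w)) else H

/-- The candidates for the next terminal of the sought side. -/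
noncomputable def cands (lab : ℕ → ℕ) (d t : ℕ) : List ℕ :=
  countdown (fun i => countdown (fun g => J.attempt lab d t (J.tl i) (g - 1)) J.guesses) J.NT []

open Classical in
/-- Adds one terminal to the sought side, guided by the digits of `g`. -/
noncomputable def level (lab : ℕ → ℕ) (g : ℕ) : ℕ → ℕ :=
  if h : g / J.base / J.base % J.base <
      (J.cands lab (g % J.base) (g / J.base % J.base)).length then
    Function.update lab
      ((J.cands lab (g % J.base) (g / J.base % J.base))[g / J.base / J.base % J.base]) 1
  else lab

/-- The search along the guess `g` finds a cut within `k` levels. -/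
def Finds : ℕ → (ℕ → ℕ) → ℕ → Prop
  | 0, _, _ => False
  | k + 1, lab, g => J.conn lab ≤ J.l ∧
      (J.c ≤ J.tcount (J.far lab) ∨ Finds k (J.level lab g) (g / J.base / J.base / J.base))

variable {J}

/-- A block of `t` terminals that belongs to a single cut with at most `d` edges. -/
structure IsBlock (J : Inst) (lab : ℕ → ℕ) (d t : ℕ) (b : List ℕ) : Prop where
  length : b.length = t
  exists_cut : ∃ S, Sep lab S ∧ J.cut S ≤ d ∧ ∀ v ∈ b, v ∈ S ∧ v ∈ J.T ∧ v ∉ J.far lab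

/-- The list is a concatenation of disjoint blocks. -/
def IsBlocks (J : Inst) (lab : ℕ → ℕ) (d t : ℕ) (H : List ℕ) : Prop :=
  H.Nodup ∧ ∃ bs : List (List ℕ), H = bs.flatten ∧ ∀ b ∈ bs, IsBlock J lab d t b

theorem prefix_mark (lab : ℕ → ℕ) (t : ℕ) (H : List ℕ) (S : Set ℕ) : H <+: J.mark lab t H S := by
  unfold mark
  split_ifs
  · exact List.prefix_append _ _
  · exact List.prefix_rfl

theorem prefix_attempt (lab : ℕ → ℕ) (d t s w : ℕ) (H : List ℕ) :
    H <+: J.attempt lab d t s w H := by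
  unfold attempt
  split_ifs
  · exact prefix_mark _ _ _ _
  · exact List.prefix_rfl

/-- Terminals are added only `t` at a time, from a single cut and not yet in the list, so an
addition is exactly one new disjoint block. -/
theorem IsBlocks.mark {lab : ℕ → ℕ} {d t : ℕ} {H : List ℕ} {S : Set ℕ}
    (h : IsBlocks J lab d t H) (hS : Sep lab S) (hd : J.cut S ≤ d) :
    IsBlocks J lab d t (J.mark lab t H S) := by
  classical
  unfold Inst.mark
  split_ifs with ht
  · obtain ⟨h1, bs, h2, h3⟩ := h
    set F := (descList J.tl J.NT).filter (J.IsCand lab H S)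
    have hF : ∀ v ∈ F.take t, J.IsCand lab H S v ∧ v ∈ J.T := fun v hv => by
      have := List.mem_of_mem_take hv
      simp only [F, List.mem_filter, mem_descList, decide_eq_true_eq] at this
      obtain ⟨⟨i, a, b, c⟩, e⟩ := this
      exact ⟨e, c ▸ (J.tl_mem i a b).1⟩
    refine ⟨?_, bs ++ [F.take t], by simp [h2], ?_⟩
    · refine List.nodup_append.2 ⟨h1, ?_, ?_⟩
      · exact ((nodup_descList J.tl_inj).filter _).sublist (List.take_sublist _ _)
      · rintro a ha b hb rfl
        exact (hF a hb).1.2.2 ha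
    · intro b hb
      rw [List.mem_append, List.mem_singleton] at hb
      obtain hb | rfl := hb
      · exact h3 b hb
      · exact ⟨by simp [ht], S, hS, hd, fun v hv => ⟨(hF v hv).1.1, (hF v hv).2, (hF v hv).1.2.1⟩⟩
  · exact h

theorem sep_of_sep_leaf {lab : ℕ → ℕ} {d s w : ℕ} {A : Set ℕ} (hs : lab s ≠ 2)
    (h : Sep (J.leaf lab d s w) A) : Sep lab A ∧ s ∈ A :=
  Sep.of_update_one hs (J.sep_of_sep_ext h)

theorem IsBlocks.attempt {lab : ℕ → ℕ} {d t s w : ℕ} {H : List ℕ} (hs : lab s ≠ 2)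
    (h : IsBlocks J lab d t H) : IsBlocks J lab d t (J.attempt lab d t s w H) := by
  unfold Inst.attempt
  split_ifs with h1
  · exact h.mark (sep_of_sep_leaf hs (J.isFar_far _).sep).1 h1
  · exact h

/-- Greedy maximality: either the list already meets `F`, or all of `F` is new, in which case there
are enough candidates and `t ≥ 1` of them are added. In both cases the list ends up with an element
of `S`. -/
theorem exists_mem_mark {lab : ℕ → ℕ} {t : ℕ} {H : List ℕ} {S : Set ℕ} (ht : 1 ≤ t)
    {F : Finset ℕ} (hF : t ≤ F.card)
    (h : ∀ v ∈ F, v ∈ S ∧ v ∈ J.T ∧ v ∈ J.verts ∧ v ∉ J.far lab) :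
    ∃ v ∈ S, v ∈ J.mark lab t H S := by
  classical
  by_cases hex : ∃ v ∈ F, v ∈ H
  · obtain ⟨v, hv, hvH⟩ := hex
    exact ⟨v, (h v hv).1, (prefix_mark lab t H S).subset hvH⟩
  · push Not at hex
    set C := (descList J.tl J.NT).filter (J.IsCand lab H S) with hC
    have hFC : F ⊆ C.toFinset := by
      intro v hv
      obtain ⟨h1, h2, h3, h4⟩ := h v hv
      simp only [hC, List.mem_toFinset, List.mem_filter, mem_descList, decide_eq_true_eq]
      exact ⟨J.exists_tl v h2 h3, h1, h4, hex v hv⟩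
    have hlen : t ≤ C.length := hF.trans ((Finset.card_le_card hFC).trans C.toFinset_card_le)
    have hm : J.mark lab t H S = H ++ C.take t := by rw [mark, if_pos hlen]
    obtain ⟨v, hv⟩ : ∃ v, v ∈ C.take t := by
      refine List.exists_mem_of_length_pos ?_
      rw [List.length_take]
      omega
    refine ⟨v, ?_, by rw [hm]; exact List.mem_append_right _ hv⟩
    have := List.mem_of_mem_take hv
    simp only [hC, List.mem_filter, decide_eq_true_eq] at this
    exact this.2.1

theorem prefix_countdown {f : ℕ → List ℕ → List ℕ} (hf : ∀ i H, H <+: f i H) (k : ℕ)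
    (H : List ℕ) : H <+: countdown f k H := by
  induction k generalizing H with
  | zero => exact List.prefix_rfl
  | succ k ih => exact (hf _ _).trans (ih _)

theorem countdown_induction {α : Type*} {f : ℕ → α → α} {P : α → Prop} {k : ℕ}
    (hf : ∀ i a, 1 ≤ i → i ≤ k → P a → P (f i a)) {a : α} (ha : P a) : P (countdown f k a) := by
  induction k generalizing a with
  | zero => exact ha
  | succ k ih =>
    exact ih (fun i a h1 h2 => hf i a h1 (by omega)) (hf _ _ (by omega) le_rfl ha)

/-- Later rounds only extend the list, so what round `i` has put there survives, whatever list that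
round started from. -/
theorem countdown_at {f : ℕ → List ℕ → List ℕ} (hf : ∀ i H, H <+: f i H) {k i : ℕ} (h1 : 1 ≤ i)
    (h2 : i ≤ k) (H : List ℕ) : ∃ H', f i H' <+: countdown f k H := by
  induction k generalizing H with
  | zero => omega
  | succ k ih =>
    obtain rfl | h := h2.eq_or_lt
    · exact ⟨H, prefix_countdown hf _ _⟩
    · exact ih (by omega) _

theorem isBlocks_cands {lab : ℕ → ℕ} {d t : ℕ} (hT : ∀ v ∈ J.T, lab v ≠ 2) :
    IsBlocks J lab d t (J.cands lab d t) :=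
  countdown_induction (fun i _ h1 h2 ha =>
    countdown_induction (fun _ _ _ _ hb => hb.attempt (hT _ (J.tl_mem i h1 h2).1)) ha)
    ⟨List.nodup_nil, [], rfl, by simp⟩

theorem exists_mem_cands {lab : ℕ → ℕ} {d t s w : ℕ} (ht : 1 ≤ t) (hs : s ∈ J.T)
    (hs' : s ∈ J.verts) (hw : w < J.guesses) (hd : J.conn (J.leaf lab d s w) ≤ d)
    {F : Finset ℕ} (hF : t ≤ F.card)
    (h : ∀ v ∈ F, v ∈ J.far (J.leaf lab d s w) ∧ v ∈ J.T ∧ v ∈ J.verts ∧ v ∉ J.far lab) :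
    ∃ v ∈ J.far (J.leaf lab d s w), v ∈ J.cands lab d t := by
  obtain ⟨i, h1, h2, rfl⟩ := J.exists_tl s hs hs'
  have p1 : ∀ i g H, H <+: J.attempt lab d t (J.tl i) (g - 1) H := fun i g H =>
    prefix_attempt _ _ _ _ _ _
  obtain ⟨H₁, hH₁⟩ := countdown_at (fun i H => prefix_countdown (p1 i) J.guesses H) h1 h2 []
  -- Rounds count down to `1` and round `g` tries the guess `g - 1`, so `w` belongs to round `w +
  -- 1`.
  obtain ⟨H₂, hH₂⟩ := countdown_at (p1 i) (show 1 ≤ w + 1 by omega) hw H₁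
  obtain ⟨v, hv, hv'⟩ := exists_mem_mark (H := H₂) ht hF h
  refine ⟨v, hv, hH₁.subset (hH₂.subset ?_)⟩
  rw [Nat.add_sub_cancel, attempt, if_pos hd]
  exact hv'

end Inst

/-! ### The exchange argument and the correctness of the search -/

namespace Inst

variable {J : Inst}

/-- A side as it is sought, except that it need only respect the labels. -/
structure IsSide (J : Inst) (lab : ℕ → ℕ) (A : Set ℕ) : Prop where
  sep : Sep lab A
  cut_le : J.cut A ≤ J.l
  le_tcount : J.c ≤ J.tcount A

theorem tcount_mono {A B : Set ℕ} (h : A ⊆ B) : J.tcount A ≤ J.tcount B := by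
  classical
  refine Finset.card_le_card fun v hv => ?_
  simp only [Finset.mem_filter] at hv ⊢
  exact ⟨hv.1, h hv.2⟩

theorem tcount_lt {A B : Set ℕ} {v : ℕ} (h : A ⊆ B) (hv : v ∈ J.T) (h1 : v ∈ B) (h2 : v ∉ A) :
    J.tcount A < J.tcount B := by
  classical
  refine Finset.card_lt_card ⟨fun v hv => ?_, fun h' => ?_⟩
  · simp only [Finset.mem_filter] at hv ⊢
    exact ⟨hv.1, h hv.2⟩
  · have := h' (Finset.mem_filter.2 ⟨hv, h1⟩)
    exact h2 (Finset.mem_filter.1 this).2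

theorem tcount_add_card_le {A B : Set ℕ} {F : Finset ℕ} (hA : A ⊆ B)
    (hF : ∀ v ∈ F, v ∈ J.T ∧ v ∈ B ∧ v ∉ A) : J.tcount A + F.card ≤ J.tcount B := by
  classical
  unfold tcount
  rw [← Finset.card_union_of_disjoint]
  · refine Finset.card_le_card fun v hv => ?_
    simp only [Finset.mem_filter, Finset.mem_union] at hv ⊢
    obtain ⟨h1, h2⟩ | h := hv
    · exact ⟨h1, hA h2⟩
    · exact ⟨(hF v h).1, (hF v h).2.1⟩
  · rw [Finset.disjoint_left]
    intro v hv hv'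
    exact (hF v hv').2.2 (Finset.mem_filter.1 hv).2

theorem tcount_le_add {A C : Set ℕ} {F : Finset ℕ} (hF : ∀ v ∈ J.T, v ∈ C → v ∈ F) :
    J.tcount A ≤ J.tcount (A \ C) + F.card := by
  classical
  unfold tcount
  refine (Finset.card_le_card fun v hv => ?_).trans (Finset.card_union_le _ _)
  simp only [Finset.mem_filter, Finset.mem_union, Set.mem_sdiff] at hv ⊢
  by_cases h : v ∈ C
  · exact Or.inr (hF v hv.1 h)
  · exact Or.inl ⟨hv.1, hv.2, h⟩

/-- Disjoint blocks outnumber the terminals of a small set. -/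
theorem exists_block_disjoint {bs : List (List ℕ)} (hbs : bs.flatten.Nodup) {A : Set ℕ}
    (hT : ∀ b ∈ bs, ∀ v ∈ b, v ∈ J.T) (h : J.tcount A < bs.length) :
    ∃ b ∈ bs, ∀ v ∈ b, v ∉ A := by
  classical
  induction bs generalizing A with
  | nil => simp at h
  | cons b bs ih =>
    by_cases hb : ∀ v ∈ b, v ∉ A
    · exact ⟨b, by simp, hb⟩
    · push Not at hb
      obtain ⟨v, hv, hvA⟩ := hb
      rw [List.flatten_cons, List.nodup_append] at hbs
      -- A block that meets `A` uses up a terminal of `A` that, by disjointness, no later block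
      -- contains.
      have h1 : J.tcount (A \ {v}) < J.tcount A :=
        tcount_lt Set.sdiff_subset (hT b (by simp) v hv) hvA (by simp)
      rw [List.length_cons] at h
      obtain ⟨b', h2, h3⟩ := ih hbs.2.1 (A := A \ {v})
        (fun b' hb' => hT b' (List.mem_cons_of_mem _ hb')) (by omega)
      refine ⟨b', List.mem_cons_of_mem _ h2, fun u hu huA => h3 u hu ⟨huA, ?_⟩⟩
      rintro rfl
      exact hbs.2.2 u hv u (List.mem_flatten.2 ⟨b', h2, hu⟩) rfl

theorem length_flatten_le {bs : List (List ℕ)} {t : ℕ} (h : ∀ b ∈ bs, b.length = t) :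
    bs.flatten.length = bs.length * t := by
  induction bs with
  | nil => simp
  | cons b bs ih =>
    rw [List.flatten_cons, List.length_append, ih fun b hb => h b (List.mem_cons_of_mem _ hb),
      h b (by simp), List.length_cons]
    ring

/-- One of the first candidates lies in a side. -/
theorem exists_cand {lab : ℕ → ℕ} (hT : ∀ v ∈ J.T, lab v ≠ 2) {A : Set ℕ} (hA : IsSide J lab A)
    (hfar : J.tcount (J.far lab) < J.c) :
    ∃ d t j, d < J.base ∧ t < J.base ∧ j < J.base ∧ ∃ hj : j < (J.cands lab d t).length,
      (J.cands lab d t)[j] ∉ J.far lab ∧ (J.cands lab d t)[j] ∈ J.T ∧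
      ∃ A', IsSide J lab A' ∧ (J.cands lab d t)[j] ∈ A' := by
  classical
  set M := J.far lab with hM
  have hMfar := J.isFar_far lab
  -- a side that contains `M`, with as few terminals as possible
  obtain ⟨A, ⟨hA, hMA⟩, hmin⟩ := WellFounded.has_min (measure J.tcount).wf
    {A | IsSide J lab A ∧ M ⊆ A}
    ⟨A ∪ M, ⟨hA.sep.union hMfar.sep, (J.cut_union_far_le hA.sep).trans hA.cut_le,
      hA.le_tcount.trans (tcount_mono Set.subset_union_left)⟩, Set.subset_union_right⟩
  obtain ⟨s, hsT, hsA, hsM⟩ : ∃ s ∈ J.T, s ∈ A ∧ s ∉ M := by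
    by_contra! h
    have : J.tcount A ≤ J.tcount M := by
      refine Finset.card_le_card fun v hv => ?_
      simp only [Finset.mem_filter] at hv ⊢
      exact ⟨hv.1, h v hv.1 hv.2⟩
    have := hA.le_tcount
    omega
  -- `C` below is the component of `s` in the graph induced on `A \ M`, described by reachability so
  -- that statements about it follow by induction along paths.
  set R : ℕ → ℕ → Prop := fun u v => (∃ p ∈ Finset.Icc 1 J.N, J.src p = u ∧ J.dst p = v) ∧
    v ∈ A ∧ v ∉ M with hR
  set C : Set ℕ := {v | Relation.ReflTransGen R s v} with hC
  have hsC : s ∈ C := Relation.ReflTransGen.refl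
  have hCA : ∀ v ∈ C, v ∈ A ∧ v ∉ M := fun v hv => by
    obtain rfl | ⟨u, _, h⟩ := Relation.ReflTransGen.cases_tail hv
    · exact ⟨hsA, hsM⟩
    · exact h.2
  have hCM : Disjoint C M := Set.disjoint_left.2 fun v hv => (hCA v hv).2
  have hmod := J.cut_union_add_cut_diff hMA (fun v hv => (hCA v hv).1) hCM
    fun p hp h1 h2 h3 => Relation.ReflTransGen.tail h1 ⟨⟨p, hp, rfl, rfl⟩, h2, h3⟩
  have hMAC : M ⊆ A \ C := fun v hv => ⟨hMA hv, fun h => (hCA v h).2 hv⟩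
  have hAC : Sep lab (A \ C) := fun v =>
    ⟨fun h => hMAC ((hMfar.sep v).1 h), fun h h' => (hA.sep v).2 h h'.1⟩
  have hMC : Sep lab (M ∪ C) := fun v =>
    ⟨fun h => Or.inl ((hMfar.sep v).1 h),
      fun h h' => (hA.sep v).2 h (h'.elim (fun h => hMA h) fun h => (hCA v h).1)⟩
  have hACle := J.conn_le hAC
  have hMCle := J.conn_le hMC
  have hconn : J.cut M = J.conn lab := rfl
  have hAl := hA.cut_le
  have hll := J.l_le
  -- Since `M ∪ C` costs at least as much as `M`, the uncrossing inequality makes `A \ C` no more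
  -- expensive than `A`. With `c` terminals it would be a side with fewer terminals than `A`, as it
  -- lacks `s`.
  have hACt : J.tcount (A \ C) < J.c := by
    by_contra! h
    refine hmin (A \ C) ⟨⟨hAC, by omega, h⟩, hMAC⟩ ?_
    exact tcount_lt Set.sdiff_subset hsT hsA fun h => h.2 hsC
  -- exchanging `C` for a cut `S`
  set d := J.cut (M ∪ C) with hd
  have hexch : ∀ S, Sep lab S → J.cut S ≤ d → Sep lab (A \ C ∪ S) ∧ J.cut (A \ C ∪ S) ≤ J.l := by
    intro S hS hSd
    refine ⟨hAC.union hS, ?_⟩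
    -- The intersection costs at least `conn`, so the union costs at most the cut of `A \ C` plus `d
    -- - conn`, which by `hmod` is at most the cut of `A`.
    have h1 := J.cut_union_add_cut_inter (A \ C) S
    have h2 := J.conn_le (hAC.inter hS)
    omega
  set F : Finset ℕ := J.T.filter (· ∈ C) with hF
  -- The cap at `c` keeps `c` blocks within `c * c` entries; more than `c` terminals are never
  -- needed from one block.
  set t := min J.c F.card with ht
  have hFpos : 1 ≤ F.card := Finset.card_pos.2 ⟨s, by simp [hF, hsT, hsC]⟩
  have hcpos : 1 ≤ J.c := by omega
  have ht1 : 1 ≤ t := by omega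
  have hverts : ∀ v ∈ J.T, v ∉ M → v ∈ J.verts := fun v h1 h2 => by
    by_contra h
    exact h2 (J.mem_far_of_notMem_verts h (hT v h1))
  have hbase := J.base_eq
  have hcc : J.c ≤ J.c * J.c := Nat.le_mul_of_pos_left _ hcpos
  obtain ⟨hnd, bs, hbs, hblock⟩ := isBlocks_cands (J := J) (lab := lab) (d := d) (t := t) hT
  -- At most `c` blocks of at most `c` entries: the position of the candidate is less than the base
  -- and can be guessed as one digit.
  have hindex : ∀ bs' : List (List ℕ), bs' <+: bs → bs'.length ≤ J.c → ∀ h ∈ bs'.flatten,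
      ∃ j, j < J.base ∧ ∃ hj : j < (J.cands lab d t).length, (J.cands lab d t)[j] = h := by
    intro bs' hpre hlen h hh
    obtain ⟨j, hj, hjh⟩ := List.mem_iff_getElem.1 hh
    have hpre' : bs'.flatten <+: J.cands lab d t := by
      rw [hbs]
      obtain ⟨r, rfl⟩ := hpre
      rw [List.flatten_append]
      exact List.prefix_append _ _
    have hl : bs'.flatten.length = bs'.length * t :=
      length_flatten_le fun b hb => (hblock b (hpre.subset hb)).length
    have hl' : bs'.length * t ≤ J.c * J.c := Nat.mul_le_mul hlen (min_le_left _ _)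
    refine ⟨j, by omega, hj.trans_le hpre'.length_le, ?_⟩
    rw [← hjh, hpre'.getElem]
  have hgoal : ∀ bs' : List (List ℕ), bs' <+: bs → bs'.length ≤ J.c → ∀ h ∈ bs'.flatten,
      ∀ A', IsSide J lab A' → h ∈ A' →
      ∃ d t j, d < J.base ∧ t < J.base ∧ j < J.base ∧ ∃ hj : j < (J.cands lab d t).length,
        (J.cands lab d t)[j] ∉ J.far lab ∧ (J.cands lab d t)[j] ∈ J.T ∧
        ∃ A', IsSide J lab A' ∧ (J.cands lab d t)[j] ∈ A' := by
    intro bs' hpre hlen h hh A' hA' hhA'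
    obtain ⟨j, h1, hj, hjh⟩ := hindex bs' hpre hlen h hh
    obtain ⟨b, hb, hhb⟩ := List.mem_flatten.1 hh
    obtain ⟨S, _, _, hS⟩ := (hblock b (hpre.subset hb)).exists_cut
    refine ⟨d, t, j, by omega, by omega, h1, hj, ?_⟩
    rw [hjh]
    exact ⟨(hS h hhb).2.2, (hS h hhb).2.1, A', hA', hhA'⟩
  by_cases hK : J.c ≤ bs.length
  -- Many blocks: `A \ C` has fewer than `c` terminals, so one of the first `c` blocks avoids it.
  · obtain ⟨b, hb, hbA⟩ := exists_block_disjoint (bs := bs.take J.c) (A := A \ C)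
      ((hbs ▸ hnd).sublist (List.take_sublist _ _).flatten)
      (fun b hb v hv => by
        obtain ⟨S, _, _, hS⟩ := (hblock b (List.mem_of_mem_take hb)).exists_cut
        exact (hS v hv).2.1) (by rw [List.length_take]; omega)
    have hb' := hblock b (List.mem_of_mem_take hb)
    obtain ⟨S, hS1, hS2, hS3⟩ := hb'.exists_cut
    obtain ⟨h, hh⟩ := List.exists_mem_of_length_pos (l := b) (by rw [hb'.length]; omega)
    obtain ⟨e1, e2⟩ := hexch S hS1 hS2
    refine hgoal (bs.take J.c) (List.take_prefix _ _) (by rw [List.length_take]; omega) h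
      (List.mem_flatten.2 ⟨b, hb, hh⟩) (A \ C ∪ S) ⟨e1, e2, ?_⟩ (Or.inr (hS3 h hh).1)
    have hbnd : b.Nodup := by
      refine List.Nodup.sublist ?_ (hbs ▸ hnd)
      exact List.sublist_flatten_of_mem (List.mem_of_mem_take hb)
    have h1 := tcount_add_card_le (J := J) (A := A \ C) (B := A \ C ∪ S) (F := b.toFinset)
      Set.subset_union_left fun v hv => by
        rw [List.mem_toFinset] at hv
        exact ⟨(hS3 v hv).2.1, Or.inr (hS3 v hv).1, hbA v hv⟩
    rw [List.toFinset_card_of_nodup hbnd, hb'.length] at h1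
    -- If `t = c`, the block alone suffices. Otherwise `t` is the number of terminals of `C`, and
    -- the block replaces exactly what was removed.
    have h2 : J.tcount A ≤ J.tcount (A \ C) + F.card :=
      tcount_le_add fun v h1 h2 => Finset.mem_filter.2 ⟨h1, h2⟩
    have := hA.le_tcount
    omega
  -- Few blocks: all positions are small, and it remains to see that a useful candidate was
  -- collected. The enumeration from `s` is aimed at `M ∪ C`; by `hmod` one has `d ≤ l ≤ c`, so its
  -- `3 * c + 3` steps exceed the `2 * d` required.
  · set lab₁ := Function.update lab s 1
    obtain ⟨w, hw, S', g1, g2, g3, g4, g5⟩ := J.exists_ext (B := J.base) (d := d) (by omega)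
      J.len lab₁
      (M ∪ C) (sep_update_one hMC (Or.inr hsC)) le_rfl (by have := J.len_eq; omega)
    change Sep (J.leaf lab d s w) S' at g2
    change J.front (J.leaf lab d s w) = 0 at g4
    change ∀ v, lab₁ v = 1 → J.leaf lab d s w v = 1 at g5
    set S := J.far (J.leaf lab d s w) with hSdef
    have hSfar := J.isFar_far (J.leaf lab d s w)
    have hSd : J.cut S ≤ d := (J.conn_le g2).trans g3
    have hSlab := sep_of_sep_leaf (hT s hsT) hSfar.sep
    -- No undecided edge leaves `S`, and no vertex of `C` is forbidden because the target `S'`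
    -- contains `C` and respects the labels. So a path inside `C` that starts at `s ∈ S` cannot
    -- leave `S`.
    have hCS : ∀ v ∈ C, v ∈ S := by
      intro v hv
      induction hv with
      | refl => exact hSlab.2
      | @tail u v hu huv ih =>
        obtain ⟨⟨p, hp, rfl, rfl⟩, h1, h2⟩ := huv
        by_contra hvS
        refine (J.front_spec _).2 g4 p hp ⟨ih, hvS, fun h => (g2 _).2 h (g1 ?_)⟩
        exact Or.inr (Relation.ReflTransGen.tail hu ⟨⟨p, hp, rfl, rfl⟩, h1, h2⟩)
    obtain ⟨h, hhS, hh⟩ := exists_mem_cands ht1 hsT (hverts s hsT hsM) hw hSd (F := F)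
      (min_le_right _ _) fun v hv => by
        obtain ⟨h1, h2⟩ := Finset.mem_filter.1 hv
        exact ⟨hCS v h2, h1, hverts v h1 (hCA v h2).2, (hCA v h2).2⟩
    obtain ⟨e1, e2⟩ := hexch S hSlab.1 hSd
    refine hgoal bs List.prefix_rfl (by omega) h (hbs ▸ hh) (A \ C ∪ S) ⟨e1, e2, ?_⟩ (Or.inr hhS)
    -- As `S` contains `C`, the exchange loses no vertex of `A`.
    refine hA.le_tcount.trans (tcount_mono fun v hv => ?_)
    by_cases hvC : v ∈ C
    · exact Or.inr (hCS v hvC)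
    · exact Or.inl ⟨hv, hvC⟩

/-- Some guess leads to a side, if there is one. -/
theorem exists_finds (k : ℕ) {lab : ℕ → ℕ} (hT : ∀ v ∈ J.T, lab v ≠ 2) {A : Set ℕ}
    (hA : IsSide J lab A) (hk : J.l < k + J.conn lab) :
    ∃ g < J.base ^ (3 * k), J.Finds k lab g := by
  induction k generalizing lab A with
  | zero =>
    have h1 := J.conn_le hA.sep
    have h2 := hA.cut_le
    omega
  | succ k ih =>
    have hconn := (J.conn_le hA.sep).trans hA.cut_le
    have hbase := J.base_eq
    have hpos : 0 < J.base := by omega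
    by_cases hfar : J.c ≤ J.tcount (J.far lab)
    · exact ⟨0, by positivity, hconn, Or.inl hfar⟩
    · obtain ⟨d, t, j, hd, ht, hj, hj', h1, h2, A', hA', h3⟩ := exists_cand hT hA (not_le.1 hfar)
      set h := (J.cands lab d t)[j] with hh
      have hsep := sep_update_one hA'.sep h3
      -- The chosen terminal lies outside `far`, so fixing it raises `conn` and compensates for the
      -- level spent.
      have hlt : J.conn lab < J.conn (Function.update lab h 1) := by
        have h4 := Sep.of_update_one (hT h h2) (J.isFar_far (Function.update lab h 1)).sep
        exact J.conn_lt h4.1 h4.2 h1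
      obtain ⟨g, hg, hgf⟩ := ih (lab := Function.update lab h 1) (fun v hv => by
          rw [Function.update_apply]
          split_ifs
          · omega
          · exact hT v hv) ⟨hsep, hA'.cut_le, hA'.le_tcount⟩ (by omega)
      have hdiv : ∀ a x, a < J.base → (a + J.base * x) % J.base = a ∧
          (a + J.base * x) / J.base = x := fun a x ha => by
        rw [Nat.add_mul_mod_self_left, Nat.mod_eq_of_lt ha, Nat.add_mul_div_left _ _ hpos,
          Nat.div_eq_of_lt ha, zero_add]
        exact ⟨rfl, rfl⟩
      obtain ⟨a1, a2⟩ := hdiv d (t + J.base * (j + J.base * g)) hd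
      obtain ⟨b1, b2⟩ := hdiv t (j + J.base * g) ht
      obtain ⟨c1, c2⟩ := hdiv j g hj
      have hstep : ∀ a x y, a < J.base → x < y → a + J.base * x < J.base * y := by
        intro a x y ha hx
        have : J.base * (x + 1) ≤ J.base * y := Nat.mul_le_mul_left _ hx
        rw [mul_add] at this
        omega
      -- The three choices of this level are the lowest digits, and the guess for the remaining
      -- levels sits above them.
      refine ⟨d + J.base * (t + J.base * (j + J.base * g)), ?_, hconn, Or.inr ?_⟩
      · have := hstep d _ _ hd (hstep t _ _ ht (hstep j _ _ hj hg))
        rw [show 3 * (k + 1) = 3 * k + 1 + 1 + 1 by ring, pow_succ, pow_succ, pow_succ]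
        calc _ < _ := this
          _ = _ := by ring
      · rw [a2, b2, c2]
        have : J.level lab (d + J.base * (t + J.base * (j + J.base * g))) =
            Function.update lab h 1 := by
          unfold level
          simp only [a1, a2, b1, b2, c1]
          rw [dif_pos hj']
        rwa [this]

end Inst

/-! ### The data structures of the search -/

/-- An instance together with the lists that represent it in memory: `vl 1, …, vl NV` are the ends
of edges, and the half-edges out of `v` are `head v`, `nxt (head v)`, …, in decreasing order. -/
structure Layout extends Inst where
  n : ℕ
  NV : ℕ
  swap : ℕ
  nxt : ℕ → ℕ
  head : ℕ → ℕ
  vl : ℕ → ℕ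
  lab₀ : ℕ → ℕ
  T_lt : ∀ v ∈ T, v < n
  nxt_le : ∀ p ∈ Finset.Icc 1 N, nxt p < p
  src_nxt : ∀ p ∈ Finset.Icc 1 N, nxt p ≠ 0 → src (nxt p) = src p
  le_nxt : ∀ p ∈ Finset.Icc 1 N, ∀ q ∈ Finset.Icc 1 N, src q = src p → q < p → q ≤ nxt p
  head_mem : ∀ p ∈ Finset.Icc 1 N, head (src p) ∈ Finset.Icc 1 N
  src_head : ∀ p ∈ Finset.Icc 1 N, src (head (src p)) = src p
  le_head : ∀ p ∈ Finset.Icc 1 N, p ≤ head (src p)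
  vl_mem : ∀ i, 1 ≤ i → i ≤ NV → vl i ∈ toNet.verts
  exists_vl : ∀ v ∈ toNet.verts, ∃ i, 1 ≤ i ∧ i ≤ NV ∧ vl i = v
  vl_inj : ∀ i j, 1 ≤ i → i ≤ NV → 1 ≤ j → j ≤ NV → vl i = vl j → i = j
  lab₀_le : ∀ v, lab₀ v ≤ 2
  lab₀_ne : ∀ v ∈ T, lab₀ v ≠ 2

namespace Layout

variable (Λ : Layout)

theorem NV_le : Λ.NV ≤ Λ.N := by
  have h : (Finset.Icc 1 Λ.NV).card ≤ Λ.verts.card := by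
    refine Finset.card_le_card_of_injOn Λ.vl ?_ ?_
    · intro i hi
      simp only [Finset.coe_Icc, Set.mem_Icc] at hi
      exact Λ.vl_mem i hi.1 hi.2
    · intro i hi j hj h
      simp only [Finset.coe_Icc, Set.mem_Icc] at hi hj
      exact Λ.vl_inj i j hi.1 hi.2 hj.1 hj.2 h
  simpa using h.trans Λ.card_verts_le

/-- Labels that differ from the initial ones only at ends of edges. -/
structure IsLab (lab : ℕ → ℕ) : Prop where
  le : ∀ v, lab v ≤ 2
  eq : ∀ v, v ∉ Λ.verts → lab v = Λ.lab₀ v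

variable {Λ}

theorem IsLab.update {lab : ℕ → ℕ} (h : Λ.IsLab lab) {v x : ℕ} (hv : v ∈ Λ.verts) (hx : x ≤ 2) :
    Λ.IsLab (Function.update lab v x) := by
  constructor
  · intro u
    rw [Function.update_apply]
    split_ifs
    · exact hx
    · exact h.le u
  · intro u hu
    rw [Function.update_apply, if_neg fun e : u = v => hu (e ▸ hv)]
    exact h.eq u hu

variable (Λ)

/-- `vis` is right at the vertices that are not ends of edges. -/
def IsVis (vis : ℕ → ℕ) : Prop := ∀ v, v ∉ Λ.verts → vis v = if Λ.lab₀ v = 2 then 1 else 0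

/-- The invariant of the graph search. The half-edges in `P` have been processed; `ρ` is the
position of a vertex in the queue `que 0, …, que (qt - 1)`, from which `qh` vertices have been
taken; `cur` is the next half-edge to be processed. -/
structure SearchInv (lab res : ℕ → ℕ) (P : Finset ℕ) (ρ vis que par : ℕ → ℕ)
    (qh qt cur fnd fx : ℕ) : Prop where
  vis_le : ∀ v, vis v ≤ 1
  vis_two : ∀ v, lab v = 2 → vis v ≠ 0
  isVis : Λ.IsVis vis
  queue : ∀ i < qt, que i ∈ Λ.verts ∧ vis (que i) ≠ 0 ∧ ρ (que i) = i
  rank : ∀ v ∈ Λ.verts, vis v ≠ 0 → ρ v < qt ∧ que (ρ v) = v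
  parent : ∀ v, vis v ≠ 0 → lab v ≠ 2 → par v ∈ Finset.Icc 1 Λ.N ∧ Λ.src (par v) = v ∧
    res (par v) ≠ 0 ∧ vis (Λ.dst (par v)) ≠ 0 ∧ ρ (Λ.dst (par v)) < ρ v
  qh_le : qh ≤ qt
  done : ∀ p ∈ P, p ∈ Finset.Icc 1 Λ.N ∧ vis (Λ.src p) ≠ 0 ∧ ρ (Λ.src p) < qh ∧
    (vis (Λ.dst p) ≠ 0 ∨ res (Λ.rev p) = 0) ∧ (cur ≠ 0 → Λ.src p = Λ.src cur → cur < p)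
  current : cur ≠ 0 → cur ∈ Finset.Icc 1 Λ.N ∧ vis (Λ.src cur) ≠ 0 ∧ ρ (Λ.src cur) < qh
  cover : ∀ p ∈ Finset.Icc 1 Λ.N, vis (Λ.src p) ≠ 0 →
    p ∈ P ∨ qh ≤ ρ (Λ.src p) ∨ (cur ≠ 0 ∧ Λ.src p = Λ.src cur ∧ p ≤ cur)
  not_found : fnd = 0 → ∀ v, lab v = 1 → vis v = 0
  found : fnd ≠ 0 → lab fx = 1 ∧ vis fx ≠ 0

/-- The invariant of the initialisation of the search, which runs through the vertices
`vl NV, …, vl 1` and has reached `vl k`. -/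
structure InitInv (lab : ℕ → ℕ) (k : ℕ) (ρ vis que : ℕ → ℕ) (qt : ℕ) : Prop where
  le : k ≤ Λ.NV
  isVis : ∀ v, v ∉ Λ.verts → vis v = if lab v = 2 then 1 else 0
  vis : ∀ j, k < j → j ≤ Λ.NV → vis (Λ.vl j) = if lab (Λ.vl j) = 2 then 1 else 0
  queue : ∀ i < qt, lab (que i) = 2 ∧ ρ (que i) = i ∧ ∃ j, k < j ∧ j ≤ Λ.NV ∧ Λ.vl j = que i
  rank : ∀ j, k < j → j ≤ Λ.NV → lab (Λ.vl j) = 2 → ρ (Λ.vl j) < qt ∧ que (ρ (Λ.vl j)) = Λ.vl j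

theorem InitInv.skip {Λ : Layout} {lab ρ vis que : ℕ → ℕ} {k qt : ℕ}
    (h : Λ.InitInv lab (k + 1) ρ vis que qt) (hl : lab (Λ.vl (k + 1)) ≠ 2) :
    Λ.InitInv lab k ρ (Function.update vis (Λ.vl (k + 1)) 0) que qt := by
  have hk := h.le
  have hmem := Λ.vl_mem (k + 1) (by omega) hk
  constructor
  · omega
  · intro v hv
    rw [Function.update_apply, if_neg fun e : v = _ => hv (e ▸ hmem)]
    exact h.isVis v hv
  · intro j h1 h2
    rw [Function.update_apply]
    split_ifs with e e' e'
    · exact absurd (e ▸ e') hl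
    · rfl
    · rw [h.vis j (by by_contra h3; exact e (by rw [show j = k + 1 by omega])) h2, if_pos e']
    · rw [h.vis j (by by_contra h3; exact e (by rw [show j = k + 1 by omega])) h2, if_neg e']
  · intro i hi
    obtain ⟨a1, a2, j, a3, a4, a5⟩ := h.queue i hi
    exact ⟨a1, a2, j, by omega, a4, a5⟩
  · intro j h1 h2 h3
    refine h.rank j ?_ h2 h3
    by_contra h4
    rw [show j = k + 1 by omega] at h3
    exact hl h3

theorem InitInv.push {Λ : Layout} {lab ρ vis que : ℕ → ℕ} {k qt : ℕ}
    (h : Λ.InitInv lab (k + 1) ρ vis que qt) (hl : lab (Λ.vl (k + 1)) = 2) :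
    Λ.InitInv lab k (Function.update ρ (Λ.vl (k + 1)) qt) (Function.update vis (Λ.vl (k + 1)) 1)
      (Function.update que qt (Λ.vl (k + 1))) (qt + 1) := by
  have hk := h.le
  have hmem := Λ.vl_mem (k + 1) (by omega) hk
  have hne : ∀ j, k + 1 < j → j ≤ Λ.NV → Λ.vl j ≠ Λ.vl (k + 1) := fun j a b e => by
    have := Λ.vl_inj j (k + 1) (by omega) b (by omega) hk e
    omega
  constructor
  · omega
  · intro v hv
    rw [Function.update_apply, if_neg fun e : v = _ => hv (e ▸ hmem)]
    exact h.isVis v hv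
  · intro j h1 h2
    rw [Function.update_apply]
    split_ifs with e e' e'
    · rfl
    · exact absurd (e ▸ hl) e'
    · rw [h.vis j (by by_contra h3; exact e (by rw [show j = k + 1 by omega])) h2, if_pos e']
    · rw [h.vis j (by by_contra h3; exact e (by rw [show j = k + 1 by omega])) h2, if_neg e']
  · intro i hi
    by_cases e : i = qt
    · subst e
      simp only [Function.update_self]
      exact ⟨hl, trivial, k + 1, by omega, hk, rfl⟩
    · obtain ⟨a1, a2, j, a3, a4, a5⟩ := h.queue i (by omega)
      rw [Function.update_apply, if_neg e]
      refine ⟨a1, ?_, j, by omega, a4, a5⟩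
      rw [Function.update_apply, if_neg fun e => hne j a3 a4 (a5.trans e)]
      exact a2
  · intro j h1 h2 h3
    by_cases e : j = k + 1
    · subst e
      simp
    · obtain ⟨a1, a2⟩ := h.rank j (by omega) h2 h3
      rw [Function.update_apply ρ, if_neg (hne j (by omega) h2), Function.update_apply,
        if_neg (by omega)]
      exact ⟨by omega, a2⟩

theorem InitInv.searchInv {Λ : Layout} {lab res ρ vis que par : ℕ → ℕ} {qt fx : ℕ}
    (h : Λ.InitInv lab 0 ρ vis que qt) (hlab : Λ.IsLab lab) :
    Λ.SearchInv lab res ∅ ρ vis que par 0 qt 0 0 fx := by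
  have hvis : ∀ v, vis v = if lab v = 2 then 1 else 0 := fun v => by
    by_cases hv : v ∈ Λ.verts
    · obtain ⟨j, h1, h2, rfl⟩ := Λ.exists_vl v hv
      exact h.vis j h1 h2
    · exact h.isVis v hv
  have hvis' : ∀ v, vis v ≠ 0 → lab v = 2 := fun v hv => by
    by_contra e
    rw [hvis, if_neg e] at hv
    exact hv rfl
  constructor
  · intro v
    rw [hvis]
    split_ifs <;> omega
  · intro v hv
    rw [hvis, if_pos hv]
    exact one_ne_zero
  · intro v hv
    rw [hvis, hlab.eq v hv]
  · intro i hi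
    obtain ⟨a1, a2, j, a3, a4, a5⟩ := h.queue i hi
    exact ⟨a5 ▸ Λ.vl_mem j a3 a4, by rw [hvis, if_pos a1]; exact one_ne_zero, a2⟩
  · intro v hv hv'
    obtain ⟨j, h1, h2, rfl⟩ := Λ.exists_vl v hv
    exact h.rank j h1 h2 (hvis' _ hv')
  · exact fun v h1 h2 => absurd (hvis' v h1) h2
  · omega
  · simp
  · simp
  · exact fun p _ _ => Or.inr (Or.inl (Nat.zero_le _))
  · intro _ v hv
    rw [hvis, if_neg (by omega)]
  · simp

/-! ### The steps of the residual graph search -/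

namespace SearchInv

variable {Λ} {lab res : ℕ → ℕ} {P : Finset ℕ} {ρ vis que par : ℕ → ℕ} {qh qt cur fnd fx : ℕ}

/-- The rank inverts the queue, so the queue holds distinct ends of edges. This bounds the number of
times a vertex is dequeued. -/
theorem qt_le (h : Λ.SearchInv lab res P ρ vis que par qh qt cur fnd fx) : qt ≤ Λ.N := by
  have h1 : (Finset.range qt).card ≤ Λ.verts.card := by
    refine Finset.card_le_card_of_injOn que ?_ ?_
    · intro i hi
      simp only [Finset.coe_range, Set.mem_Iio] at hi
      exact (h.queue i hi).1
    · intro i hi j hj e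
      simp only [Finset.coe_range, Set.mem_Iio] at hi hj
      rw [← (h.queue i hi).2.2, ← (h.queue j hj).2.2, e]
  simpa using h1.trans Λ.card_verts_le

theorem card_le (h : Λ.SearchInv lab res P ρ vis que par qh qt cur fnd fx) : P.card ≤ Λ.N := by
  simpa using Finset.card_le_card (fun p hp => (h.done p hp).1 : P ⊆ Finset.Icc 1 Λ.N)

theorem notMem (h : Λ.SearchInv lab res P ρ vis que par qh qt cur fnd fx) (hcur : cur ≠ 0) :
    cur ∉ P := fun hP => lt_irrefl _ ((h.done cur hP).2.2.2.2 hcur rfl)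

/-- The current half-edge has been processed. -/
theorem advance (h : Λ.SearchInv lab res P ρ vis que par qh qt cur fnd fx) (hcur : cur ≠ 0)
    (hv : vis (Λ.dst cur) ≠ 0 ∨ res (Λ.rev cur) = 0) :
    Λ.SearchInv lab res (insert cur P) ρ vis que par qh qt (Λ.nxt cur) fnd fx := by
  obtain ⟨c1, c2, c3⟩ := h.current hcur
  have hn := Λ.nxt_le cur c1
  refine { h with done := ?_, current := ?_, cover := ?_ }
  · intro p hp
    rw [Finset.mem_insert] at hp
    obtain rfl | hp := hp
    · exact ⟨c1, c2, c3, hv, fun _ _ => hn⟩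
    · obtain ⟨a1, a2, a3, a4, a5⟩ := h.done p hp
      refine ⟨a1, a2, a3, a4, fun b1 b2 => ?_⟩
      rw [Λ.src_nxt cur c1 b1] at b2
      exact hn.trans (a5 hcur b2)
  · intro hn0
    rw [Λ.src_nxt cur c1 hn0]
    refine ⟨?_, c2, c3⟩
    simp only [Finset.mem_Icc] at c1 ⊢
    omega
  · intro p hp hpv
    obtain h1 | h1 | ⟨h1, h2, h3⟩ := h.cover p hp hpv
    · exact Or.inl (Finset.mem_insert_of_mem h1)
    · exact Or.inr (Or.inl h1)
    · obtain rfl | h3 := h3.eq_or_lt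
      · exact Or.inl (Finset.mem_insert_self _ _)
      -- Adjacency lists decrease and skip nothing: a smaller half-edge with the same source is at
      -- most the successor.
      · have h4 := Λ.le_nxt cur c1 p hp h2 h3
        have h5 : Λ.nxt cur ≠ 0 := by
          have := (Finset.mem_Icc.1 hp).1
          omega
        exact Or.inr (Or.inr ⟨h5, by rw [Λ.src_nxt cur c1 h5, h2], h4⟩)

/-- A new vertex is reached along the current half-edge. -/
theorem visit (hlab : Λ.IsLab lab) (h : Λ.SearchInv lab res P ρ vis que par qh qt cur fnd fx)
    (hcur : cur ≠ 0) (hv : vis (Λ.dst cur) = 0) (hr : res (Λ.rev cur) ≠ 0) {fnd' fx' : ℕ}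
    (hf : (lab (Λ.dst cur) ≠ 0 → fnd' = 1 ∧ fx' = Λ.dst cur) ∧
      (lab (Λ.dst cur) = 0 → fnd' = fnd ∧ fx' = fx)) :
    Λ.SearchInv lab res P (Function.update ρ (Λ.dst cur) qt)
      (Function.update vis (Λ.dst cur) 1) (Function.update que qt (Λ.dst cur))
      (Function.update par (Λ.dst cur) (Λ.rev cur)) qh (qt + 1) cur fnd' fx' := by
  obtain ⟨c1, c2, c3⟩ := h.current hcur
  set v := Λ.dst cur with hvdef
  have hvV : v ∈ Λ.verts := Λ.dst_mem_verts c1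
  have hlab2 : lab v ≠ 2 := fun e => h.vis_two v e hv
  have hvis : ∀ u, vis u ≠ 0 → u ≠ v := fun u hu e => hu (e ▸ hv)
  have hvis' : ∀ u, vis u ≠ 0 → Function.update vis v 1 u ≠ 0 := fun u hu => by
    rw [Function.update_apply]
    split_ifs
    · exact one_ne_zero
    · exact hu
  have hsplit : ∀ u, Function.update vis v 1 u ≠ 0 → u = v ∨ vis u ≠ 0 := fun u hu => by
    rw [Function.update_apply] at hu
    split_ifs at hu with e
    · exact Or.inl e
    · exact Or.inr hu
  have hρ : ∀ u, vis u ≠ 0 → Function.update ρ v qt u = ρ u := fun u hu => by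
    rw [Function.update_apply, if_neg (hvis u hu)]
  have hqh := h.qh_le
  constructor
  · intro u
    rw [Function.update_apply]
    split_ifs
    · exact le_rfl
    · exact h.vis_le u
  · exact fun u hu => hvis' u (h.vis_two u hu)
  · intro u hu
    rw [Function.update_apply, if_neg fun e : u = v => hu (e ▸ hvV)]
    exact h.isVis u hu
  · intro i hi
    by_cases hi' : i = qt
    · subst hi'
      simp [hvV]
    · obtain ⟨a1, a2, a3⟩ := h.queue i (by omega)
      rw [Function.update_apply, if_neg hi']
      exact ⟨a1, hvis' _ a2, by rw [hρ _ a2, a3]⟩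
  · intro u hu hu'
    obtain rfl | hu' := hsplit u hu'
    · simp
    · obtain ⟨a1, a2⟩ := h.rank u hu hu'
      rw [hρ u hu', Function.update_apply, if_neg (by omega)]
      exact ⟨by omega, a2⟩
  · intro u hu hu2
    obtain rfl | hu' := hsplit u hu
    -- The search runs backwards: the parent of the new vertex is the reverse of the current
    -- half-edge, residual and pointing to a vertex queued earlier.
    · simp only [Function.update_self]
      rw [Λ.src_rev cur c1, Λ.dst_rev c1, hρ _ c2]
      exact ⟨Λ.rev_mem cur c1, rfl, hr, hvis' _ c2, by omega⟩
    · obtain ⟨a1, a2, a3, a4, a5⟩ := h.parent u hu' hu2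
      rw [hρ u hu', Function.update_apply, if_neg (hvis u hu')]
      exact ⟨a1, a2, a3, hvis' _ a4, by rwa [hρ _ a4]⟩
  · omega
  · intro p hp
    obtain ⟨a1, a2, a3, a4, a5⟩ := h.done p hp
    exact ⟨a1, hvis' _ a2, by rwa [hρ _ a2], a4.imp_left (hvis' _), a5⟩
  · exact fun _ => ⟨c1, hvis' _ c2, by rwa [hρ _ c2]⟩
  · intro p hp hpv
    obtain e | hpv := hsplit _ hpv
    · right; left
      rw [e, Function.update_self]
      exact hqh
    · rw [hρ _ hpv]
      exact h.cover p hp hpv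
  · intro hf0 u hu
    have hl : lab v = 0 := by
      by_contra hl
      have := (hf.1 hl).1
      omega
    rw [Function.update_apply, if_neg (by rintro rfl; omega)]
    exact h.not_found ((hf.2 hl).1 ▸ hf0) u hu
  · intro hf0
    by_cases hl : lab v = 0
    · obtain ⟨e1, e2⟩ := hf.2 hl
      rw [e2]
      obtain ⟨a1, a2⟩ := h.found (e1 ▸ hf0)
      exact ⟨a1, hvis' _ a2⟩
    · rw [(hf.1 hl).2]
      have := hlab.le v
      exact ⟨by omega, by simp⟩

/-- The next vertex is taken from the queue. -/
theorem dequeue (h : Λ.SearchInv lab res P ρ vis que par qh qt 0 fnd fx) (hq : qh < qt) :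
    Λ.SearchInv lab res P ρ vis que par (qh + 1) qt (Λ.head (que qh)) fnd fx := by
  obtain ⟨q1, q2, q3⟩ := h.queue qh hq
  obtain ⟨p₀, hp₀, hp₀'⟩ := Finset.mem_image.1 q1
  have m1 := Λ.head_mem p₀ hp₀
  have m2 := Λ.src_head p₀ hp₀
  rw [hp₀'] at m1 m2
  refine { h with qh_le := hq, done := ?_, current := ?_, cover := ?_ }
  · intro p hp
    obtain ⟨a1, a2, a3, a4, a5⟩ := h.done p hp
    refine ⟨a1, a2, by omega, a4, fun _ e => ?_⟩
    rw [m2] at e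
    rw [e] at a3
    omega
  · intro _
    rw [m2]
    exact ⟨m1, q2, by omega⟩
  · intro p hp hpv
    obtain h1 | h1 | ⟨h1, _⟩ := h.cover p hp hpv
    · exact Or.inl h1
    · obtain h1 | h1 := h1.eq_or_lt
      · right; right
        have e := (h.rank _ (Λ.src_mem_verts hp) hpv).2
        rw [← h1] at e
        have := Λ.le_head p hp
        rw [m2, e]
        refine ⟨?_, rfl, this⟩
        rw [← e] at this
        have := (Finset.mem_Icc.1 hp).1
        rw [e] at *
        omega
      · exact Or.inr (Or.inl h1)
    · exact absurd rfl h1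

/-- At the end of the search no residual half-edge leads to a visited vertex. -/
theorem closed (h : Λ.SearchInv lab res P ρ vis que par qh qh 0 fnd fx) :
    ∀ p ∈ Finset.Icc 1 Λ.N, vis (Λ.src p) = 0 → vis (Λ.dst p) ≠ 0 → res p = 0 := by
  intro p hp h1 h2
  have hr := Λ.rev_mem p hp
  rw [← Λ.src_rev p hp] at h2
  obtain h3 | h3 | ⟨h3, _⟩ := h.cover _ hr h2
  · have h4 := (h.done _ h3).2.2.2.1
    rw [Λ.dst_rev hp, Λ.rev_rev p hp] at h4
    exact h4.resolve_left fun h5 => h5 h1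
  · have := (h.rank _ (Λ.src_mem_verts hr) h2).1
    omega
  · exact absurd rfl h3

end SearchInv

end Layout

/-! ### Registers and arrays -/

notation "rN" => (0 : ℕ)
notation "rM" => (1 : ℕ)
notation "rC0" => (2 : ℕ)
notation "rC1" => (3 : ℕ)
notation "rL" => (4 : ℕ)
notation "rOne" => (5 : ℕ)
notation "rC" => (6 : ℕ)
notation "rSwap" => (7 : ℕ)
notation "rHalf" => (8 : ℕ)
notation "rNV" => (9 : ℕ)
notation "rNT" => (10 : ℕ)
notation "rBase" => (11 : ℕ)
notation "rPred" => (12 : ℕ)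
notation "rLen" => (13 : ℕ)
notation "rGuesses" => (14 : ℕ)
notation "rOkay" => (15 : ℕ)
notation "rSucc" => (16 : ℕ)
notation "rTwo" => (17 : ℕ)
notation "rCur" => (20 : ℕ)
notation "rQh" => (21 : ℕ)
notation "rQt" => (22 : ℕ)
notation "rRun" => (23 : ℕ)
notation "rFnd" => (24 : ℕ)
notation "rFx" => (25 : ℕ)
notation "rX" => (26 : ℕ)
notation "rV" => (27 : ℕ)
notation "rA" => (28 : ℕ)
notation "rB" => (29 : ℕ)
notation "rQ" => (30 : ℕ)
notation "rD" => (31 : ℕ)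
notation "rRem" => (32 : ℕ)
notation "rGo" => (33 : ℕ)
notation "rW" => (34 : ℕ)
notation "rY" => (35 : ℕ)
notation "rDig" => (36 : ℕ)
notation "rF" => (37 : ℕ)
notation "rS" => (39 : ℕ)
notation "rT" => (40 : ℕ)
notation "rCnt" => (41 : ℕ)
notation "rR" => (42 : ℕ)
notation "rHN" => (43 : ℕ)
notation "rI" => (44 : ℕ)
notation "rGw" => (45 : ℕ)
notation "rCode" => (46 : ℕ)
notation "rJ" => (47 : ℕ)
notation "rLv" => (48 : ℕ)
notation "rGg" => (49 : ℕ)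

notation "aFst" => (0 : ℕ)
notation "aSnd" => (1 : ℕ)
notation "aTerm" => (2 : ℕ)
notation "aQ0" => (3 : ℕ)
notation "aQ1" => (4 : ℕ)
notation "aSrc" => (5 : ℕ)
notation "aDst" => (6 : ℕ)
notation "aRev" => (7 : ℕ)
notation "aNxt" => (8 : ℕ)
notation "aHead" => (9 : ℕ)
notation "aVl" => (10 : ℕ)
notation "aTl" => (11 : ℕ)
notation "aLab0" => (12 : ℕ)
notation "aLab" => (13 : ℕ)
notation "aBase" => (14 : ℕ)
notation "aVis" => (15 : ℕ)
notation "aPar" => (16 : ℕ)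
notation "aQue" => (17 : ℕ)
notation "aRes" => (18 : ℕ)
notation "aMk" => (19 : ℕ)
notation "aHl" => (20 : ℕ)

namespace Layout

/-- The memory holds the layout. -/
structure In (Λ : Layout) (s : State) : Prop where
  n : s.reg rN = Λ.n
  l : s.reg rL = Λ.l
  one : s.reg rOne = 1
  c : s.reg rC = Λ.c
  swap : s.reg rSwap = Λ.swap
  half : s.reg rHalf = Λ.N
  NV : s.reg rNV = Λ.NV
  NT : s.reg rNT = Λ.NT
  base : s.reg rBase = Λ.base
  pred : s.reg rPred = Λ.base - 1
  len : s.reg rLen = Λ.len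
  guesses : s.reg rGuesses = Λ.guesses
  two : s.reg rTwo = 2
  term : ∀ v, s.arr aTerm v ≠ 0 ↔ v ∈ Λ.T
  src : s.arr aSrc = Λ.src
  dst : s.arr aDst = Λ.dst
  rev : s.arr aRev = Λ.rev
  nxt : s.arr aNxt = Λ.nxt
  head : s.arr aHead = Λ.head
  vl : s.arr aVl = Λ.vl
  tl : s.arr aTl = Λ.tl
  lab₀ : s.arr aLab0 = Λ.lab₀

end Layout

/-- The program does not write to the part of the memory that holds the layout. -/
def Prog.keeps (p : Prog) : Bool :=
  [0, 4, 5, 6, 7, 8, 9, 10, 11, 12, 13, 14, 17].all (fun r => !p.writesReg r) &&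
    [2, 5, 6, 7, 8, 9, 10, 11, 12].all (fun A => !p.writesArr A)

theorem Layout.In.frame {Λ : Layout} {s s' : State} {p : Prog} (h : Λ.In s) (hf : Frame p s s')
    (hp : p.keeps = true) : Λ.In s' := by
  simp only [Prog.keeps, List.all_cons, List.all_nil, Bool.and_true, Bool.and_eq_true,
    Bool.not_eq_true'] at hp
  obtain ⟨⟨r0, r4, r5, r6, r7, r8, r9, r10, r11, r12, r13, r14, r17⟩,
    a2, a5, a6, a7, a8, a9, a10, a11, a12⟩ := hp
  constructor
  · rw [hf.reg _ r0, h.n]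
  · rw [hf.reg _ r4, h.l]
  · rw [hf.reg _ r5, h.one]
  · rw [hf.reg _ r6, h.c]
  · rw [hf.reg _ r7, h.swap]
  · rw [hf.reg _ r8, h.half]
  · rw [hf.reg _ r9, h.NV]
  · rw [hf.reg _ r10, h.NT]
  · rw [hf.reg _ r11, h.base]
  · rw [hf.reg _ r12, h.pred]
  · rw [hf.reg _ r13, h.len]
  · rw [hf.reg _ r14, h.guesses]
  · rw [hf.reg _ r17, h.two]
  · rw [hf.arr _ a2]
    exact h.term
  · rw [hf.arr _ a5, h.src]
  · rw [hf.arr _ a6, h.dst]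
  · rw [hf.arr _ a7, h.rev]
  · rw [hf.arr _ a8, h.nxt]
  · rw [hf.arr _ a9, h.head]
  · rw [hf.arr _ a10, h.vl]
  · rw [hf.arr _ a11, h.tl]
  · rw [hf.arr _ a12, h.lab₀]

theorem Layout.In.setReg {Λ : Layout} {s : State} (h : Λ.In s) {r v : ℕ}
    (hr : (Prog.const r v).keeps = true) : Λ.In (s.setReg r v) :=
  h.frame (Run.const s r v).frame hr

theorem Layout.In.setArr {Λ : Layout} {s : State} (h : Λ.In s) {A i v : ℕ}
    (hr : (Prog.store A i v).keeps = true) : Λ.In (s.setArr A i v) := by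
  refine h.frame (p := .store A i v) ⟨fun _ _ => rfl, fun x hx => ?_⟩ hr
  simp only [Prog.writesArr, beq_eq_false_iff_ne] at hx
  simp [hx]

/-! ### The graph search -/

namespace Prog

/-- Marks the vertex `vl x` as visited if its label is `2`. -/
def searchInit : Prog := block [
  .load rV aVl rX, .load rA aLab rV, .sub rA rA rOne, .store aVis rV rA,
  .ite rA (block [.store aQue rQt rV, .add rQt rQt rOne]) .skip,
  .sub rX rX rOne]

/-- Handles one half-edge, or takes the next vertex from the queue. -/
def searchStep : Prog :=
  .ite rCur
    (block [.load rV aDst rCur, .load rQ aRev rCur, .load rA aVis rV, .load rB aRes rQ,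
      .ite rA .skip (.ite rB
        (block [.store aVis rV rOne, .store aPar rV rQ, .store aQue rQt rV, .add rQt rQt rOne,
          .load rA aLab rV, .ite rA (block [.const rFnd 1, .copy rFx rV]) .skip])
        .skip),
      .load rCur aNxt rCur])
    (block [.sub rA rQt rQh,
      .ite rA (block [.load rV aQue rQh, .add rQh rQh rOne, .load rCur aHead rV])
        (.const rRun 0)])

/-- Finds the vertices from which a vertex with label `2` can be reached in the residual network. -/
def search : Prog := block [
  .const rFnd 0, .const rQt 0, .const rQh 0, .const rCur 0, .const rRun 1, .copy rX rNV,
  .loop rX searchInit, .loop rRun searchStep]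

end Prog

namespace Layout

variable {Λ : Layout}

/-- The label minus one, truncated, is the indicator of label `2`. Only ends of edges are reset; at
other vertices `aVis` stays correct throughout, which keeps `n` out of the cost. -/
theorem tri_searchInit {s : State} (hs : Λ.In s) (hlab : Λ.IsLab (s.arr aLab))
    (hvis : Λ.IsVis (s.arr aVis)) (hx : s.reg rX = Λ.NV) (hq : s.reg rQt = 0) :
    Tri (.loop rX Prog.searchInit) s (Λ.NV * 12 + 1) fun s' =>
      ∃ ρ, Λ.InitInv (s.arr aLab) 0 ρ (s'.arr aVis) (s'.arr aQue) (s'.reg rQt) := by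
  refine Tri.down (b := 11) (fun k s' => ∃ ρ, Λ.InitInv (s.arr aLab) k ρ (s'.arr aVis)
    (s'.arr aQue) (s'.reg rQt)) ?_ hx ⟨fun _ => 0, le_rfl, ?_, ?_, ?_, ?_⟩
  · rintro k s₁ hf ⟨ρ, h⟩ hx₁
    have hs₁ := hs.frame hf rfl
    have hlab₁ : s₁.arr aLab = s.arr aLab := hf.arr _ rfl
    have hl2 := hlab.le (Λ.vl (k + 1))
    refine Tri.of_wp ?_
    simp [Prog.searchInit, hs₁.vl, hx₁, hs₁.one, hlab₁]
    constructor
    · intro hl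
      have hl' : s.arr aLab (Λ.vl (k + 1)) = 2 := by omega
      rw [hl']
      exact ⟨_, h.push hl'⟩
    · intro hl
      rw [hl]
      exact ⟨_, h.skip (by omega)⟩
  · intro v hv
    rw [hvis v hv, hlab.eq v hv]
  · omega
  · omega
  · omega

/-- Each round processes a new half-edge, dequeues a vertex or clears the run flag, so the
unprocessed half-edges, the room left in the queue and the flag together form the potential. -/
theorem tri_searchStep {s : State} (hs : Λ.In s) (hlab : Λ.IsLab (s.arr aLab)) {ρ : ℕ → ℕ}
    (h : Λ.SearchInv (s.arr aLab) (s.arr aRes) ∅ ρ (s.arr aVis) (s.arr aQue) (s.arr aPar)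
      (s.reg rQh) (s.reg rQt) (s.reg rCur) (s.reg rFnd) (s.reg rFx)) (hrun : s.reg rRun = 1) :
    Tri (.loop rRun Prog.searchStep) s ((2 * Λ.N + 1) * 21 + 1) fun s' => ∃ P ρ,
      Λ.SearchInv (s.arr aLab) (s.arr aRes) P ρ (s'.arr aVis) (s'.arr aQue) (s'.arr aPar)
        (s'.reg rQh) (s'.reg rQh) 0 (s'.reg rFnd) (s'.reg rFx) := by
  refine (Tri.loop (b := 20) (k₀ := 2 * Λ.N + 1) (fun k s' => ∃ P ρ,
    Λ.SearchInv (s.arr aLab) (s.arr aRes) P ρ (s'.arr aVis) (s'.arr aQue) (s'.arr aPar)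
      (s'.reg rQh) (s'.reg rQt) (s'.reg rCur) (s'.reg rFnd) (s'.reg rFx) ∧
    (s'.reg rRun = 0 → s'.reg rCur = 0 ∧ s'.reg rQh = s'.reg rQt) ∧
    (Λ.N - P.card) + (Λ.N - s'.reg rQh) + s'.reg rRun ≤ k) ?_ ?_).mono le_rfl ?_
  · rintro k s₁ hf ⟨P, ρ, h, h1, h2⟩ hr
    have hs₁ := hs.frame hf rfl
    have hlab₁ : s₁.arr aLab = s.arr aLab := hf.arr _ rfl
    have hres₁ : s₁.arr aRes = s.arr aRes := hf.arr _ rfl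
    refine Tri.of_wp ?_
    simp [Prog.searchStep, hs₁.dst, hs₁.rev, hs₁.nxt, hs₁.head, hs₁.one, hlab₁, hres₁]
    have hadv : ∀ ρ' vis que par qt fnd fx,
        Λ.SearchInv (s.arr aLab) (s.arr aRes) P ρ' vis que par (s₁.reg rQh) qt (s₁.reg rCur)
          fnd fx → s₁.reg rCur ≠ 0 →
        vis (Λ.dst (s₁.reg rCur)) ≠ 0 ∨ s.arr aRes (Λ.rev (s₁.reg rCur)) = 0 →
        ∃ k' < k, ∃ P, (∃ x, Λ.SearchInv (s.arr aLab) (s.arr aRes) P x vis que par (s₁.reg rQh) qt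
            (Λ.nxt (s₁.reg rCur)) fnd fx) ∧
          (s₁.reg rRun = 0 → Λ.nxt (s₁.reg rCur) = 0 ∧ s₁.reg rQh = qt) ∧
          Λ.N - P.card + (Λ.N - s₁.reg rQh) + s₁.reg rRun ≤ k' := by
      intro ρ' vis que par qt fnd fx h' hcur hv
      have h3 := h'.advance hcur hv
      have h4 := h3.card_le
      rw [Finset.card_insert_of_notMem (h'.notMem hcur)] at h4
      refine ⟨k - 1, by omega, _, ⟨_, h3⟩, fun e => absurd e hr, ?_⟩
      rw [Finset.card_insert_of_notMem (h'.notMem hcur)]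
      omega
    refine ⟨fun hcur => ⟨fun hv => ?_, fun hv => ⟨fun hres => ⟨fun hl => ?_, fun hl => ?_⟩,
      fun hres => ?_⟩⟩, fun hcur => ⟨fun hq => ?_, fun hq => ?_⟩⟩
    · exact hadv _ _ _ _ _ _ _ h hcur (Or.inl hv)
    · exact hadv _ _ _ _ _ _ _ (h.visit hlab hcur hv hres
        ⟨fun _ => ⟨rfl, rfl⟩, fun e => absurd e hl⟩) hcur (Or.inl (by simp))
    · exact hadv _ _ _ _ _ _ _ (h.visit hlab hcur hv hres
        ⟨fun e => absurd hl e, fun _ => ⟨rfl, rfl⟩⟩) hcur (Or.inl (by simp))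
    · exact hadv _ _ _ _ _ _ _ h hcur (Or.inr hres)
    · rw [hcur] at h
      have h3 := h.qt_le
      exact ⟨k - 1, by omega, P, ⟨ρ, h.dequeue (by omega)⟩, fun e => absurd e hr, by omega⟩
    · have h3 := h.qh_le
      exact ⟨k - 1, by omega, P, ⟨ρ, h⟩, ⟨hcur, by omega⟩, by omega⟩
  · exact ⟨∅, ρ, h, by omega, by simp [hrun]; omega⟩
  · rintro s' ⟨⟨k, P, ρ, h, h1, h2⟩, h3⟩ _
    obtain ⟨h4, h5⟩ := h1 h3
    rw [h4, ← h5] at h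
    exact ⟨P, ρ, h⟩

/-- The outcome of the search. -/
structure Searched (Λ : Layout) (lab res : ℕ → ℕ) (s : State) : Prop where
  vis_le : ∀ v, s.arr aVis v ≤ 1
  vis_two : ∀ v, lab v = 2 → s.arr aVis v ≠ 0
  isVis : Λ.IsVis (s.arr aVis)
  parent : ∃ ρ : ℕ → ℕ, ∀ v, s.arr aVis v ≠ 0 → ρ v ≤ Λ.N ∧ (lab v ≠ 2 →
    s.arr aPar v ∈ Finset.Icc 1 Λ.N ∧ Λ.src (s.arr aPar v) = v ∧ res (s.arr aPar v) ≠ 0 ∧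
    s.arr aVis (Λ.dst (s.arr aPar v)) ≠ 0 ∧ ρ (Λ.dst (s.arr aPar v)) < ρ v)
  closed : ∀ p ∈ Finset.Icc 1 Λ.N, s.arr aVis (Λ.src p) = 0 → s.arr aVis (Λ.dst p) ≠ 0 → res p = 0
  not_found : s.reg rFnd = 0 → ∀ v, lab v = 1 → s.arr aVis v = 0
  found : s.reg rFnd ≠ 0 → lab (s.reg rFx) = 1 ∧ s.arr aVis (s.reg rFx) ≠ 0

theorem tri_search {s : State} (hs : Λ.In s) (hlab : Λ.IsLab (s.arr aLab))
    (hvis : Λ.IsVis (s.arr aVis)) :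
    Tri Prog.search s (60 * Λ.N + 40) (Searched Λ (s.arr aLab) (s.arr aRes)) := by
  refine Tri.of_wp ?_
  simp only [Prog.search, wp_block_cons, wp_const, wp_copy]
  set s₁ := State.setReg _ _ _ with hs₁
  have hin : Λ.In s₁ := by
    iterate 6 refine Layout.In.setReg ?_ rfl
    exact hs
  have e1 : s₁.arr = s.arr := by simp [hs₁]
  refine (tri_searchInit hin (e1 ▸ hlab) (e1 ▸ hvis) (by simp [hs₁, hs.NV]) (by simp [hs₁])).wp ?_
  rintro s₂ t₂ ⟨ρ, h⟩ hf₂ ht₂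
  have hlab₂ : s₂.arr aLab = s.arr aLab := (hf₂.arr _ rfl).trans (by rw [e1])
  have hres₂ : s₂.arr aRes = s.arr aRes := (hf₂.arr _ rfl).trans (by rw [e1])
  have g1 : s₂.reg rCur = 0 := (hf₂.reg _ rfl).trans (by simp [hs₁])
  have g2 : s₂.reg rQh = 0 := (hf₂.reg _ rfl).trans (by simp [hs₁])
  have g3 : s₂.reg rFnd = 0 := (hf₂.reg _ rfl).trans (by simp [hs₁])
  have g4 : s₂.reg rRun = 1 := (hf₂.reg _ rfl).trans (by simp [hs₁])
  rw [e1] at h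
  rw [wp_block_cons]
  have hinv := h.searchInv (res := s.arr aRes) (par := s₂.arr aPar) (fx := s₂.reg rFx) hlab
  refine (tri_searchStep (ρ := ρ) (hin.frame hf₂ rfl) (hlab₂ ▸ hlab)
    (by rw [g1, g2, g3, hlab₂, hres₂]; exact hinv) g4).wp ?_
  rintro s₃ t₃ ⟨P, ρ, h3⟩ hf₃ ht₃
  rw [hlab₂, hres₂] at h3
  rw [wp_block_nil]
  have hNV := Λ.NV_le
  -- Forbidden isolated vertices count as visited without ever being queued, so the invariant says
  -- nothing about their rank; they get the default `0` to satisfy the bound `N`.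
  refine ⟨⟨h3.vis_le, h3.vis_two, h3.isVis, ⟨fun v => if v ∈ Λ.verts then ρ v + 1 else 0, ?_⟩,
    h3.closed, h3.not_found, h3.found⟩, by omega⟩
  intro v hv
  beta_reduce
  constructor
  · split_ifs with hv'
    · have := (h3.rank v hv' hv).1
      have := h3.qt_le
      omega
    · omega
  · intro hl
    obtain ⟨a1, a2, a3, a4, a5⟩ := h3.parent v hv hl
    refine ⟨a1, a2, a3, a4, ?_⟩
    rw [if_pos (Λ.dst_mem_verts a1), if_pos (a2 ▸ Λ.src_mem_verts a1)]
    omega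

end Layout

/-! ### Flows -/

namespace Net

variable (D : Net)

/-- `res` are the residual capacities of a flow of value `F` between the labels `1` and `2`. -/
def IsFlow (lab res : ℕ → ℕ) (F : ℕ) : Prop :=
  ∀ A, Sep lab A → D.cut A = F + D.flux res A Aᶜ

open Classical in
/-- Pushing one unit along the half-edge `p`. -/
theorem flux_push (res : ℕ → ℕ) {p : ℕ} (hp : p ∈ Finset.Icc 1 D.N) (hr : res p ≠ 0) (A : Set ℕ) :
    D.flux (Function.update (Function.update res p (res p - 1)) (D.rev p) (res (D.rev p) + 1))
      A Aᶜ +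
      (if D.dst p ∈ A then 0 else 1) =
    D.flux res A Aᶜ + if D.src p ∈ A then 0 else 1 := by
  set res' := Function.update (Function.update res p (res p - 1)) (D.rev p) (res (D.rev p) + 1)
    with hres'
  have hne := D.rev_ne p hp
  -- The unit removed from `p` is moved to the other side, which leaves an identity without
  -- truncated subtraction that holds half-edge by half-edge.
  have key : D.flux res' A Aᶜ + D.flux (fun i => if i = p then 1 else 0) A Aᶜ =
      D.flux res A Aᶜ + D.flux (fun i => if i = D.rev p then 1 else 0) A Aᶜ := by
    simp only [flux, ← Finset.sum_add_distrib]
    refine Finset.sum_congr rfl fun i _ => ?_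
    have : res' i + (if i = p then 1 else 0) = res i + (if i = D.rev p then 1 else 0) := by
      simp only [hres', Function.update_apply]
      split_ifs with h1 h2 h3
      · exact absurd (h1.symm.trans h2) hne
      · rw [h1]
      · rw [h3]; omega
      · rfl
    by_cases hc : D.src i ∈ A ∧ D.dst i ∈ Aᶜ
    · simp only [if_pos hc]
      exact this
    · simp only [if_neg hc]
  have single : ∀ q ∈ Finset.Icc 1 D.N, D.flux (fun i => if i = q then 1 else 0) A Aᶜ =
      if D.src q ∈ A ∧ D.dst q ∈ Aᶜ then 1 else 0 := by
    intro q hq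
    rw [flux, Finset.sum_eq_single q]
    · simp
    · intro b _ hb
      simp [hb]
    · exact fun h => absurd hq h
  rw [single p hp, single _ (D.rev_mem p hp), D.src_rev p hp, D.dst_rev hp] at key
  by_cases h1 : D.src p ∈ A <;> by_cases h2 : D.dst p ∈ A <;> simp [h1, h2] at key ⊢ <;> omega

end Net

namespace Prog

/-- Pushes one unit of flow along the half-edge that was found for the vertex `rFx`. -/
def augmentStep : Prog := block [
  .load rQ aPar rFx, .load rB aRes rQ, .sub rB rB rOne, .store aRes rQ rB,
  .load rV aRev rQ, .load rB aRes rV, .add rB rB rOne, .store aRes rV rB,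
  .load rFx aDst rQ, .load rA aLab rFx, .sub rA rTwo rA]

/-- Pushes one unit of flow along the path that was found. -/
def augment : Prog := block [.load rA aLab rFx, .sub rA rTwo rA, .loop rA augmentStep]

/-- One round of the flow computation. -/
def flowStep : Prog := block [
  search,
  .ite rFnd (block [augment, .sub rRem rRem rOne, .copy rGo rRem]) (.const rGo 0)]

/-- Resets the flow. -/
def flowInit : Prog := block [.store aRes rX rOne, .sub rX rX rOne]

/-- Computes the furthest smallest cut, if it has at most `rD` edges. -/
def flow : Prog := block [
  .copy rX rHalf, .loop rX flowInit, .add rRem rD rOne, .const rGo 1, .loop rGo flowStep]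

end Prog

namespace Layout

variable {Λ : Layout}

/-- While the unit rests at a vertex `x`, each cut `A` equals `F` plus the residual flux plus one if
`x ∉ A`. The extra term is `0` at the start, where `x` has label `1`, and `1` at the end, where it
has label `2`. Ranks drop along parents, so no parent half-edge is used twice. -/
theorem tri_augment {s : State} (hs : Λ.In s) (hlab : Λ.IsLab (s.arr aLab)) {F : ℕ}
    (hF : Λ.IsFlow (s.arr aLab) (s.arr aRes) F) (h : Searched Λ (s.arr aLab) (s.arr aRes) s)
    (hfnd : s.reg rFnd ≠ 0) :
    Tri Prog.augment s (14 * Λ.N + 10) fun s' =>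
      Λ.IsFlow (s.arr aLab) (s'.arr aRes) (F + 1) := by
  classical
  obtain ⟨ρ, hρ⟩ := h.parent
  set lab := s.arr aLab with hlabdef
  have hfx := h.found hfnd
  refine Tri.of_wp ?_
  simp only [Prog.augment, wp_block_cons, wp_load, wp_sub]
  set s₁ := State.setReg _ _ _ with hs₁
  have hin : Λ.In s₁ := by
    iterate 2 refine Layout.In.setReg ?_ rfl
    exact hs
  have hA : s₁.reg rA = 2 - lab (s₁.reg rFx) := by simp [hs₁, hs.two, hlabdef]
  have hFx : s₁.reg rFx = s.reg rFx := by simp [hs₁]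
  have harr : s₁.arr = s.arr := by simp [hs₁]
  clear_value s₁
  refine Tri.wp (Tri.loop (b := 12) (k₀ := ρ (s₁.reg rFx)) (fun k s' =>
    s'.reg rA = 2 - lab (s'.reg rFx) ∧ s.arr aVis (s'.reg rFx) ≠ 0 ∧ ρ (s'.reg rFx) = k ∧
    (∀ A, Sep lab A → Λ.cut A =
      F + (if s'.reg rFx ∈ A then 0 else 1) + Λ.flux (s'.arr aRes) A Aᶜ) ∧
    ∀ v, s.arr aVis v ≠ 0 → lab v ≠ 2 → ρ v ≤ k → s'.arr aRes (s.arr aPar v) ≠ 0) ?_ ?_) ?_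
  · rintro k s₂ hf ⟨h1, h2, h3, h4, h5⟩ h6
    have hs₂ := hin.frame hf rfl
    have hlab₂ : s₂.arr aLab = lab := by rw [hf.arr _ rfl, harr]
    have hpar₂ : s₂.arr aPar = s.arr aPar := by rw [hf.arr _ rfl, harr]
    have hl2 : lab (s₂.reg rFx) ≠ 2 := by omega
    obtain ⟨-, h7⟩ := hρ _ h2
    obtain ⟨p1, p2, p3, p4, p5⟩ := h7 hl2
    have hne := Λ.rev_ne _ p1
    have hr := h5 _ h2 hl2 h3.le
    have h8 : ∀ A, Sep lab A → _ := fun A _ => Λ.flux_push (s₂.arr aRes) p1 hr A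
    refine Tri.of_wp ?_
    simp only [Prog.augmentStep, wp_block_cons, wp_block_nil, wp_load, wp_sub, wp_store, wp_add]
    simp [hs₂.one, hs₂.two, hs₂.rev, hs₂.dst, hlab₂, hpar₂, Function.update_of_ne hne]
    refine ⟨?_, p4, ?_, ?_⟩
    · omega
    · intro A hA
      have e1 := h4 A hA
      have e2 := h8 A hA
      rw [p2] at e2
      omega
    · intro v hv hv2 hle
      -- Equal parents would have equal sources, but the vertex just left has larger rank than every
      -- vertex still relevant.
      have hvne : s.arr aPar v ≠ s.arr aPar (s₂.reg rFx) := fun e => by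
        have h9 := ((hρ v hv).2 hv2).2.1
        rw [e, p2] at h9
        rw [← h9] at hle
        omega
      rw [Function.update_apply, Function.update_apply]
      rw [if_neg hvne]
      split_ifs
      · exact not_false
      · exact h5 v hv hv2 (by omega)
  · refine ⟨hA, hFx ▸ hfx.2, rfl, ?_, ?_⟩
    · intro A hA'
      rw [harr, hFx, if_pos ((hA' _).1 hfx.1), hF A hA', add_zero]
    · intro v hv hv2 _
      rw [harr]
      exact ((hρ v hv).2 hv2).2.2.1
  · rintro s' t' ⟨⟨k, h1, h2, h3, h4, h5⟩, h6⟩ hf ht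
    have hl := hlab.le (s'.reg rFx)
    rw [wp_block_nil]
    refine ⟨fun A hA => ?_, ?_⟩
    · have := h4 A hA
      rwa [if_neg ((hA _).2 (by omega))] at this
    · have : ρ (s₁.reg rFx) ≤ Λ.N := by
        rw [hFx]
        exact (hρ _ hfx.2).1
      have h7 : ρ (s₁.reg rFx) * (12 + 1) ≤ Λ.N * 13 := Nat.mul_le_mul_right _ this
      omega

/-- The outcome of the flow computation. -/
structure Flowed (Λ : Layout) (lab : ℕ → ℕ) (d : ℕ) (s : State) : Prop where
  isVis : Λ.IsVis (s.arr aVis)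
  success : s.reg rRem ≠ 0 → Λ.conn lab ≤ d ∧ (∀ v, s.arr aVis v ≤ 1) ∧
    Λ.far lab = {v | s.arr aVis v = 0}
  failure : s.reg rRem = 0 → d < Λ.conn lab

/-- Max-flow min-cut: no residual half-edge leaves the unvisited set, so its cut equals the flow
value, a lower bound for all cuts. Another cut of that size has no residual flux either; a visited
vertex in it would lead along parents, without leaving it, to a forbidden vertex. -/
theorem Searched.isFar {lab res : ℕ → ℕ} {s : State} (h : Searched Λ lab res s) {F : ℕ}
    (hF : Λ.IsFlow lab res F) (hfnd : s.reg rFnd = 0) :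
    Λ.IsFar lab {v | s.arr aVis v = 0} ∧ Λ.cut {v | s.arr aVis v = 0} = F := by
  have hsep : Sep lab {v | s.arr aVis v = 0} := fun v =>
    ⟨fun h1 => h.not_found hfnd v h1, fun h2 => h.vis_two v h2⟩
  have hcut : Λ.cut {v | s.arr aVis v = 0} = F := by
    rw [hF _ hsep]
    simp only [Nat.add_eq_left]
    exact (Λ.flux_eq_zero).2 fun p hp h1 h2 => h.closed p hp h1 h2
  refine ⟨⟨hsep, fun A hA => ?_, fun A hA hAM v hv => ?_⟩, hcut⟩
  · rw [hcut, hF A hA]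
    omega
  · rw [hcut, hF A hA] at hAM
    have h0 : Λ.flux res A Aᶜ = 0 := by omega
    rw [Λ.flux_eq_zero] at h0
    obtain ⟨ρ, hρ⟩ := h.parent
    by_contra hvis
    obtain ⟨k, hk⟩ : ∃ k, ρ v = k := ⟨_, rfl⟩
    induction k using Nat.strong_induction_on generalizing v with
    | _ k ih =>
      obtain ⟨-, h1⟩ := hρ v hvis
      obtain ⟨p1, p2, p3, p4, p5⟩ := h1 fun e => (hA v).2 e hv
      refine ih _ (hk ▸ p5) _ ?_ p4 rfl
      by_contra h2
      exact p3 (h0 _ p1 (p2.symm ▸ hv) h2)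

/-- Register `rRem` starts at `d + 1` and loses one per augmentation. Reaching `0` exhibits a flow
of value `d + 1`, so every cut is too large; otherwise the last search found no path and left the
furthest smallest cut behind. -/
theorem tri_flow {s : State} (hs : Λ.In s) (hlab : Λ.IsLab (s.arr aLab))
    (hvis : Λ.IsVis (s.arr aVis)) :
    Tri Prog.flow s ((s.reg rD + 3) * (80 * Λ.N + 70)) (Flowed Λ (s.arr aLab) (s.reg rD)) := by
  set lab := s.arr aLab with hlabdef
  refine Tri.of_wp ?_
  simp only [Prog.flow, wp_block_cons, wp_copy, hs.half]
  set s₁ := State.setReg _ _ _ with hs₁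
  have hin : Λ.In s₁ := hs.setReg rfl
  have harr : s₁.arr = s.arr := rfl
  have hD : s₁.reg rD = s.reg rD := by simp [hs₁]
  refine Tri.wp (Tri.down (b := 3) (k₀ := Λ.N) (fun k s' =>
    ∀ p, k < p → p ≤ Λ.N → s'.arr aRes p = 1)
    ?_ (by simp [hs₁]) (by omega)) ?_
  · rintro k s₂ hf h1 h2
    have hs₂ := hin.frame hf rfl
    refine Tri.of_wp ?_
    simp [Prog.flowInit, hs₂.one, h2]
    intro p h3 h4
    rw [Function.update_apply]
    split_ifs
    · rfl
    · exact h1 p (by omega) h4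
  rintro s₂ t₂ h1 hf₂ ht₂
  have hs₂ := hin.frame hf₂ rfl
  have hlab₂ : s₂.arr aLab = lab := by rw [hf₂.arr _ rfl, harr]
  have hvis₂ : s₂.arr aVis = s.arr aVis := by rw [hf₂.arr _ rfl, harr]
  have hD₂ : s₂.reg rD = s.reg rD := by rw [hf₂.reg _ rfl, hD]
  clear_value s₁
  simp only [wp_block_cons, wp_add, wp_const, hs₂.one, hD₂]
  set s₃ := State.setReg _ _ _ with hs₃
  have hin₃ : Λ.In s₃ := by
    iterate 2 refine Layout.In.setReg ?_ rfl
    exact hs₂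
  have hrem₃ : s₃.reg rRem = s.reg rD + 1 := by simp [hs₃]
  have hgo₃ : s₃.reg rGo = 1 := by simp [hs₃]
  have harr₃ : s₃.arr = s₂.arr := rfl
  clear_value s₃
  refine Tri.wp (Tri.loop (b := 74 * Λ.N + 60) (k₀ := s.reg rD + 2) (fun k s' => ∃ F,
    Λ.IsFlow lab (s'.arr aRes) F ∧ F + s'.reg rRem = s.reg rD + 1 ∧ Λ.IsVis (s'.arr aVis) ∧
    (s'.reg rGo ≠ 0 → s'.reg rRem ≠ 0 ∧ s'.reg rRem + 1 ≤ k) ∧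
    (s'.reg rGo = 0 → s'.reg rRem ≠ 0 → Searched Λ lab (s'.arr aRes) s' ∧ s'.reg rFnd = 0))
    ?_ ?_) ?_
  · rintro k s₄ hf₄ ⟨F, h2, h3, h4, h5, h6⟩ hgo
    have hs₄ := hin₃.frame hf₄ rfl
    have hlab₄ : s₄.arr aLab = lab := by rw [hf₄.arr _ rfl, harr₃, hlab₂]
    obtain ⟨h7, h8⟩ := h5 hgo
    refine Tri.of_wp ?_
    simp only [Prog.flowStep, wp_block_cons]
    refine (tri_search hs₄ (hlab₄ ▸ hlab) h4).wp ?_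
    intro s₅ t₅ h9 hf₅ ht₅
    have hs₅ := hs₄.frame hf₅ rfl
    have hlab₅ : s₅.arr aLab = lab := by rw [hf₅.arr _ rfl, hlab₄]
    have hres₅ : s₅.arr aRes = s₄.arr aRes := hf₅.arr _ rfl
    have hrem₅ : s₅.reg rRem = s₄.reg rRem := hf₅.reg _ rfl
    rw [hlab₄, ← hres₅] at h9
    rw [← hres₅] at h2
    rw [wp_block_cons, wp_ite]
    refine ⟨fun hfnd => ?_, fun hfnd => ?_⟩
    · rw [wp_block_cons]
      refine (tri_augment (F := F) hs₅ (hlab₅ ▸ hlab) (hlab₅ ▸ h2) (hlab₅ ▸ h9) hfnd).wp ?_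
      intro s₆ t₆ h10 hf₆ ht₆
      have hs₆ := hs₅.frame hf₆ rfl
      have hrem₆ : s₆.reg rRem = s₄.reg rRem := by rw [hf₆.reg _ rfl, hrem₅]
      have hvis₆ : s₆.arr aVis = s₅.arr aVis := hf₆.arr _ rfl
      rw [hlab₅] at h10
      simp [hs₆.one, hrem₆, hvis₆]
      refine ⟨⟨k - 1, by omega, F + 1, h10, by omega, h9.isVis, by omega, by omega⟩, by omega⟩
    · simp [hrem₅]
      exact ⟨⟨⟨0, by omega⟩, F, h2, h3, h9.isVis, fun _ => ⟨⟨h9.vis_le, h9.vis_two, h9.isVis,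
        h9.parent, h9.closed, by simpa using h9.not_found, by simpa using h9.found⟩, hfnd⟩⟩,
        by omega⟩
  · refine ⟨0, ?_, by omega, ?_, by omega, by omega⟩
    · intro A hA
      rw [harr₃, zero_add]
      unfold Net.cut Net.flux
      refine Finset.sum_congr rfl fun p hp => ?_
      rw [Finset.mem_Icc] at hp
      rw [h1 p (by omega) hp.2]
      rfl
    · rw [harr₃, hvis₂]
      exact hvis
  · rintro s' t' ⟨⟨k, F, h2, h3, h4, h5, h6⟩, hgo⟩ hf ht
    rw [wp_block_nil]
    refine ⟨⟨h4, fun hrem => ?_, fun hrem => ?_⟩, ?_⟩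
    · obtain ⟨h7, h8⟩ := h6 hgo hrem
      obtain ⟨h9, h10⟩ := h7.isFar h2 h8
      rw [Net.conn, ← h9.eq_far]
      exact ⟨by omega, h7.vis_le, rfl⟩
    · have := h2 _ (Λ.isFar_far lab).sep
      rw [Net.conn]
      omega
    · have h7 : (s.reg rD + 2) * (74 * Λ.N + 60 + 1) + (s.reg rD + 3) * (6 * Λ.N + 9) +
        (74 * Λ.N + 61) = (s.reg rD + 3) * (80 * Λ.N + 70) := by ring
      have h8 : 3 * (6 * Λ.N + 9) ≤ (s.reg rD + 3) * (6 * Λ.N + 9) :=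
        Nat.mul_le_mul_right _ (by omega)
      omega

end Layout

/-! ### The enumeration of cuts -/

namespace Prog

/-- One subtraction in the division of `code` by the base. -/
def digitStep (code dig : ℕ) : Prog := block [
  .sub dig dig rBase, .add code code rOne, .sub rX dig rPred]

/-- Moves the last digit of the register `code` to the register `dig`. -/
def digit (code dig : ℕ) : Prog := block [
  .copy dig code, .const code 0, .sub rX dig rPred, .loop rX (digitStep code dig)]

/-- Tests whether the half-edge `rX` leaves the cut to a vertex that may still be chosen. -/
def frontStep : Prog := block [
  .load rV aSrc rX, .load rA aVis rV,
  .ite rA .skip (block [.load rV aDst rX, .load rA aVis rV,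
    .ite rA (block [.load rB aLab rV, .sub rB rTwo rB, .ite rB (.copy rF rX) .skip]) .skip]),
  .sub rX rX rOne]

/-- Finds a half-edge that leaves the cut to a vertex that may still be chosen. -/
def front : Prog := block [.const rF 0, .copy rX rHalf, .loop rX frontStep]

/-- One step of the enumeration. -/
def extStep : Prog := block [
  flow, digit rW rDig,
  .ite rRem
    (block [front, .ite rF
      (block [.load rV aDst rF, .ite rDig (.store aLab rV rOne) (.store aLab rV rTwo)]) .skip])
    .skip,
  .sub rY rY rOne]

/-- The enumeration, guided by the digits of `rW`. -/
def ext : Prog := block [.copy rY rLen, .loop rY extStep, flow]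

end Prog

namespace Layout

variable {Λ : Layout}

theorem base_pos : 0 < Λ.base := by
  have := Λ.base_eq
  omega

/-- Division by repeated subtraction takes time linear in the code, which is affordable because
codes are bounded by the number of guesses. -/
theorem tri_digit {s : State} (hs : Λ.In s) {code dig : ℕ} (h1 : 20 ≤ code) (h2 : 20 ≤ dig)
    (h3 : code ≠ dig) (h4 : code ≠ 26) (h5 : dig ≠ 26)
    (hk : (Prog.digitStep code dig).keeps = true) :
    Tri (Prog.digit code dig) s (6 * s.reg code + 10) fun s' =>
      s'.reg dig = s.reg code % Λ.base ∧ s'.reg code = s.reg code / Λ.base := by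
  have hpos := Λ.base_pos
  have a1 : 5 ≠ code := by omega
  have a2 : 5 ≠ dig := by omega
  have a3 : 11 ≠ code := by omega
  have a4 : 11 ≠ dig := by omega
  have a5 : 12 ≠ code := by omega
  have a6 : 12 ≠ dig := by omega
  refine Tri.of_wp ?_
  simp only [Prog.digit, wp_block_cons, wp_copy, wp_const, wp_sub]
  set s₁ := State.setReg _ _ _ with hs₁
  have hd : s₁.reg dig = s.reg code := by simp [hs₁, h3.symm, h5]
  have hc : s₁.reg code = 0 := by simp [hs₁, h4]
  -- Subtracting the base minus one makes the test register nonzero exactly when the remainder is at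
  -- least the base.
  have hx : s₁.reg rX = s₁.reg dig - (Λ.base - 1) := by
    simp [hs₁, h3.symm, h5, a5, a6, hs.pred]
  have hone : s₁.reg rOne = 1 ∧ s₁.reg rBase = Λ.base ∧ s₁.reg rPred = Λ.base - 1 := by
    simp [hs₁, a1, a2, a3, a4, a5, a6, hs.one, hs.base, hs.pred]
  clear_value s₁
  simp only [Prog.keeps, List.all_cons, List.all_nil, Bool.and_true, Bool.and_eq_true,
    Bool.not_eq_true'] at hk
  refine Tri.wp (Tri.loop (b := 4) (k₀ := s.reg code) (fun k s' =>
    s'.reg dig + Λ.base * s'.reg code = s.reg code ∧ s'.reg dig = k ∧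
      s'.reg rX = s'.reg dig - (Λ.base - 1)) ?_ ⟨by simp [hd, hc], hd, hx⟩) ?_
  · rintro k s₂ hf ⟨h6, h7, h8⟩ h9
    have b1 : s₂.reg rOne = 1 := (hf.reg _ (by simp_all)).trans hone.1
    have b2 : s₂.reg rBase = Λ.base := (hf.reg _ (by simp_all)).trans hone.2.1
    have b3 : s₂.reg rPred = Λ.base - 1 := (hf.reg _ (by simp_all)).trans hone.2.2
    refine Tri.of_wp ?_
    simp [Prog.digitStep, b1, b2, b3, h3, h3.symm, h4, h5, a2, a5, a6]
    rw [mul_add]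
    omega
  · rintro s' t' ⟨⟨k, h6, h7, h8⟩, h9⟩ hf ht
    rw [wp_block_nil]
    have h10 : s'.reg dig < Λ.base := by omega
    refine ⟨?_, by omega⟩
    rw [← h6, Nat.add_mul_mod_self_left, Nat.mod_eq_of_lt h10, Nat.add_mul_div_left _ _ hpos,
      Nat.div_eq_of_lt h10, zero_add]
    exact ⟨rfl, rfl⟩

theorem tri_front {s : State} (hs : Λ.In s) (hlab : Λ.IsLab (s.arr aLab))
    (hfar : Λ.far (s.arr aLab) = {v | s.arr aVis v = 0}) :
    Tri Prog.front s (16 * Λ.N + 10) fun s' => s'.reg rF = Λ.front (s.arr aLab) := by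
  classical
  refine Tri.of_wp ?_
  simp only [Prog.front, wp_block_cons, wp_const, wp_copy]
  set s₁ := State.setReg _ _ _ with hs₁
  have hin : Λ.In s₁ := by
    iterate 2 refine Layout.In.setReg ?_ rfl
    exact hs
  have harr : s₁.arr = s.arr := rfl
  have hx : s₁.reg rX = Λ.N := by simp [hs₁, hs.half]
  have hF : s₁.reg rF = 0 := by simp [hs₁]
  clear_value s₁
  refine Tri.wp (Tri.down (b := 15) (k₀ := Λ.N) (fun k s' =>
    countdown (fun p f => if Λ.IsFront (s.arr aLab) p then p else f) k (s'.reg rF) =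
      Λ.front (s.arr aLab)) ?_ hx ?_) ?_
  · intro k s₂ hf h1 h2
    have hs₂ := hin.frame hf rfl
    have hlab₂ : s₂.arr aLab = s.arr aLab := by rw [hf.arr _ rfl, harr]
    have hvis₂ : s₂.arr aVis = s.arr aVis := by rw [hf.arr _ rfl, harr]
    have hl := hlab.le (Λ.dst (k + 1))
    refine Tri.of_wp ?_
    simp only [countdown, Net.IsFront, hfar, Set.mem_ofPred_eq] at h1
    simp [Prog.frontStep, hs₂.one, hs₂.two, hs₂.src, hs₂.dst, hlab₂, hvis₂, h2, Net.IsFront, hfar]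
    refine ⟨fun h3 => ?_, fun h3 => ⟨fun h4 => ⟨fun h5 => ?_, fun h5 => ?_⟩, fun h4 => ?_⟩⟩
    · rwa [if_neg fun h => h3 h.1] at h1
    · rwa [if_pos ⟨h3, h4, by omega⟩] at h1
    · rwa [if_neg fun h => h.2.2 (by omega)] at h1
    · rwa [if_neg fun h => h.2.1 h4] at h1
  · rw [hF]
    rfl
  · intro s' t' h1 hf ht
    rw [wp_block_nil]
    exact ⟨h1, by omega⟩

theorem IsLab.extStep {lab : ℕ → ℕ} (h : Λ.IsLab lab) (d b : ℕ) :
    Λ.IsLab (Λ.extStep d lab b) := by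
  unfold Net.extStep
  split_ifs with h1
  · exact h.update (Λ.dst_mem_verts ((Λ.front_spec lab).1 h1.2).1) (by omega)
  · exact h.update (Λ.dst_mem_verts ((Λ.front_spec lab).1 h1.2).1) (by omega)
  · exact h

theorem tri_extStep {s : State} (hs : Λ.In s) (hlab : Λ.IsLab (s.arr aLab))
    (hvis : Λ.IsVis (s.arr aVis)) :
    Tri Prog.extStep s ((s.reg rD + 3) * (80 * Λ.N + 70) + 16 * Λ.N + 6 * s.reg rW + 40) fun s' =>
      s'.arr aLab = Λ.extStep (s.reg rD) (s.arr aLab) (s.reg rW % Λ.base) ∧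
      s'.reg rW = s.reg rW / Λ.base ∧ Λ.IsVis (s'.arr aVis) ∧ s'.reg rY = s.reg rY - 1 := by
  refine Tri.of_wp ?_
  simp only [Prog.extStep, wp_block_cons]
  refine (tri_flow hs hlab hvis).wp ?_
  intro s₁ t₁ h1 hf₁ ht₁
  have hs₁ := hs.frame hf₁ rfl
  rw [wp_block_cons]
  refine (tri_digit (code := rW) (dig := rDig) hs₁ (by omega) (by omega) (by omega) (by omega)
    (by omega) rfl).wp ?_
  rintro s₂ t₂ ⟨h2, h3⟩ hf₂ ht₂
  have hs₂ := hs₁.frame hf₂ rfl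
  have hlab₂ : s₂.arr aLab = s.arr aLab := by rw [hf₂.arr _ rfl, hf₁.arr _ rfl]
  have hvis₂ : s₂.arr aVis = s₁.arr aVis := hf₂.arr _ rfl
  have hrem₂ : s₂.reg rRem = s₁.reg rRem := hf₂.reg _ rfl
  have hw₁ : s₁.reg rW = s.reg rW := hf₁.reg _ rfl
  have hy₂ : s₂.reg rY = s.reg rY := by rw [hf₂.reg _ rfl, hf₁.reg _ rfl]
  rw [hw₁] at h2 h3 ht₂
  rw [wp_block_cons, wp_ite, hrem₂]
  refine ⟨fun hrem => ?_, fun hrem => ?_⟩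
  · obtain ⟨h4, h5, h6⟩ := h1.success hrem
    rw [wp_block_cons]
    refine (tri_front hs₂ (hlab₂ ▸ hlab) (by rw [hlab₂, hvis₂, h6])).wp ?_
    intro s₃ t₃ h7 hf₃ ht₃
    have hs₃ := hs₂.frame hf₃ rfl
    have hlab₃ : s₃.arr aLab = s.arr aLab := by rw [hf₃.arr _ rfl, hlab₂]
    have hvis₃ : s₃.arr aVis = s₁.arr aVis := by rw [hf₃.arr _ rfl, hvis₂]
    have hdig₃ : s₃.reg rDig = s.reg rW % Λ.base := by rw [hf₃.reg _ rfl, h2]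
    have hw₃ : s₃.reg rW = s.reg rW / Λ.base := by rw [hf₃.reg _ rfl, h3]
    have hy₃ : s₃.reg rY = s.reg rY := by rw [hf₃.reg _ rfl, hy₂]
    rw [hlab₂] at h7
    simp [hs₃.one, hs₃.two, hs₃.dst, h7, hlab₃, hvis₃, hdig₃, hw₃, hy₃, Net.extStep, h4]
    refine ⟨fun h8 => ⟨fun h9 => ?_, fun h9 => ?_⟩, fun h8 => ?_⟩
    · rw [if_neg h8, if_neg h9]
      exact ⟨⟨rfl, h1.isVis⟩, by omega⟩
    · rw [if_neg h8, if_pos h9]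
      exact ⟨⟨rfl, h1.isVis⟩, by omega⟩
    · exact ⟨⟨fun h => absurd h8 h, h1.isVis⟩, by omega⟩
  · have h4 := h1.failure hrem
    simp [hs₂.one, hlab₂, hvis₂, h3, hy₂, Net.extStep, h4, h1.isVis]
    omega

/-- The flow after the last decision leaves the cut for the final labels in `aVis`, ready for
marking. -/
theorem tri_ext {s : State} (hs : Λ.In s) (hlab : Λ.IsLab (s.arr aLab))
    (hvis : Λ.IsVis (s.arr aVis)) :
    Tri Prog.ext s ((Λ.len + 1) *
        ((s.reg rD + 3) * (80 * Λ.N + 70) + 16 * Λ.N + 6 * s.reg rW + 50)) fun s' =>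
      s'.arr aLab = Λ.ext Λ.base (s.reg rD) Λ.len (s.arr aLab) (s.reg rW) ∧
      Flowed Λ (s'.arr aLab) (s.reg rD) s' ∧ Λ.IsLab (s'.arr aLab) := by
  refine Tri.of_wp ?_
  simp only [Prog.ext, wp_block_cons, wp_copy]
  set s₁ := State.setReg _ _ _ with hs₁
  have hin : Λ.In s₁ := hs.setReg rfl
  have harr : s₁.arr = s.arr := rfl
  have hy : s₁.reg rY = Λ.len := by simp [hs₁, hs.len]
  have hw : s₁.reg rW = s.reg rW := by simp [hs₁]
  have hD : s₁.reg rD = s.reg rD := by simp [hs₁]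
  clear_value s₁
  set b := (s.reg rD + 3) * (80 * Λ.N + 70) + 16 * Λ.N + 6 * s.reg rW + 40 with hb
  refine Tri.wp (Tri.down (b := b) (k₀ := Λ.len) (fun k s' =>
    Λ.ext Λ.base (s.reg rD) k (s'.arr aLab) (s'.reg rW) =
      Λ.ext Λ.base (s.reg rD) Λ.len (s.arr aLab) (s.reg rW) ∧ s'.reg rW ≤ s.reg rW ∧
      Λ.IsLab (s'.arr aLab) ∧ Λ.IsVis (s'.arr aVis)) ?_ hy ?_) ?_
  · rintro k s₂ hf ⟨h1, h2, h3, h4⟩ h5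
    have hs₂ := hin.frame hf rfl
    have hD₂ : s₂.reg rD = s.reg rD := by rw [hf.reg _ rfl, hD]
    refine (tri_extStep hs₂ h3 h4).mono ?_ ?_
    · rw [hD₂]
      omega
    · rintro s₃ ⟨h6, h7, h8, h9⟩ hf₃
      rw [hD₂] at h6
      refine ⟨⟨?_, ?_, ?_, h8⟩, by omega⟩
      · rw [h6, h7]
        exact h1
      · rw [h7]
        exact (Nat.div_le_self _ _).trans h2
      · rw [h6]
        exact h3.extStep _ _
  · rw [harr, hw]
    exact ⟨rfl, le_rfl, hlab, hvis⟩
  · rintro s₂ t₂ ⟨h1, h2, h3, h4⟩ hf ht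
    have hs₂ := hin.frame hf rfl
    have hD₂ : s₂.reg rD = s.reg rD := by rw [hf.reg _ rfl, hD]
    rw [wp_block_cons]
    refine (tri_flow hs₂ h3 h4).wp ?_
    intro s₃ t₃ h5 hf₃ ht₃
    have hlab₃ : s₃.arr aLab = s₂.arr aLab := hf₃.arr _ rfl
    rw [wp_block_nil, hlab₃]
    rw [hD₂] at h5 ht₃
    refine ⟨⟨h1, h5, h3⟩, ?_⟩
    have h6 : (Λ.len + 1) * (b + 10) = Λ.len * (b + 1) + Λ.len * 9 + (b + 10) := by ring
    have h7 : (s.reg rD + 3) * (80 * Λ.N + 70) + 16 * Λ.N + 6 * s.reg rW + 50 = b + 10 := by omega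
    rw [h7, h6]
    omega

end Layout

/-! ### Collecting the candidates -/

namespace Prog

/-- Copies the entry of array `A` at the vertex `vl x` to array `B`. -/
def copyStep (A B : ℕ) : Prog := block [
  .load rV aVl rX, .load rA A rV, .store B rV rA, .sub rX rX rOne]

/-- Copies the entries of array `A` at all ends of edges to array `B`. -/
def copyVerts (A B : ℕ) : Prog := block [.copy rX rNV, .loop rX (copyStep A B)]

/-- Counts the terminal `tl x` if it is new. -/
def countStep : Prog := block [
  .load rV aTl rX, .load rA aVis rV, .load rB aMk rV,
  .ite rA .skip (.ite rB .skip (.add rCnt rCnt rOne)), .sub rX rX rOne]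

/-- Marks the terminal `tl x` if it is new, and adds it to the list. -/
def markStep : Prog := block [
  .load rV aTl rX, .load rA aVis rV, .load rB aMk rV,
  .ite rA .skip (.ite rB .skip (.ite rR
    (block [.store aMk rV rOne, .add rHN rHN rOne, .store aHl rHN rV, .sub rR rR rOne]) .skip)),
  .sub rX rX rOne]

/-- Adds `rT` new terminals of the current cut to the list, if there are so many. -/
def mark : Prog := block [
  .const rCnt 0, .copy rX rNT, .loop rX countStep, .sub rA rT rCnt,
  .ite rA .skip (block [.copy rR rT, .copy rX rNT, .loop rX markStep])]

/-- Adds the terminals of the cut that belongs to a terminal and a guess. -/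
def attempt : Prog := block [
  copyVerts aBase aLab, .sub rW rGw rOne, .load rS aTl rI, .store aLab rS rOne, ext,
  .ite rRem mark .skip, .sub rGw rGw rOne]

/-- Marks the terminal `tl x` if it is in the current cut. -/
def markInit : Prog := block [
  .load rV aTl rX, .load rA aVis rV, .sub rA rOne rA, .store aMk rV rA, .sub rX rX rOne]

/-- Runs through all guesses for one terminal. -/
def candsStep : Prog := block [.copy rGw rGuesses, .loop rGw attempt, .sub rI rI rOne]

/-- Collects the candidates for the next terminal of the sought side. -/
def cands : Prog := block [
  .const rHN 0, copyVerts aLab aBase, .copy rX rNT, .loop rX markInit,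
  .copy rI rNT, .loop rI candsStep, copyVerts aBase aLab]

end Prog

namespace Layout

variable {Λ : Layout}

theorem NT_le : Λ.NT ≤ Λ.N := by
  have h : (Finset.Icc 1 Λ.NT).card ≤ Λ.verts.card := by
    refine Finset.card_le_card_of_injOn Λ.tl ?_ ?_
    · intro i hi
      simp only [Finset.coe_Icc, Set.mem_Icc] at hi
      exact (Λ.tl_mem i hi.1 hi.2).2
    · intro i hi j hj h
      simp only [Finset.coe_Icc, Set.mem_Icc] at hi hj
      exact Λ.tl_inj i j hi.1 hi.2 hj.1 hj.2 h
  simpa using h.trans Λ.card_verts_le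

/-- Running through the list of ends of edges instead of all vertices gives a cost in terms of the
number of half-edges, as the innermost loops require. -/
theorem tri_copyVerts {s : State} (hs : Λ.In s) {A B : ℕ} (hAB : A ≠ B)
    (hk : (Prog.copyStep A B).keeps = true) :
    Tri (Prog.copyVerts A B) s (6 * Λ.N + 5) fun s' =>
      (∀ v ∈ Λ.verts, s'.arr B v = s.arr A v) ∧ ∀ v, v ∉ Λ.verts → s'.arr B v = s.arr B v := by
  refine Tri.of_wp ?_
  simp only [Prog.copyVerts, wp_block_cons, wp_copy]
  set s₁ := State.setReg _ _ _ with hs₁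
  have hin : Λ.In s₁ := hs.setReg rfl
  have harr : s₁.arr = s.arr := rfl
  have hx : s₁.reg rX = Λ.NV := by simp [hs₁, hs.NV]
  clear_value s₁
  refine Tri.wp (Tri.down (b := 5) (k₀ := Λ.NV) (fun k s' => k ≤ Λ.NV ∧
    (∀ j, k < j → j ≤ Λ.NV → s'.arr B (Λ.vl j) = s.arr A (Λ.vl j)) ∧
      ∀ v, v ∉ Λ.verts → s'.arr B v = s.arr B v) ?_ hx ⟨le_rfl, by omega, by simp [harr]⟩) ?_
  · rintro k s₂ hf ⟨h0, h1, h2⟩ h3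
    have hs₂ := hin.frame hf hk
    have hA₂ : s₂.arr A = s.arr A := by
      rw [hf.arr _ (by simp [Prog.copyStep, Prog.block, Prog.writesArr, hAB]), harr]
    have hmem := Λ.vl_mem (k + 1) (by omega) h0
    refine Tri.of_wp ?_
    simp [Prog.copyStep, hs₂.vl, hs₂.one, hA₂, h3]
    refine ⟨by omega, fun j h4 h5 => ?_, fun v hv => ?_⟩
    · rw [Function.update_apply]
      split_ifs with h6
      · rw [h6]
      · exact h1 j (by by_contra h7; exact h6 (by rw [show j = k + 1 by omega])) h5
    · rw [Function.update_apply, if_neg fun h : v = _ => hv (h ▸ hmem)]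
      exact h2 v hv
  · rintro s' t' ⟨h0, h1, h2⟩ hf ht
    rw [wp_block_nil]
    have := Λ.NV_le
    refine ⟨⟨fun v hv => ?_, h2⟩, by omega⟩
    obtain ⟨j, h3, h4, rfl⟩ := Λ.exists_vl v hv
    exact h1 j h3 h4

/-- The marks and the list in memory represent the list `H`. -/
structure Marked (Λ : Layout) (lab : ℕ → ℕ) (H : List ℕ) (mk hl : ℕ → ℕ) (hn : ℕ) : Prop where
  mark : ∀ i, 1 ≤ i → i ≤ Λ.NT → (mk (Λ.tl i) = 0 ↔ Λ.tl i ∉ Λ.far lab ∧ Λ.tl i ∉ H)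
  length : hn = H.length
  get : ∀ j (hj : j < H.length), hl (j + 1) = H[j]

theorem Marked.append {lab : ℕ → ℕ} {H : List ℕ} {mk hl : ℕ → ℕ} {hn : ℕ}
    (h : Marked Λ lab H mk hl hn) (v : ℕ) :
    Marked Λ lab (H ++ [v]) (Function.update mk v 1) (Function.update hl (hn + 1) v) (hn + 1) := by
  constructor
  · intro i h1 h2
    rw [Function.update_apply]
    split_ifs with h3
    · simp [h3]
    · simp [h.mark i h1 h2, h3]
  · simp [h.length]
  · intro j hj
    rw [List.length_append, List.length_singleton] at hj
    rw [Function.update_apply, h.length]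
    split_ifs with h3
    · simp [Nat.succ_injective h3]
    · rw [List.getElem_append_left (by omega)]
      exact h.get j (by omega)

/-- A counting pass precedes the marking pass because nothing may be added if fewer than `t`
terminals are new. While marking, terminals still ahead keep their status, since `tl` has no
repetitions; this lets the filter refer to the old list. -/
theorem tri_mark {s : State} (hs : Λ.In s) {lab : ℕ → ℕ} {H : List ℕ}
    (h : Marked Λ lab H (s.arr aMk) (s.arr aHl) (s.reg rHN)) :
    Tri Prog.mark s (30 * Λ.N + 20) fun s' =>
      Marked Λ lab (Λ.mark lab (s.reg rT) H {v | s.arr aVis v = 0}) (s'.arr aMk) (s'.arr aHl)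
        (s'.reg rHN) := by
  classical
  set S := {v | s.arr aVis v = 0} with hS
  have hNT := Λ.NT_le
  have hcand : ∀ k, k + 1 ≤ Λ.NT → (Λ.IsCand lab H S (Λ.tl (k + 1)) ↔
      s.arr aVis (Λ.tl (k + 1)) = 0 ∧ s.arr aMk (Λ.tl (k + 1)) = 0) := fun k hk => by
    rw [h.mark (k + 1) (by omega) hk]
    rfl
  refine Tri.of_wp ?_
  simp only [Prog.mark, wp_block_cons, wp_const, wp_copy]
  set s₁ := State.setReg _ _ _ with hs₁
  have hin : Λ.In s₁ := by
    iterate 2 refine Layout.In.setReg ?_ rfl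
    exact hs
  have harr : s₁.arr = s.arr := rfl
  have hx : s₁.reg rX = Λ.NT := by simp [hs₁, hs.NT]
  have hcnt : s₁.reg rCnt = 0 := by simp [hs₁]
  have hT : s₁.reg rT = s.reg rT := by simp [hs₁]
  have hHN : s₁.reg rHN = s.reg rHN := by simp [hs₁]
  clear_value s₁
  refine Tri.wp (Tri.down (b := 10) (k₀ := Λ.NT) (fun k s' => k ≤ Λ.NT ∧
    s'.reg rCnt + ((descList Λ.tl k).filter (Λ.IsCand lab H S)).length =
      ((descList Λ.tl Λ.NT).filter (Λ.IsCand lab H S)).length) ?_ hx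
      ⟨le_rfl, by rw [hcnt, zero_add]⟩) ?_
  · rintro k s₂ hf ⟨h0, h1⟩ h2
    have hs₂ := hin.frame hf rfl
    have hvis₂ : s₂.arr aVis = s.arr aVis := by rw [hf.arr _ rfl, harr]
    have hmk₂ : s₂.arr aMk = s.arr aMk := by rw [hf.arr _ rfl, harr]
    rw [descList, List.filter_cons] at h1
    refine Tri.of_wp ?_
    simp [Prog.countStep, hs₂.one, hs₂.tl, hvis₂, hmk₂, h2]
    refine ⟨fun h3 => ?_, fun h3 => ⟨fun h4 => ?_, fun h4 => ?_⟩⟩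
    · rw [if_neg (by simp [hcand k h0, h3])] at h1
      exact ⟨by omega, h1⟩
    · rw [if_neg (by simp [hcand k h0, h4])] at h1
      exact ⟨by omega, h1⟩
    · rw [if_pos (by simp [hcand k h0, h3, h4])] at h1
      rw [List.length_cons] at h1
      exact ⟨by omega, by omega⟩
  rintro s₂ t₂ ⟨-, h1⟩ hf₂ ht₂
  have hs₂ := hin.frame hf₂ rfl
  have harr₂ : ∀ A, s₂.arr A = s.arr A := fun A => by rw [hf₂.arr A rfl, harr]
  have hT₂ : s₂.reg rT = s.reg rT := by rw [hf₂.reg _ rfl, hT]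
  have hHN₂ : s₂.reg rHN = s.reg rHN := by rw [hf₂.reg _ rfl, hHN]
  simp only [descList, List.filter_nil, List.length_nil, add_zero] at h1
  simp only [wp_block_cons, wp_sub, wp_ite, wp_skip, wp_block_nil, wp_copy]
  refine ⟨fun h2 => ⟨?_, by omega⟩, fun h2 => ?_⟩
  · simp [hT₂, h1] at h2
    unfold Inst.mark
    rw [if_neg (by omega)]
    simpa [harr₂, hHN₂] using h
  simp [hT₂, h1] at h2
  set s₃ := State.setReg (State.setReg (State.setReg _ _ _) _ _) _ _ with hs₃
  have hin₃ : Λ.In s₃ := by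
    iterate 3 refine Layout.In.setReg ?_ rfl
    exact hs₂
  have harr₃ : s₃.arr = s₂.arr := rfl
  have hx₃ : s₃.reg rX = Λ.NT := by simp [hs₃, hs₂.NT]
  have hR₃ : s₃.reg rR = s.reg rT := by simp [hs₃, hT₂]
  have hHN₃ : s₃.reg rHN = s.reg rHN := by simp [hs₃, hHN₂]
  clear_value s₃
  refine Tri.wp (Tri.down (b := 15) (k₀ := Λ.NT) (fun k s' => k ≤ Λ.NT ∧ ∃ H',
    Marked Λ lab H' (s'.arr aMk) (s'.arr aHl) (s'.reg rHN) ∧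
    (∀ i, 1 ≤ i → i ≤ k → (Λ.tl i ∈ H' ↔ Λ.tl i ∈ H)) ∧
    H' ++ ((descList Λ.tl k).filter (Λ.IsCand lab H S)).take (s'.reg rR) =
      Λ.mark lab (s.reg rT) H S) ?_ hx₃ ?_) ?_
  · rintro k s₄ hf ⟨h0, H', h3, h4, h5⟩ h6
    have hs₄ := hin₃.frame hf rfl
    have hvis₄ : s₄.arr aVis = s.arr aVis := by rw [hf.arr _ rfl, harr₃, harr₂]
    have hmk₄ : s₄.arr aMk (Λ.tl (k + 1)) = 0 ↔ s.arr aMk (Λ.tl (k + 1)) = 0 := by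
      rw [h3.mark _ (by omega) h0, h.mark _ (by omega) h0, h4 _ (by omega) le_rfl]
    have h4' : ∀ i, 1 ≤ i → i ≤ k → (Λ.tl i ∈ H' ↔ Λ.tl i ∈ H) := fun i a b => h4 i a (by omega)
    have hc := hcand k h0
    rw [descList, List.filter_cons] at h5
    refine Tri.of_wp ?_
    simp [Prog.markStep, hs₄.one, hs₄.tl, hvis₄, h6]
    refine ⟨fun h7 => ?_, fun h7 => ⟨fun h8 => ?_, fun h8 => ⟨fun h9 => ?_, fun h9 => ?_⟩⟩⟩
    · rw [if_neg (by simp [hc, h7])] at h5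
      exact ⟨by omega, H', h3, h4', h5⟩
    · rw [if_neg (by simp [hc, ← hmk₄, h8])] at h5
      exact ⟨by omega, H', h3, h4', h5⟩
    · rw [if_pos (by simp [hc, ← hmk₄, h7, h8])] at h5
      refine ⟨by omega, H' ++ [Λ.tl (k + 1)], h3.append _, fun i a b => ?_, ?_⟩
      · have : Λ.tl i ≠ Λ.tl (k + 1) := fun e => by
          have := Λ.tl_inj i (k + 1) a (by omega) (by omega) h0 e
          omega
        simp [h4' i a b, this]
      · obtain ⟨r, hr⟩ := Nat.exists_eq_succ_of_ne_zero h9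
        rw [← h5, hr]
        simp
    · rw [h9, List.take_zero] at h5
      exact ⟨by omega, H', h3, h4', by rw [h9, List.take_zero, h5]⟩
  · refine ⟨le_rfl, H, ?_, fun _ _ _ => Iff.rfl, ?_⟩
    · rw [harr₃, harr₂, harr₂, hHN₃]
      exact h
    · rw [hR₃, Inst.mark, if_pos (by omega)]
  · rintro s' t' ⟨-, H', h3, -, h5⟩ hf ht
    simp only [descList, List.filter_nil, List.take_nil, List.append_nil] at h5
    rw [wp_block_nil, wp_block_nil, ← h5]
    exact ⟨h3, by omega⟩

/-- All label arrays agree with the initial one away from ends of edges, so a partial copy restores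
the whole array. -/
theorem tri_restore {s : State} (hs : Λ.In s) (hlab : Λ.IsLab (s.arr aLab)) {lab : ℕ → ℕ}
    (hlab' : Λ.IsLab lab) {A : ℕ} (hA : A ≠ aLab) (h : ∀ v ∈ Λ.verts, s.arr A v = lab v)
    (hk : (Prog.copyStep A aLab).keeps = true) :
    Tri (Prog.copyVerts A aLab) s (6 * Λ.N + 5) fun s' => s'.arr aLab = lab := by
  refine (tri_copyVerts hs hA hk).mono le_rfl ?_
  rintro s₁ ⟨h1, h2⟩ -
  funext v
  by_cases hv : v ∈ Λ.verts
  · rw [h1 v hv, h v hv]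
  · rw [h2 v hv, hlab.eq v hv, hlab'.eq v hv]

variable (Λ) in
/-- A bound on the running time of a single enumeration. -/
def extCost : ℕ :=
  (Λ.len + 1) * ((Λ.base + 3) * (80 * Λ.N + 70) + 16 * Λ.N + 6 * Λ.guesses + 50)

theorem tri_attempt {s : State} (hs : Λ.In s) (hlab : Λ.IsLab (s.arr aLab))
    (hvis : Λ.IsVis (s.arr aVis)) {lab : ℕ → ℕ} (hlab' : Λ.IsLab lab)
    (hbase : ∀ v ∈ Λ.verts, s.arr aBase v = lab v) {H : List ℕ}
    (h : Marked Λ lab H (s.arr aMk) (s.arr aHl) (s.reg rHN)) (hd : s.reg rD ≤ Λ.base)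
    (hi : 1 ≤ s.reg rI) (hi' : s.reg rI ≤ Λ.NT) (hg : s.reg rGw ≤ Λ.guesses) :
    Tri Prog.attempt s (Λ.extCost + 36 * Λ.N + 40) fun s' =>
      Marked Λ lab (Λ.attempt lab (s.reg rD) (s.reg rT) (Λ.tl (s.reg rI)) (s.reg rGw - 1) H)
        (s'.arr aMk) (s'.arr aHl) (s'.reg rHN) ∧
      Λ.IsLab (s'.arr aLab) ∧ Λ.IsVis (s'.arr aVis) ∧ s'.reg rGw = s.reg rGw - 1 := by
  refine Tri.of_wp ?_
  simp only [Prog.attempt, wp_block_cons]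
  refine (tri_restore hs hlab hlab' (by omega) hbase rfl).wp ?_
  intro s₁ t₁ h1 hf₁ ht₁
  have hs₁ := hs.frame hf₁ rfl
  simp only [wp_block_cons, wp_sub, wp_load, wp_store]
  set s₂ := State.setArr _ _ _ _ with hs₂
  have hin₂ : Λ.In s₂ := by
    refine Layout.In.setArr ?_ rfl
    iterate 2 refine Layout.In.setReg ?_ rfl
    exact hs₁
  have hlab₂ : s₂.arr aLab = Function.update lab (Λ.tl (s.reg rI)) 1 := by
    simp [hs₂, h1, hs₁.tl, hs₁.one, hf₁.reg rI rfl]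
  have hvis₂ : s₂.arr aVis = s.arr aVis := by simp [hs₂, hf₁.arr aVis rfl]
  have hmk₂ : s₂.arr aMk = s.arr aMk := by simp [hs₂, hf₁.arr aMk rfl]
  have hhl₂ : s₂.arr aHl = s.arr aHl := by simp [hs₂, hf₁.arr aHl rfl]
  have hhn₂ : s₂.reg rHN = s.reg rHN := by simp [hs₂, hf₁.reg rHN rfl]
  have hw₂ : s₂.reg rW = s.reg rGw - 1 := by simp [hs₂, hf₁.reg rGw rfl, hs₁.one]
  have hgw₂ : s₂.reg rGw = s.reg rGw := by simp [hs₂, hf₁.reg rGw rfl]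
  have hd₂ : s₂.reg rD = s.reg rD := by simp [hs₂, hf₁.reg rD rfl]
  have ht₂ : s₂.reg rT = s.reg rT := by simp [hs₂, hf₁.reg rT rfl]
  clear_value s₂
  have hlab₂' : Λ.IsLab (s₂.arr aLab) := by
    rw [hlab₂]
    exact hlab'.update (Λ.tl_mem _ hi hi').2 (by omega)
  refine (tri_ext hin₂ hlab₂' (hvis₂ ▸ hvis)).wp ?_
  rintro s₃ t₃ ⟨h3, h4, h5⟩ hf₃ ht₃
  have hs₃ := hin₂.frame hf₃ rfl
  have h3' : s₃.arr aLab = Λ.leaf lab (s.reg rD) (Λ.tl (s.reg rI)) (s.reg rGw - 1) := by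
    rw [h3, hlab₂, hd₂, hw₂]
    rfl
  have hcost : (Λ.len + 1) * ((s₂.reg rD + 3) * (80 * Λ.N + 70) + 16 * Λ.N + 6 * s₂.reg rW + 50) ≤
      Λ.extCost := by
    refine Nat.mul_le_mul_left _ ?_
    have : (s₂.reg rD + 3) * (80 * Λ.N + 70) ≤ (Λ.base + 3) * (80 * Λ.N + 70) :=
      Nat.mul_le_mul_right _ (by omega)
    omega
  have hM₃ : Marked Λ lab H (s₃.arr aMk) (s₃.arr aHl) (s₃.reg rHN) := by
    rw [hf₃.arr _ rfl, hf₃.arr _ rfl, hf₃.reg _ rfl, hmk₂, hhl₂, hhn₂]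
    exact h
  have hT₃ : s₃.reg rT = s.reg rT := by rw [hf₃.reg _ rfl, ht₂]
  have hgw₃ : s₃.reg rGw = s.reg rGw := by rw [hf₃.reg _ rfl, hgw₂]
  rw [hd₂, h3'] at h4
  rw [h3'] at h5
  rw [wp_block_cons, wp_ite]
  refine ⟨fun h6 => ?_, fun h6 => ?_⟩
  · obtain ⟨h7, -, h8⟩ := h4.success h6
    refine (tri_mark hs₃ hM₃).wp ?_
    intro s₄ t₄ h9 hf₄ ht₄
    have hs₄ := hs₃.frame hf₄ rfl
    simp [hs₄.one, hf₄.reg rGw rfl, hgw₃, hf₄.arr aLab rfl, hf₄.arr aVis rfl, h3', h5, h4.isVis]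
    rw [Inst.attempt, if_pos h7, h8, ← hT₃]
    exact ⟨h9, by omega⟩
  · have h7 := h4.failure h6
    simp [hs₃.one, hgw₃, h3', h5, h4.isVis]
    rw [Inst.attempt, if_neg (by omega)]
    exact ⟨hM₃, by omega⟩

variable (Λ) in
/-- A bound on the time for collecting the candidates. -/
def candsCost : ℕ :=
  Λ.NT * (Λ.guesses * (Λ.extCost + 36 * Λ.N + 41) + 6) + 20 * Λ.N + 30

/-- Terminals in the current `far` are marked beforehand, so a single mark rules out both these and
the terminals already listed. -/
theorem tri_cands {s : State} (hs : Λ.In s) (hlab : Λ.IsLab (s.arr aLab))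
    (hvis : Λ.IsVis (s.arr aVis)) (hvis' : ∀ v, s.arr aVis v ≤ 1)
    (hfar : Λ.far (s.arr aLab) = {v | s.arr aVis v = 0}) (hd : s.reg rD ≤ Λ.base) :
    Tri Prog.cands s Λ.candsCost fun s' =>
      s'.reg rHN = (Λ.cands (s.arr aLab) (s.reg rD) (s.reg rT)).length ∧
      (∀ j (hj : j < (Λ.cands (s.arr aLab) (s.reg rD) (s.reg rT)).length),
        s'.arr aHl (j + 1) = (Λ.cands (s.arr aLab) (s.reg rD) (s.reg rT))[j]) ∧
      s'.arr aLab = s.arr aLab ∧ Λ.IsVis (s'.arr aVis) := by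
  have hNT := Λ.NT_le
  refine Tri.of_wp ?_
  simp only [Prog.cands, wp_block_cons, wp_const]
  set s₁ := State.setReg _ _ _ with hs₁
  have hin₁ : Λ.In s₁ := hs.setReg rfl
  have harr₁ : s₁.arr = s.arr := rfl
  have hhn₁ : s₁.reg rHN = 0 := by simp [hs₁]
  have hd₁ : s₁.reg rD = s.reg rD := by simp [hs₁]
  have hT₁ : s₁.reg rT = s.reg rT := by simp [hs₁]
  clear_value s₁
  refine (tri_copyVerts hin₁ (A := aLab) (B := aBase) (by omega) rfl).wp ?_
  rintro s₂ t₂ ⟨h2, -⟩ hf₂ ht₂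
  have hs₂ := hin₁.frame hf₂ rfl
  simp only [wp_block_cons, wp_copy]
  set s₃ := State.setReg _ _ _ with hs₃
  have hin₃ : Λ.In s₃ := hs₂.setReg rfl
  have harr₃ : s₃.arr = s₂.arr := rfl
  have hx₃ : s₃.reg rX = Λ.NT := by simp [hs₃, hs₂.NT]
  have hhn₃ : s₃.reg rHN = 0 := by simp [hs₃, hf₂.reg rHN rfl, hhn₁]
  have hd₃ : s₃.reg rD = s.reg rD := by simp [hs₃, hf₂.reg rD rfl, hd₁]
  have hT₃ : s₃.reg rT = s.reg rT := by simp [hs₃, hf₂.reg rT rfl, hT₁]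
  have hlab₃ : s₃.arr aLab = s.arr aLab := by rw [harr₃, hf₂.arr _ rfl, harr₁]
  have hvis₃ : s₃.arr aVis = s.arr aVis := by rw [harr₃, hf₂.arr _ rfl, harr₁]
  have hbase₃ : ∀ v ∈ Λ.verts, s₃.arr aBase v = s.arr aLab v := fun v hv => by
    rw [harr₃, h2 v hv, harr₁]
  clear_value s₃
  refine Tri.wp (Tri.down (b := 6) (k₀ := Λ.NT) (fun k s' => k ≤ Λ.NT ∧ ∀ j, k < j → j ≤ Λ.NT →
    (s'.arr aMk (Λ.tl j) = 0 ↔ Λ.tl j ∉ Λ.far (s.arr aLab))) ?_ hx₃ ⟨le_rfl, by omega⟩) ?_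
  · rintro k s₄ hf ⟨h0, h1⟩ h3
    have hs₄ := hin₃.frame hf rfl
    have hvis₄ : s₄.arr aVis = s.arr aVis := by rw [hf.arr _ rfl, hvis₃]
    refine Tri.of_wp ?_
    simp [Prog.markInit, hs₄.tl, hs₄.one, hvis₄, h3]
    refine ⟨by omega, fun j h4 h5 => ?_⟩
    rw [Function.update_apply]
    split_ifs with h6
    · rw [h6, hfar, Set.mem_ofPred_eq]
      have := hvis' (Λ.tl (k + 1))
      omega
    · exact h1 j (by by_contra h7; exact h6 (by rw [show j = k + 1 by omega])) h5
  rintro s₄ t₄ ⟨-, h4⟩ hf₄ ht₄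
  have hs₄ := hin₃.frame hf₄ rfl
  simp only [wp_block_cons, wp_copy]
  set s₅ := State.setReg _ _ _ with hs₅
  have hin₅ : Λ.In s₅ := hs₄.setReg rfl
  have harr₅ : s₅.arr = s₄.arr := rfl
  have hi₅ : s₅.reg rI = Λ.NT := by simp [hs₅, hs₄.NT]
  have hhn₅ : s₅.reg rHN = 0 := by simp [hs₅, hf₄.reg rHN rfl, hhn₃]
  have hd₅ : s₅.reg rD = s.reg rD := by simp [hs₅, hf₄.reg rD rfl, hd₃]
  have hT₅ : s₅.reg rT = s.reg rT := by simp [hs₅, hf₄.reg rT rfl, hT₃]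
  have hlab₅ : s₅.arr aLab = s.arr aLab := by rw [harr₅, hf₄.arr _ rfl, hlab₃]
  have hvis₅ : s₅.arr aVis = s.arr aVis := by rw [harr₅, hf₄.arr _ rfl, hvis₃]
  have hbase₅ : ∀ v ∈ Λ.verts, s₅.arr aBase v = s.arr aLab v := fun v hv => by
    rw [harr₅, hf₄.arr _ rfl, hbase₃ v hv]
  clear_value s₅
  set f : ℕ → ℕ → List ℕ → List ℕ := fun i g =>
    Λ.attempt (s.arr aLab) (s.reg rD) (s.reg rT) (Λ.tl i) (g - 1) with hfdef
  refine Tri.wp (Tri.down (b := Λ.guesses * (Λ.extCost + 36 * Λ.N + 41) + 5) (k₀ := Λ.NT)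
    (fun k s' => k ≤ Λ.NT ∧ Λ.IsLab (s'.arr aLab) ∧ Λ.IsVis (s'.arr aVis) ∧ ∃ H,
      Marked Λ (s.arr aLab) H (s'.arr aMk) (s'.arr aHl) (s'.reg rHN) ∧
      countdown (fun i => countdown (f i) Λ.guesses) k H =
        Λ.cands (s.arr aLab) (s.reg rD) (s.reg rT)) ?_ hi₅ ?_) ?_
  · rintro k s₆ hf ⟨h0, h5, h6, H, h7, h8⟩ h9
    have hs₆ := hin₅.frame hf rfl
    have hd₆ : s₆.reg rD = s.reg rD := by rw [hf.reg _ rfl, hd₅]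
    have hT₆ : s₆.reg rT = s.reg rT := by rw [hf.reg _ rfl, hT₅]
    have hbase₆ : ∀ v ∈ Λ.verts, s₆.arr aBase v = s.arr aLab v := fun v hv => by
      rw [hf.arr _ rfl, hbase₅ v hv]
    rw [countdown] at h8
    refine Tri.of_wp ?_
    simp only [Prog.candsStep, wp_block_cons, wp_copy]
    set s₇ := State.setReg _ _ _ with hs₇
    have hin₇ : Λ.In s₇ := hs₆.setReg rfl
    have harr₇ : s₇.arr = s₆.arr := rfl
    have hg₇ : s₇.reg rGw = Λ.guesses := by simp [hs₇, hs₆.guesses]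
    have hi₇ : s₇.reg rI = k + 1 := by simp [hs₇, h9]
    have hd₇ : s₇.reg rD = s.reg rD := by simp [hs₇, hd₆]
    have hT₇ : s₇.reg rT = s.reg rT := by simp [hs₇, hT₆]
    have hhn₇ : s₇.reg rHN = s₆.reg rHN := by simp [hs₇]
    clear_value s₇
    refine Tri.wp (Tri.down (b := Λ.extCost + 36 * Λ.N + 40) (k₀ := Λ.guesses)
      (fun g s' => g ≤ Λ.guesses ∧ Λ.IsLab (s'.arr aLab) ∧ Λ.IsVis (s'.arr aVis) ∧ ∃ H',
        Marked Λ (s.arr aLab) H' (s'.arr aMk) (s'.arr aHl) (s'.reg rHN) ∧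
        countdown (f (k + 1)) g H' = countdown (f (k + 1)) Λ.guesses H) ?_ hg₇ ?_) ?_
    · rintro g s₈ hf₈ ⟨a0, a1, a2, H', a3, a4⟩ a5
      have hs₈ := hin₇.frame hf₈ rfl
      have hd₈ : s₈.reg rD = s.reg rD := by rw [hf₈.reg _ rfl, hd₇]
      have hT₈ : s₈.reg rT = s.reg rT := by rw [hf₈.reg _ rfl, hT₇]
      have hi₈ : s₈.reg rI = k + 1 := by rw [hf₈.reg _ rfl, hi₇]
      refine (tri_attempt hs₈ a1 a2 hlab (fun v hv => ?_) a3 (by omega) (by omega) (by omega)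
        (by omega)).mono le_rfl ?_
      · rw [hf₈.arr _ rfl, harr₇, hbase₆ v hv]
      · rintro s₉ ⟨b1, b2, b3, b4⟩ -
        rw [hd₈, hT₈, hi₈, a5] at b1
        exact ⟨⟨by omega, b2, b3, _, b1, a4⟩, by omega⟩
    · rw [harr₇, hhn₇]
      exact ⟨le_rfl, h5, h6, H, h7, rfl⟩
    · rintro s₈ t₈ ⟨-, a1, a2, H', a3, a4⟩ hf₈ ht₈
      have hs₈ := hin₇.frame hf₈ rfl
      have hi₈ : s₈.reg rI = k + 1 := by rw [hf₈.reg _ rfl, hi₇]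
      simp only [countdown] at a4
      change t₈ ≤ _ + (Λ.guesses * (Λ.extCost + 36 * Λ.N + 41) + 1) at ht₈
      simp [hs₈.one, hi₈]
      exact ⟨⟨by omega, a1, a2, H', a3, by rw [a4, h8]⟩, by omega⟩
  · rw [hlab₅, hvis₅, hhn₅]
    refine ⟨le_rfl, hlab, hvis, [], ⟨fun i h5 h6 => ?_, rfl, by simp⟩, rfl⟩
    rw [harr₅, h4 i (by omega) h6]
    simp
  · rintro s₆ t₆ ⟨-, h5, h6, H, h7, h8⟩ hf₆ ht₆
    have hs₆ := hin₅.frame hf₆ rfl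
    rw [countdown] at h8
    rw [wp_block_cons]
    refine (tri_restore hs₆ h5 hlab (A := aBase) (by omega) (fun v hv => ?_) rfl).wp ?_
    · rw [hf₆.arr _ rfl, hbase₅ v hv]
    · intro s₇ t₇ h9 hf₇ ht₇
      rw [wp_block_nil, hf₇.reg _ rfl, hf₇.arr aHl rfl, hf₇.arr aVis rfl, ← h8]
      refine ⟨⟨h7.length, h7.get, h9, h6⟩, ?_⟩
      unfold candsCost
      have : Λ.guesses * (Λ.extCost + 36 * Λ.N + 41) + 5 + 1 =
        Λ.guesses * (Λ.extCost + 36 * Λ.N + 41) + 6 := rfl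
      rw [this] at ht₆
      omega

end Layout

/-! ### The search along all guesses -/

namespace Prog

/-- Counts the vertex `x - 1` if it is a terminal in the current cut. -/
def termStep : Prog := block [
  .sub rX rX rOne, .load rA aTerm rX, .load rB aVis rX,
  .ite rA (.ite rB .skip (.add rCnt rCnt rOne)) .skip]

/-- Counts the terminals in the current cut. -/
def countTerminals : Prog := block [.const rCnt 0, .copy rX rN, .loop rX termStep]

/-- Writes down on which side of the current cut the vertex `x - 1` is. -/
def outputStep : Prog := block [
  .sub rX rX rOne, .load rA aVis rX, .ite rSwap (.sub rA rOne rA) .skip, .store aFst rX rA]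

/-- Writes down the current cut. -/
def output : Prog := block [.copy rX rN, .loop rX outputStep, .copy rSucc rOne]

/-- Chooses the next terminal of the sought side. -/
def choose : Prog := block [
  digit rCode rD, digit rCode rT, cands, digit rCode rJ, .sub rA rHN rJ,
  .ite rA (block [.add rJ rJ rOne, .load rV aHl rJ, .store aLab rV rOne]) .skip]

/-- Checks the furthest smallest cut, and chooses a terminal if it is not good. -/
def level : Prog := block [
  .copy rD rL, flow,
  .ite rRem (block [countTerminals, .sub rA rC rCnt, .ite rA choose output]) .skip,
  .sub rLv rLv rOne]

/-- Follows a single guess. -/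
def guess : Prog := block [
  copyVerts aLab0 aLab, .sub rCode rGg rOne, .add rLv rC rOne, .loop rLv level, .sub rGg rGg rOne]

/-- Tries all guesses. -/
def main : Prog := block [.copy rGg rGuesses, .loop rGg guess]

end Prog

namespace Layout

variable {Λ : Layout}

theorem tri_countTerminals {s : State} (hs : Λ.In s) :
    Tri Prog.countTerminals s (8 * Λ.n + 5) fun s' =>
      s'.reg rCnt = Λ.tcount {v | s.arr aVis v = 0} := by
  classical
  refine Tri.of_wp ?_
  simp only [Prog.countTerminals, wp_block_cons, wp_const, wp_copy]
  set s₁ := State.setReg _ _ _ with hs₁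
  have hin : Λ.In s₁ := by
    iterate 2 refine Layout.In.setReg ?_ rfl
    exact hs
  have harr : s₁.arr = s.arr := rfl
  have hx : s₁.reg rX = Λ.n := by simp [hs₁, hs.n]
  have hcnt : s₁.reg rCnt = 0 := by simp [hs₁]
  clear_value s₁
  set F := Λ.T.filter fun v => s.arr aVis v = 0 with hF
  refine Tri.wp (Tri.down (b := 7) (k₀ := Λ.n) (fun k s' =>
    s'.reg rCnt + (F.filter (· < k)).card = F.card) ?_ hx ?_) ?_
  · intro k s₂ hf h1 h2
    have hs₂ := hin.frame hf rfl
    have hvis₂ : s₂.arr aVis = s.arr aVis := by rw [hf.arr _ rfl, harr]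
    have h3 : k ∈ F → (F.filter (· < k + 1)).card = (F.filter (· < k)).card + 1 := fun hk => by
      rw [← Finset.card_insert_of_notMem (a := k) (by simp)]
      congr 1
      ext v
      simp only [Finset.mem_filter, Finset.mem_insert]
      constructor
      · rintro ⟨a, b⟩
        obtain b | b := (Nat.lt_succ_iff.1 b).lt_or_eq
        · exact Or.inr ⟨a, b⟩
        · exact Or.inl b
      · rintro (rfl | ⟨a, b⟩)
        · exact ⟨hk, by omega⟩
        · exact ⟨a, by omega⟩
    have h4 : k ∉ F → (F.filter (· < k + 1)).card = (F.filter (· < k)).card := fun hk => by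
      congr 1
      refine Finset.filter_congr fun v hv => ⟨fun h => ?_, fun h => by omega⟩
      obtain h | h := (Nat.lt_succ_iff.1 h).lt_or_eq
      · exact h
      · exact absurd (h ▸ hv) hk
    have hterm := hs₂.term k
    refine Tri.of_wp ?_
    simp [Prog.termStep, hs₂.one, hvis₂, h2]
    refine ⟨fun h5 => ⟨fun h6 => ?_, fun h6 => ?_⟩, fun h5 => ?_⟩
    · rwa [h4 fun h => h6 (Finset.mem_filter.1 h).2] at h1
    · rw [h3 (Finset.mem_filter.2 ⟨hterm.1 h5, h6⟩)] at h1
      omega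
    · rwa [h4 fun h => hterm.2 (Finset.mem_filter.1 h).1 h5] at h1
  · rw [hcnt, zero_add]
    congr 1
    exact Finset.filter_true_of_mem fun v hv => Λ.T_lt v (Finset.mem_filter.1 hv).1
  · intro s' t' h1 hf ht
    rw [wp_block_nil]
    refine ⟨?_, by omega⟩
    simp only [not_lt_zero, Finset.filter_false, Finset.card_empty, add_zero] at h1
    rw [h1, Inst.tcount]
    congr 1
    ext v
    simp [hF]

/-- The output array describes the cut with the side `A`. -/
def Describes (Λ : Layout) (A : Set ℕ) (out : ℕ → ℕ) : Prop :=
  ∀ v < Λ.n, out v = 1 ↔ if Λ.swap = 0 then v ∉ A else v ∈ A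

theorem tri_output {s : State} (hs : Λ.In s) (hvis : ∀ v, s.arr aVis v ≤ 1) :
    Tri Prog.output s (7 * Λ.n + 5) fun s' =>
      Λ.Describes {v | s.arr aVis v = 0} (s'.arr aFst) ∧ s'.reg rSucc = 1 := by
  refine Tri.of_wp ?_
  simp only [Prog.output, wp_block_cons, wp_copy]
  set s₁ := State.setReg _ _ _ with hs₁
  have hin : Λ.In s₁ := hs.setReg rfl
  have harr : s₁.arr = s.arr := rfl
  have hx : s₁.reg rX = Λ.n := by simp [hs₁, hs.n]
  clear_value s₁
  refine Tri.wp (Tri.down (b := 6) (k₀ := Λ.n) (fun k s' => ∀ v < Λ.n, k ≤ v → (s'.arr aFst v = 1 ↔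
    if Λ.swap = 0 then s.arr aVis v ≠ 0 else s.arr aVis v = 0)) ?_ hx (by omega)) ?_
  · intro k s₂ hf h1 h2
    have hs₂ := hin.frame hf rfl
    have hvis₂ : s₂.arr aVis = s.arr aVis := by rw [hf.arr _ rfl, harr]
    have hk := hvis k
    refine Tri.of_wp ?_
    simp [Prog.outputStep, hs₂.one, hs₂.swap, hvis₂, h2]
    refine ⟨fun h3 v hv hkv => ?_, fun h3 v hv hkv => ?_⟩
    · rw [Function.update_apply, if_neg h3]
      split_ifs with h4
      · subst h4
        omega
      · rw [h1 v hv (by omega), if_neg h3]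
    · rw [Function.update_apply, if_pos h3]
      split_ifs with h4
      · subst h4
        omega
      · rw [h1 v hv (by omega), if_pos h3]
  · intro s' t' h1 hf ht
    have hs' := hin.frame hf rfl
    simp [hs'.one]
    exact ⟨fun v hv => h1 v hv (Nat.zero_le _), by omega⟩

theorem mem_cands {lab : ℕ → ℕ} {d t v : ℕ} (h : v ∈ Λ.cands lab d t) : v ∈ Λ.T ∧ v ∈ Λ.verts := by
  refine Inst.countdown_induction (P := fun H => ∀ v ∈ H, v ∈ Λ.T ∧ v ∈ Λ.verts)
    (fun i a h1 h2 ha => Inst.countdown_induction (P := fun H => ∀ v ∈ H, v ∈ Λ.T ∧ v ∈ Λ.verts)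
      (fun g H _ _ hH => ?_) ha) (by simp) v h
  intro v hv
  unfold Inst.attempt Inst.mark at hv
  split_ifs at hv
  · obtain hv | hv := List.mem_append.1 hv
    · exact hH v hv
    · have := (List.mem_filter.1 (List.mem_of_mem_take hv)).1
      obtain ⟨i, a, b, rfl⟩ := mem_descList.1 this
      exact Λ.tl_mem i a b
  · exact hH v hv
  · exact hH v hv

theorem tri_choose {s : State} (hs : Λ.In s) (hlab : Λ.IsLab (s.arr aLab))
    (hvis : Λ.IsVis (s.arr aVis)) (hvis' : ∀ v, s.arr aVis v ≤ 1)
    (hfar : Λ.far (s.arr aLab) = {v | s.arr aVis v = 0}) :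
    Tri Prog.choose s (Λ.candsCost + 18 * s.reg rCode + 40) fun s' =>
      s'.arr aLab = Λ.level (s.arr aLab) (s.reg rCode) ∧
      s'.reg rCode = s.reg rCode / Λ.base / Λ.base / Λ.base ∧ Λ.IsVis (s'.arr aVis) := by
  refine Tri.of_wp ?_
  simp only [Prog.choose, wp_block_cons]
  refine (tri_digit (code := rCode) (dig := rD) hs (by omega) (by omega) (by omega) (by omega)
    (by omega) rfl).wp ?_
  rintro s₁ t₁ ⟨h1, h1'⟩ hf₁ ht₁
  have hs₁ := hs.frame hf₁ rfl
  rw [wp_block_cons]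
  refine (tri_digit (code := rCode) (dig := rT) hs₁ (by omega) (by omega) (by omega) (by omega)
    (by omega) rfl).wp ?_
  rintro s₂ t₂ ⟨h2, h2'⟩ hf₂ ht₂
  have hs₂ := hs₁.frame hf₂ rfl
  rw [h1'] at h2 h2' ht₂
  have hd₂ : s₂.reg rD = s.reg rCode % Λ.base := by rw [hf₂.reg _ rfl, h1]
  have hlab₂ : s₂.arr aLab = s.arr aLab := by rw [hf₂.arr _ rfl, hf₁.arr _ rfl]
  have hvis₂ : s₂.arr aVis = s.arr aVis := by rw [hf₂.arr _ rfl, hf₁.arr _ rfl]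
  rw [wp_block_cons]
  refine (tri_cands hs₂ (hlab₂ ▸ hlab) (hvis₂ ▸ hvis) (hvis₂ ▸ hvis')
    (by rw [hlab₂, hvis₂, hfar]) ?_).wp ?_
  · rw [hd₂]
    exact (Nat.mod_lt _ Λ.base_pos).le
  rw [hlab₂, hd₂, h2]
  set C := Λ.cands (s.arr aLab) (s.reg rCode % Λ.base) (s.reg rCode / Λ.base % Λ.base) with hC
  rintro s₃ t₃ ⟨h3, h4, h5, h6⟩ hf₃ ht₃
  have hs₃ := hs₂.frame hf₃ rfl
  have hcode₃ : s₃.reg rCode = s.reg rCode / Λ.base / Λ.base := by rw [hf₃.reg _ rfl, h2']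
  rw [wp_block_cons]
  refine (tri_digit (code := rCode) (dig := rJ) hs₃ (by omega) (by omega) (by omega) (by omega)
    (by omega) rfl).wp ?_
  rintro s₄ t₄ ⟨h7, h8⟩ hf₄ ht₄
  have hs₄ := hs₃.frame hf₄ rfl
  rw [hcode₃] at h7 h8 ht₄
  have b1 := Nat.div_le_self (s.reg rCode) Λ.base
  have b2 := Nat.div_le_self (s.reg rCode / Λ.base) Λ.base
  have hhn₄ : s₄.reg rHN = C.length := by rw [hf₄.reg _ rfl, h3]
  have hhl₄ : s₄.arr aHl = s₃.arr aHl := hf₄.arr _ rfl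
  have hlab₄ : s₄.arr aLab = s.arr aLab := by rw [hf₄.arr _ rfl, h5]
  have hvis₄ : s₄.arr aVis = s₃.arr aVis := hf₄.arr _ rfl
  simp [hs₄.one, h7, h8, hhn₄, hhl₄, hlab₄, hvis₄, h6, Inst.level, ← hC]
  refine ⟨fun h9 => ?_, fun h9 => ?_⟩
  · have h10 : s.reg rCode / Λ.base / Λ.base % Λ.base < C.length := by omega
    rw [dif_pos h10, h4 _ h10]
    exact ⟨rfl, by omega⟩
  · exact ⟨fun h10 => absurd h10 (by omega), by omega⟩

/-- The labels extend the initial ones and forbid no terminal. -/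
structure Extends (Λ : Layout) (lab : ℕ → ℕ) : Prop where
  isLab : Λ.IsLab lab
  ne_two : ∀ v ∈ Λ.T, lab v ≠ 2
  sep : ∀ A, Sep lab A → Sep Λ.lab₀ A

/-- A candidate is a terminal, hence not forbidden, so labelling it only restricts the cuts. Thus
even a wrong guess yields nothing but sides of the original problem. -/
theorem Extends.level {lab : ℕ → ℕ} (h : Λ.Extends lab) (g : ℕ) : Λ.Extends (Λ.level lab g) := by
  unfold Inst.level
  split_ifs with h1
  · obtain ⟨h2, h3⟩ := mem_cands (List.getElem_mem h1)
    refine ⟨h.isLab.update h3 (by omega), fun v hv => ?_, fun A hA => ?_⟩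
    · rw [Function.update_apply]
      split_ifs
      · omega
      · exact h.ne_two v hv
    · exact h.sep A (Sep.of_update_one (h.ne_two _ h2) hA).1
  · exact h

/-- If the memory claims so, it contains a cut as desired. -/
def Answered (Λ : Layout) (s : State) : Prop :=
  s.reg rSucc ≠ 0 → ∃ A, Λ.IsSide Λ.lab₀ A ∧ Λ.Describes A (s.arr aFst)

theorem Answered.congr {s s' : State} (h : Λ.Answered s) (h1 : s'.reg rSucc = s.reg rSucc)
    (h2 : s'.arr aFst = s.arr aFst) : Λ.Answered s' := by
  unfold Answered
  rw [h1, h2]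
  exact h

variable (Λ) in
/-- A bound on the running time of a level. -/
def levelCost : ℕ :=
  (Λ.l + 3) * (80 * Λ.N + 70) + 15 * Λ.n + Λ.candsCost + 18 * Λ.guesses + 60

/-- There is no early exit. After a success the search goes on, which is harmless: the flag is never
cleared, and only valid sides are ever written over the output. -/
theorem tri_level {s : State} (hs : Λ.In s) (hlab : Λ.Extends (s.arr aLab))
    (hvis : Λ.IsVis (s.arr aVis)) (hans : Λ.Answered s) (hcode : s.reg rCode ≤ Λ.guesses) :
    Tri Prog.level s Λ.levelCost fun s' => Λ.Extends (s'.arr aLab) ∧ Λ.IsVis (s'.arr aVis) ∧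
      Λ.Answered s' ∧ s'.reg rCode ≤ s.reg rCode ∧ s'.reg rLv = s.reg rLv - 1 ∧
      (s.reg rSucc ≠ 0 → s'.reg rSucc ≠ 0) ∧
      ∀ k, Λ.Finds (k + 1) (s.arr aLab) (s.reg rCode) →
        s'.reg rSucc ≠ 0 ∨ Λ.Finds k (s'.arr aLab) (s'.reg rCode) := by
  refine Tri.of_wp ?_
  simp only [Prog.level, wp_block_cons, wp_copy]
  set s₁ := State.setReg _ _ _ with hs₁
  have hin : Λ.In s₁ := hs.setReg rfl
  have harr : s₁.arr = s.arr := rfl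
  have hd₁ : s₁.reg rD = Λ.l := by simp [hs₁, hs.l]
  have hcode₁ : s₁.reg rCode = s.reg rCode := by simp [hs₁]
  have hlv₁ : s₁.reg rLv = s.reg rLv := by simp [hs₁]
  have hsucc₁ : s₁.reg rSucc = s.reg rSucc := by simp [hs₁]
  clear_value s₁
  refine (tri_flow hin (harr ▸ hlab.isLab) (harr ▸ hvis)).wp ?_
  rw [hd₁, harr]
  intro s₂ t₂ h2 hf₂ ht₂
  have hs₂ := hin.frame hf₂ rfl
  have hlab₂ : s₂.arr aLab = s.arr aLab := by rw [hf₂.arr _ rfl, harr]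
  have hfst₂ : s₂.arr aFst = s.arr aFst := by rw [hf₂.arr _ rfl, harr]
  have hcode₂ : s₂.reg rCode = s.reg rCode := by rw [hf₂.reg _ rfl, hcode₁]
  have hlv₂ : s₂.reg rLv = s.reg rLv := by rw [hf₂.reg _ rfl, hlv₁]
  have hsucc₂ : s₂.reg rSucc = s.reg rSucc := by rw [hf₂.reg _ rfl, hsucc₁]
  simp only [wp_block_cons, wp_ite, wp_skip]
  refine ⟨fun h3 => ?_, fun h3 => ?_⟩
  · obtain ⟨h4, h5, h6⟩ := h2.success h3
    refine (tri_countTerminals hs₂).wp ?_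
    intro s₃ t₃ h7 hf₃ ht₃
    have hs₃ := hs₂.frame hf₃ rfl
    rw [← h6] at h7
    have hvis₃ : s₃.arr aVis = s₂.arr aVis := hf₃.arr _ rfl
    have hlab₃ : s₃.arr aLab = s.arr aLab := by rw [hf₃.arr _ rfl, hlab₂]
    have hfst₃ : s₃.arr aFst = s.arr aFst := by rw [hf₃.arr _ rfl, hfst₂]
    have hcode₃ : s₃.reg rCode = s.reg rCode := by rw [hf₃.reg _ rfl, hcode₂]
    have hlv₃ : s₃.reg rLv = s.reg rLv := by rw [hf₃.reg _ rfl, hlv₂]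
    have hsucc₃ : s₃.reg rSucc = s.reg rSucc := by rw [hf₃.reg _ rfl, hsucc₂]
    simp only [wp_block_cons, wp_sub, wp_ite]
    set s₄ := State.setReg _ _ _ with hs₄
    have hin₄ : Λ.In s₄ := hs₃.setReg rfl
    have harr₄ : s₄.arr = s₃.arr := rfl
    have hA₄ : s₄.reg rA = Λ.c - Λ.tcount (Λ.far (s.arr aLab)) := by simp [hs₄, hs₃.c, h7]
    have hcode₄ : s₄.reg rCode = s.reg rCode := by simp [hs₄, hcode₃]
    have hlv₄ : s₄.reg rLv = s.reg rLv := by simp [hs₄, hlv₃]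
    have hsucc₄ : s₄.reg rSucc = s.reg rSucc := by simp [hs₄, hsucc₃]
    clear_value s₄
    rw [hA₄]
    refine ⟨fun h8 => ?_, fun h8 => ?_⟩
    · refine (tri_choose hin₄ (by rw [harr₄, hlab₃]; exact hlab.isLab)
        (by rw [harr₄, hvis₃]; exact h2.isVis) (by rw [harr₄, hvis₃]; exact h5)
        (by rw [harr₄, hlab₃, hvis₃, h6])).wp ?_
      rintro s₅ t₅ ⟨h9, h10, h11⟩ hf₅ ht₅
      have hs₅ := hin₄.frame hf₅ rfl
      have hsucc₅ : s₅.reg rSucc = s.reg rSucc := by rw [hf₅.reg _ rfl, hsucc₄]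
      have hfst₅ : s₅.arr aFst = s.arr aFst := by rw [hf₅.arr _ rfl, harr₄, hfst₃]
      have hlv₅ : s₅.reg rLv = s.reg rLv := by rw [hf₅.reg _ rfl, hlv₄]
      rw [harr₄, hlab₃, hcode₄] at h9
      rw [hcode₄] at h10 ht₅
      simp only [wp_block_cons, wp_block_nil, wp_sub, State.arr_setReg]
      refine ⟨⟨?_, h11, hans.congr (by simp [hsucc₅]) (by simp [hfst₅]), ?_,
        by simp [hlv₅, hs₅.one], by simp [hsucc₅], fun k hk => ?_⟩, ?_⟩
      · rw [h9]
        exact hlab.level _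
      · simp [h10]
        exact (Nat.div_le_self _ _).trans ((Nat.div_le_self _ _).trans (Nat.div_le_self _ _))
      · right
        simp only [Inst.Finds] at hk
        have := hk.2.resolve_left (by omega)
        simpa [h9, h10] using this
      · unfold levelCost
        omega
    · refine (tri_output hin₄ (by rw [harr₄, hvis₃]; exact h5)).wp ?_
      rintro s₅ t₅ ⟨h9, h10⟩ hf₅ ht₅
      have hs₅ := hin₄.frame hf₅ rfl
      rw [harr₄, hvis₃, ← h6] at h9
      simp [hf₅.arr aLab rfl, hf₅.arr aVis rfl, hf₅.reg rLv rfl, hf₅.reg rCode rfl, harr₄, hlab₃,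
        hvis₃, hlv₄, hcode₄, hs₅.one, hlab, h2.isVis, h10]
      refine ⟨fun _ => ⟨_, ⟨hlab.sep _ (Λ.isFar_far _).sep, h4, by omega⟩, ?_⟩, ?_⟩
      · simpa using h9
      · unfold levelCost
        omega
  · have h4 := h2.failure h3
    simp only [wp_block_nil, wp_sub, State.arr_setReg]
    refine ⟨⟨hlab₂ ▸ hlab, h2.isVis, hans.congr (by simp [hsucc₂]) (by simp [hfst₂]),
      by simp [hcode₂], by simp [hlv₂, hs₂.one], by simp [hsucc₂], fun k hk => ?_⟩, ?_⟩
    · have := hk.1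
      omega
    · unfold levelCost
      omega

variable (Λ) in
/-- A bound on the time for following a guess. -/
def guessCost : ℕ := (Λ.c + 1) * (Λ.levelCost + 1) + 6 * Λ.N + 12

theorem extends_lab₀ : Λ.Extends Λ.lab₀ :=
  ⟨⟨Λ.lab₀_le, fun _ _ => rfl⟩, Λ.lab₀_ne, fun _ h => h⟩

theorem tri_guess {s : State} (hs : Λ.In s) (hlab : Λ.IsLab (s.arr aLab))
    (hvis : Λ.IsVis (s.arr aVis)) (hans : Λ.Answered s) (hg : s.reg rGg ≤ Λ.guesses) :
    Tri Prog.guess s Λ.guessCost fun s' => Λ.IsLab (s'.arr aLab) ∧ Λ.IsVis (s'.arr aVis) ∧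
      Λ.Answered s' ∧ s'.reg rGg = s.reg rGg - 1 ∧ (s.reg rSucc ≠ 0 → s'.reg rSucc ≠ 0) ∧
      (Λ.Finds (Λ.c + 1) Λ.lab₀ (s.reg rGg - 1) → s'.reg rSucc ≠ 0) := by
  refine Tri.of_wp ?_
  simp only [Prog.guess, wp_block_cons]
  refine (tri_restore hs hlab extends_lab₀.isLab (A := aLab0) (by omega)
    (fun v _ => by rw [hs.lab₀]) rfl).wp ?_
  intro s₁ t₁ h1 hf₁ ht₁
  have hs₁ := hs.frame hf₁ rfl
  simp only [wp_block_cons, wp_sub, wp_add]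
  set s₂ := State.setReg _ _ _ with hs₂
  have hin : Λ.In s₂ := by
    iterate 2 refine Layout.In.setReg ?_ rfl
    exact hs₁
  have harr : s₂.arr = s₁.arr := rfl
  have hcode : s₂.reg rCode = s.reg rGg - 1 := by simp [hs₂, hf₁.reg rGg rfl, hs₁.one]
  have hlv : s₂.reg rLv = Λ.c + 1 := by simp [hs₂, hs₁.c, hs₁.one]
  have hg₂ : s₂.reg rGg = s.reg rGg := by simp [hs₂, hf₁.reg rGg rfl]
  have hsucc : s₂.reg rSucc = s.reg rSucc := by simp [hs₂, hf₁.reg rSucc rfl]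
  clear_value s₂
  refine Tri.wp (Tri.down (b := Λ.levelCost) (k₀ := Λ.c + 1) (fun k s' => Λ.Extends (s'.arr aLab) ∧
    Λ.IsVis (s'.arr aVis) ∧ Λ.Answered s' ∧ s'.reg rCode ≤ Λ.guesses ∧
    (s.reg rSucc ≠ 0 → s'.reg rSucc ≠ 0) ∧ (Λ.Finds (Λ.c + 1) Λ.lab₀ (s.reg rGg - 1) →
      s'.reg rSucc ≠ 0 ∨ Λ.Finds k (s'.arr aLab) (s'.reg rCode))) ?_ hlv ?_) ?_
  · rintro k s₃ hf ⟨a1, a2, a3, a4, a5, a6⟩ a7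
    refine (tri_level (hin.frame hf rfl) a1 a2 a3 a4).mono le_rfl ?_
    rintro s₄ ⟨b1, b2, b3, b4, b5, b6, b7⟩ -
    refine ⟨⟨b1, b2, b3, b4.trans a4, fun h => b6 (a5 h), fun h => ?_⟩, by omega⟩
    obtain h2 | h2 := a6 h
    · exact Or.inl (b6 h2)
    · exact b7 k h2
  · rw [harr, h1, hcode, hsucc]
    refine ⟨extends_lab₀, ?_, hans.congr hsucc ?_, by omega, id, Or.inr⟩
    · rw [hf₁.arr _ rfl]
      exact hvis
    · rw [harr, hf₁.arr _ rfl]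
  · rintro s₃ t₃ ⟨a1, a2, a3, a4, a5, a6⟩ hf ht
    have hs₃ := hin.frame hf rfl
    have hg₃ : s₃.reg rGg = s.reg rGg := by rw [hf.reg _ rfl, hg₂]
    simp only [wp_block_cons, wp_block_nil, wp_sub, State.arr_setReg]
    refine ⟨⟨a1.isLab, a2, a3.congr (by simp) (by simp), by simp [hg₃, hs₃.one], by simpa using a5,
      fun h => ?_⟩, ?_⟩
    · simpa [Inst.Finds] using a6 h
    · unfold guessCost
      omega

variable (Λ) in
/-- A bound on the running time of the search. -/
def mainCost : ℕ := Λ.guesses * (Λ.guessCost + 1) + 3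

theorem tri_main {s : State} (hs : Λ.In s) (hlab : Λ.IsLab (s.arr aLab))
    (hvis : Λ.IsVis (s.arr aVis)) (hsucc : s.reg rSucc = 0) :
    Tri Prog.main s Λ.mainCost fun s' =>
      Λ.Answered s' ∧ (s'.reg rSucc = 0 → ¬ ∃ A, Λ.IsSide Λ.lab₀ A) := by
  refine Tri.of_wp ?_
  simp only [Prog.main, wp_block_cons, wp_copy]
  set s₁ := State.setReg _ _ _ with hs₁
  have hin : Λ.In s₁ := hs.setReg rfl
  have harr : s₁.arr = s.arr := rfl
  have hg : s₁.reg rGg = Λ.guesses := by simp [hs₁, hs.guesses]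
  have hsucc₁ : s₁.reg rSucc = 0 := by simp [hs₁, hsucc]
  clear_value s₁
  refine Tri.wp (Tri.down (b := Λ.guessCost) (k₀ := Λ.guesses) (fun k s' => k ≤ Λ.guesses ∧
    Λ.IsLab (s'.arr aLab) ∧ Λ.IsVis (s'.arr aVis) ∧ Λ.Answered s' ∧
    ∀ g < Λ.guesses, k ≤ g → Λ.Finds (Λ.c + 1) Λ.lab₀ g → s'.reg rSucc ≠ 0) ?_ hg ?_) ?_
  · rintro k s₂ hf ⟨a0, a1, a2, a3, a4⟩ a5
    refine (tri_guess (hin.frame hf rfl) a1 a2 a3 (by omega)).mono le_rfl ?_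
    rintro s₃ ⟨b1, b2, b3, b4, b5, b6⟩ -
    refine ⟨⟨by omega, b1, b2, b3, fun g hg hk h => ?_⟩, by omega⟩
    obtain rfl | hk := hk.eq_or_lt
    · exact b6 (by rwa [a5])
    · exact b5 (a4 g hg hk h)
  · rw [harr]
    exact ⟨le_rfl, hlab, hvis, fun h => absurd hsucc₁ h, by omega⟩
  · rintro s₂ t₂ ⟨-, a1, a2, a3, a4⟩ hf ht
    rw [wp_block_nil]
    refine ⟨⟨a3, ?_⟩, ?_⟩
    · rintro h ⟨A, hA⟩
      -- As `l ≤ c`, the search needs `c + 1` levels with three digits each, exactly the length `3 *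
      -- c + 3`.
      obtain ⟨g, hg, h1⟩ := Inst.exists_finds (Λ.c + 1) Λ.lab₀_ne hA (by have := Λ.l_le; omega)
      refine a4 g (hg.trans_eq ?_) (Nat.zero_le _) h1 h
      rw [Inst.guesses, Λ.len_eq, mul_add]
    · unfold mainCost
      omega

end Layout

/-! ### Setting up the data structures -/

namespace Prog

/-- Detects that the vertex `x` makes the problem unsolvable. -/
def check : Prog := block [
  .load rA aQ0 rX, .load rB aQ1 rX, .load rV aTerm rX,
  .ite rA (.ite rB (.const rOkay 0) (.ite rV (.const rOkay 0) .skip))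
    (.ite rB (.ite rV (.const rOkay 0) .skip) .skip)]

/-- Computes the label of the vertex `x`. -/
def label : Prog := block [
  .load rA aQ0 rX, .load rB aQ1 rX,
  .ite rSwap (.ite rA (.const rQ 1) (.ite rB (.const rQ 2) (.const rQ 0)))
    (.ite rA (.const rQ 2) (.ite rB (.const rQ 1) (.const rQ 0)))]

/-- Sets the label of the vertex `x - 1`. -/
def labelStep : Prog := block [
  .sub rX rX rOne, check, label, .store aLab0 rX rQ, .store aLab rX rQ, .sub rQ rQ rOne,
  .store aVis rX rQ]

/-- Sets the initial labels. -/
def labels : Prog := block [.const rOkay 1, .copy rX rN, .loop rX labelStep]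

/-- Adds a half-edge with the number `p` from the vertex in `rA` to the vertex in `rB`. -/
def halfEdge (p a b q : ℕ) : Prog := block [
  .store aSrc p a, .store aDst p b, .store aRev p q, .load rQ aHead a, .store aNxt p rQ,
  .store aHead a p]

/-- Adds the two half-edges of an edge. -/
def edgeStep : Prog := block [
  .load rA aFst rW, .load rB aSnd rW, .add rV rHalf rOne, .add rHalf rV rOne,
  halfEdge rV rA rB rHalf, halfEdge rHalf rB rA rV, .add rW rW rOne, .sub rX rX rOne]

/-- Builds the lists of half-edges. -/
def edges : Prog := block [
  .const rHalf 0, .const rW 0, .copy rX rM, .loop rX edgeStep]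

/-- Adds the vertex `x - 1` to the lists to which it belongs. -/
def listStep : Prog := block [
  .sub rX rX rOne, .load rA aHead rX, .load rB aTerm rX,
  .ite rA (block [.add rNV rNV rOne, .store aVl rNV rX,
    .ite rB (block [.add rNT rNT rOne, .store aTl rNT rX]) .skip]) .skip]

/-- Lists the vertices and the terminals that are ends of edges. -/
def lists : Prog := block [.const rNV 0, .const rNT 0, .copy rX rN, .loop rX listStep]

end Prog

/-- The memory holds an input with `n` vertices and `m` edges. -/
structure Fresh (s : State) : Prop where
  reg : ∀ r, 5 ≤ r → s.reg r = 0
  arr : ∀ A, 5 ≤ A → ∀ i, s.arr A i = 0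
  fst_lt : ∀ e < s.reg rM, s.arr aFst e < s.reg rN
  snd_lt : ∀ e < s.reg rM, s.arr aSnd e < s.reg rN
  term : ∀ v, s.reg rN ≤ v → s.arr aTerm v = 0
  q0 : ∀ v, s.reg rN ≤ v → s.arr aQ0 v = 0
  q1 : ∀ v, s.reg rN ≤ v → s.arr aQ1 v = 0

/-- The label of a vertex in terms of the indicators of the two prescribed sets. -/
def labelOf (swap x y : ℕ) : ℕ :=
  if swap = 0 then if x ≠ 0 then 2 else if y ≠ 0 then 1 else 0
  else if x ≠ 0 then 1 else if y ≠ 0 then 2 else 0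

/-- The vertex does not make the problem unsolvable. -/
def Compatible (x y t : ℕ) : Prop := (x = 0 ∨ y = 0) ∧ (x = 0 ∨ t = 0) ∧ (y = 0 ∨ t = 0)

theorem tri_check (s : State) : Tri Prog.check s 8 fun s' => s'.reg rOkay ≠ 0 ↔ s.reg rOkay ≠ 0 ∧
    Compatible (s.arr aQ0 (s.reg rX)) (s.arr aQ1 (s.reg rX)) (s.arr aTerm (s.reg rX)) := by
  refine Tri.of_wp ?_
  simp [Prog.check, Compatible]
  refine ⟨fun h1 => ⟨fun h2 => ?_, fun h2 => ⟨fun h3 => ?_, fun h3 => ?_⟩⟩,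
    fun h1 => ⟨fun h2 => ⟨fun h3 => ?_, fun h3 => ?_⟩, fun h2 => ?_⟩⟩ <;> simp [*]

theorem tri_label (s : State) : Tri Prog.label s 7 fun s' =>
    s'.reg rQ = labelOf (s.reg rSwap) (s.arr aQ0 (s.reg rX)) (s.arr aQ1 (s.reg rX)) := by
  refine Tri.of_wp ?_
  simp [Prog.label, labelOf]
  refine ⟨fun h1 => ⟨fun h2 => ?_, fun h2 => ⟨fun h3 => ?_, fun h3 => ?_⟩⟩,
    fun h1 => ⟨fun h2 => ?_, fun h2 => ⟨fun h3 => ?_, fun h3 => ?_⟩⟩⟩ <;> simp [*]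

/-- Writing `aVis` here supplies the permanent values at isolated vertices that the searches rely on
and never rewrite. -/
theorem tri_labels {s s₀ : State} (h₀ : Fresh s₀) (h1 : s.reg rOne = 1)
    (hn : s.reg rN = s₀.reg rN) (harr : s.arr = s₀.arr) :
    Tri Prog.labels s (23 * s₀.reg rN + 5) fun s' =>
      (∀ v, s'.arr aLab0 v = labelOf (s.reg rSwap) (s₀.arr aQ0 v) (s₀.arr aQ1 v)) ∧
      s'.arr aLab = s'.arr aLab0 ∧ (∀ v, s'.arr aVis v = s'.arr aLab0 v - 1) ∧
      (s'.reg rOkay ≠ 0 ↔ ∀ v, Compatible (s₀.arr aQ0 v) (s₀.arr aQ1 v) (s₀.arr aTerm v)) := by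
  refine Tri.of_wp ?_
  simp only [Prog.labels, wp_block_cons, wp_const, wp_copy]
  set s₁ := State.setReg _ _ _ with hs₁
  have harr₁ : s₁.arr = s₀.arr := harr
  have hx : s₁.reg rX = s₀.reg rN := by simp [hs₁, hn]
  have hone : s₁.reg rOne = 1 := by simp [hs₁, h1]
  have hok : s₁.reg rOkay = 1 := by simp [hs₁]
  have hswap : s₁.reg rSwap = s.reg rSwap := by simp [hs₁]
  clear_value s₁
  refine Tri.wp (Tri.down (b := 22) (k₀ := s₀.reg rN) (fun k s' =>
    (∀ v, s'.arr aLab0 v =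
      if k ≤ v then labelOf (s.reg rSwap) (s₀.arr aQ0 v) (s₀.arr aQ1 v) else 0) ∧
    (∀ v, s'.arr aLab v = s'.arr aLab0 v) ∧ (∀ v, s'.arr aVis v = s'.arr aLab0 v - 1) ∧
    (s'.reg rOkay ≠ 0 ↔ ∀ v, k ≤ v →
      Compatible (s₀.arr aQ0 v) (s₀.arr aQ1 v) (s₀.arr aTerm v))) ?_ hx ?_) ?_
  · rintro k s₂ hf ⟨a1, a2, a3, a4⟩ a5
    have hone₂ : s₂.reg rOne = 1 := by rw [hf.reg _ rfl, hone]
    refine Tri.of_wp ?_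
    simp only [Prog.labelStep, wp_block_cons, wp_sub]
    set s₃ := State.setReg _ _ _ with hs₃
    have harr₃ : s₃.arr = s₂.arr := rfl
    have hx₃ : s₃.reg rX = k := by simp [hs₃, a5, hone₂]
    have hone₃ : s₃.reg rOne = 1 := by simp [hs₃, hone₂]
    have hok₃ : s₃.reg rOkay = s₂.reg rOkay := by simp [hs₃]
    have hswap₃ : s₃.reg rSwap = s.reg rSwap := by simp [hs₃, hf.reg rSwap rfl, hswap]
    clear_value s₃
    refine (tri_check s₃).wp ?_
    rintro s₄ t₄ b1 hf₄ ht₄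
    rw [wp_block_cons]
    refine (tri_label s₄).wp ?_
    rintro s₅ t₅ b2 hf₅ ht₅
    rw [hf₄.reg rX rfl, hf₄.reg rSwap rfl, hf₄.arr _ rfl, hf₄.arr _ rfl, harr₃, hf.arr aQ0 rfl,
      hf.arr aQ1 rfl, harr₁, hx₃, hswap₃] at b2
    rw [harr₃, hf.arr aQ0 rfl, hf.arr aQ1 rfl, hf.arr aTerm rfl, harr₁, hx₃, hok₃, a4] at b1
    simp [hf₅.reg rX rfl, hf₄.reg rX rfl, hx₃, hf₅.reg rOne rfl, hf₄.reg rOne rfl, hone₃,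
      hf₅.arr aLab0 rfl, hf₄.arr aLab0 rfl, hf₅.arr aLab rfl, hf₄.arr aLab rfl, hf₅.arr aVis rfl,
      hf₄.arr aVis rfl, harr₃, hf₅.reg rOkay rfl, b2]
    refine ⟨⟨fun v => ?_, fun v => ?_, fun v => ?_, ?_⟩, by omega⟩
    · rw [Function.update_apply]
      split_ifs with h2 h3 h3
      · rw [h2]
      · omega
      · rw [a1, if_pos (by omega)]
      · rw [a1, if_neg (by omega)]
    · simp only [Function.update_apply]
      split_ifs
      · rfl
      · exact a2 v
    · simp only [Function.update_apply]
      split_ifs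
      · rfl
      · exact a3 v
    · rw [← ne_eq, b1]
      constructor
      · rintro ⟨c1, c2⟩ v hv
        obtain rfl | hv := hv.eq_or_lt
        · exact c2
        · exact c1 v hv
      · exact fun h => ⟨fun v hv => h v (by omega), h k le_rfl⟩
  · rw [harr₁, hok]
    refine ⟨fun v => ?_, fun v => ?_, fun v => ?_, ?_⟩
    · rw [h₀.arr _ (by omega)]
      split_ifs with h2
      · simp [labelOf, h₀.q0 v h2, h₀.q1 v h2]
      · rfl
    · rw [h₀.arr _ (by omega), h₀.arr _ (by omega)]
    · rw [h₀.arr _ (by omega), h₀.arr _ (by omega)]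
    · refine ⟨fun _ v hv => ?_, fun _ => by omega⟩
      simp [Compatible, h₀.q0 v hv, h₀.q1 v hv]
  · rintro s' t' ⟨a1, a2, a3, a4⟩ hf ht
    rw [wp_block_nil]
    exact ⟨⟨fun v => by rw [a1, if_pos (Nat.zero_le _)], funext a2, a3, by simpa using a4⟩,
      by omega⟩

/-- The half-edges `1, …, h` have been added to the lists of half-edges. -/
structure Chained (h : ℕ) (src nxt head : ℕ → ℕ) : Prop where
  nxt_le : ∀ p ∈ Finset.Icc 1 h, nxt p < p
  src_nxt : ∀ p ∈ Finset.Icc 1 h, nxt p ≠ 0 → src (nxt p) = src p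
  le_nxt : ∀ p ∈ Finset.Icc 1 h, ∀ q ∈ Finset.Icc 1 h, src q = src p → q < p → q ≤ nxt p
  le_head : ∀ p ∈ Finset.Icc 1 h, p ≤ head (src p)
  head_mem : ∀ v, head v ≠ 0 → head v ∈ Finset.Icc 1 h ∧ src (head v) = v

/-- The new half-edge has the largest number, so putting it in front keeps the adjacency list
decreasing and complete. -/
theorem Chained.push {h : ℕ} {src nxt head : ℕ → ℕ} (H : Chained h src nxt head) (a : ℕ) :
    Chained (h + 1) (Function.update src (h + 1) a) (Function.update nxt (h + 1) (head a))
      (Function.update head a (h + 1)) := by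
  have hmem : ∀ p ∈ Finset.Icc 1 (h + 1), p = h + 1 ∨ p ≠ h + 1 ∧ p ∈ Finset.Icc 1 h := by
    intro p hp
    simp only [Finset.mem_Icc] at hp ⊢
    omega
  have hlt : ∀ v, head v < h + 1 := fun v => by
    by_cases hv : head v = 0
    · omega
    · have := Finset.mem_Icc.1 (H.head_mem v hv).1
      omega
  constructor
  · intro p hp
    obtain rfl | ⟨h1, h2⟩ := hmem p hp
    · simpa using hlt a
    · rw [Function.update_of_ne h1]
      exact H.nxt_le p h2
  · intro p hp
    obtain rfl | ⟨h1, h2⟩ := hmem p hp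
    · rw [Function.update_self, Function.update_self, Function.update_of_ne (hlt a).ne]
      exact fun h3 => (H.head_mem a h3).2
    · have := H.nxt_le p h2
      have h3 := (Finset.mem_Icc.1 h2).2
      rw [Function.update_of_ne h1, Function.update_of_ne h1, Function.update_of_ne (by omega)]
      exact H.src_nxt p h2
  · intro p hp q hq h3 h4
    obtain rfl | ⟨h1, h2⟩ := hmem p hp
    · obtain rfl | ⟨h5, h6⟩ := hmem q hq
      · omega
      · rw [Function.update_self, Function.update_of_ne h5] at h3
        rw [Function.update_self, ← h3]
        exact H.le_head q h6
    · obtain rfl | ⟨h5, h6⟩ := hmem q hq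
      · have := (Finset.mem_Icc.1 h2).2
        omega
      · rw [Function.update_of_ne h5, Function.update_of_ne h1] at h3
        rw [Function.update_of_ne h1]
        exact H.le_nxt p h2 q h6 h3 h4
  · intro p hp
    obtain rfl | ⟨h1, h2⟩ := hmem p hp
    · rw [Function.update_self, Function.update_self]
    · rw [Function.update_of_ne h1, Function.update_apply]
      split_ifs
      · have := (Finset.mem_Icc.1 h2).2
        omega
      · exact H.le_head p h2
  · intro v
    rw [Function.update_apply]
    split_ifs with h1
    · intro _
      simp [h1]
    · intro h2
      obtain ⟨h3, h4⟩ := H.head_mem v h2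
      rw [Function.update_of_ne (hlt v).ne]
      simp only [Finset.mem_Icc] at h3 ⊢
      exact ⟨by omega, h4⟩

/-- The half-edges of the first `e` edges are in memory. -/
def Paired (fst snd src dst rev : ℕ → ℕ) (e : ℕ) : Prop :=
  ∀ j < e, (src (2 * j + 1) = fst j ∧ dst (2 * j + 1) = snd j ∧ rev (2 * j + 1) = 2 * j + 2) ∧
    src (2 * j + 2) = snd j ∧ dst (2 * j + 2) = fst j ∧ rev (2 * j + 2) = 2 * j + 1

theorem tri_edges {s s₀ : State} (h1 : s.reg rOne = 1)
    (hm : s.reg rM = s₀.reg rM) (hfst : s.arr aFst = s₀.arr aFst) (hsnd : s.arr aSnd = s₀.arr aSnd)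
    (harr : ∀ v, s.arr aHead v = 0) :
    Tri Prog.edges s (23 * s₀.reg rM + 6) fun s' => s'.reg rHalf = 2 * s₀.reg rM ∧
      Chained (2 * s₀.reg rM) (s'.arr aSrc) (s'.arr aNxt) (s'.arr aHead) ∧
      Paired (s₀.arr aFst) (s₀.arr aSnd) (s'.arr aSrc) (s'.arr aDst) (s'.arr aRev)
        (s₀.reg rM) := by
  refine Tri.of_wp ?_
  simp only [Prog.edges, wp_block_cons, wp_const, wp_copy]
  set s₁ := State.setReg _ _ _ with hs₁
  have harr₁ : s₁.arr = s.arr := rfl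
  have hx : s₁.reg rX = s₀.reg rM := by simp [hs₁, hm]
  have hone : s₁.reg rOne = 1 := by simp [hs₁, h1]
  have hhalf : s₁.reg rHalf = 0 := by simp [hs₁]
  have hw : s₁.reg rW = 0 := by simp [hs₁]
  clear_value s₁
  refine Tri.wp (Tri.down (b := 22) (k₀ := s₀.reg rM) (fun k s' =>
    s'.reg rW + k = s₀.reg rM ∧ s'.reg rHalf = 2 * s'.reg rW ∧
    Chained (2 * s'.reg rW) (s'.arr aSrc) (s'.arr aNxt) (s'.arr aHead) ∧
    Paired (s₀.arr aFst) (s₀.arr aSnd) (s'.arr aSrc) (s'.arr aDst) (s'.arr aRev)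
      (s'.reg rW)) ?_ hx ?_) ?_
  · rintro k s₂ hf ⟨a1, a2, a3, a4⟩ a5
    have hone₂ : s₂.reg rOne = 1 := by rw [hf.reg _ rfl, hone]
    refine Tri.of_wp ?_
    simp [Prog.edgeStep, Prog.halfEdge, hone₂, a2, a5, hf.arr aFst rfl, hf.arr aSnd rfl, harr₁,
      hfst, hsnd]
    refine ⟨by omega, by omega, ?_, fun j hj => ?_⟩
    · exact (a3.push _).push _
    · obtain hj | rfl := (Nat.lt_succ_iff.1 hj).lt_or_eq
      · have e1 : 2 * j + 1 ≠ 2 * s₂.reg rW + 1 := by omega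
        have e2 : 2 * j + 1 ≠ 2 * s₂.reg rW + 1 + 1 := by omega
        have e3 : 2 * j + 2 ≠ 2 * s₂.reg rW + 1 := by omega
        have e4 : 2 * j + 2 ≠ 2 * s₂.reg rW + 1 + 1 := by omega
        simp only [Function.update_of_ne e1, Function.update_of_ne e2, Function.update_of_ne e3,
          Function.update_of_ne e4]
        exact a4 j hj
      · simp
  · rw [hw, harr₁, hhalf]
    refine ⟨by omega, rfl, ?_, fun j hj => by omega⟩
    constructor <;> simp [harr]
  · rintro s' t' ⟨a1, a2, a3, a4⟩ hf ht
    rw [wp_block_nil]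
    rw [show s'.reg rW = s₀.reg rM by omega] at a2 a3 a4
    exact ⟨⟨a2, a3, a4⟩, by omega⟩

/-- The list `l 1, …, l cnt` contains the numbers from `k` that have the property `P`, each of them
once. -/
structure Lists (P : ℕ → Prop) (k cnt : ℕ) (l : ℕ → ℕ) : Prop where
  mem : ∀ i, 1 ≤ i → i ≤ cnt → k ≤ l i ∧ P (l i)
  complete : ∀ v, k ≤ v → P v → ∃ i, 1 ≤ i ∧ i ≤ cnt ∧ l i = v
  inj : ∀ i j, 1 ≤ i → i ≤ cnt → 1 ≤ j → j ≤ cnt → l i = l j → i = j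

theorem Lists.push {P : ℕ → Prop} {k cnt : ℕ} {l : ℕ → ℕ} (h : Lists P (k + 1) cnt l)
    (hk : P k) : Lists P k (cnt + 1) (Function.update l (cnt + 1) k) := by
  have hne : ∀ i, 1 ≤ i → i ≤ cnt → l i ≠ k := fun i h1 h2 h3 => by
    have := (h.mem i h1 h2).1
    omega
  constructor
  · intro i h1 h2
    rw [Function.update_apply]
    split_ifs
    · exact ⟨le_rfl, hk⟩
    · obtain ⟨h3, h4⟩ := h.mem i h1 (by omega)
      exact ⟨by omega, h4⟩
  · intro v h1 h2
    obtain rfl | h1 := h1.eq_or_lt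
    · exact ⟨cnt + 1, by omega, le_rfl, by simp⟩
    · obtain ⟨i, h3, h4, h5⟩ := h.complete v h1 h2
      exact ⟨i, h3, by omega, by rw [Function.update_of_ne (by omega), h5]⟩
  · intro i j h1 h2 h3 h4 h5
    rw [Function.update_apply, Function.update_apply] at h5
    split_ifs at h5 with h6 h7 h7
    · omega
    · exact absurd h5.symm (hne j h3 (by omega))
    · exact absurd h5 (hne i h1 (by omega))
    · exact h.inj i j h1 (by omega) h3 (by omega) h5

theorem Lists.skip {P : ℕ → Prop} {k cnt : ℕ} {l : ℕ → ℕ} (h : Lists P (k + 1) cnt l)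
    (hk : ¬ P k) : Lists P k cnt l := by
  refine ⟨fun i h1 h2 => ?_, fun v h1 h2 => ?_, h.inj⟩
  · obtain ⟨h3, h4⟩ := h.mem i h1 h2
    exact ⟨by omega, h4⟩
  · obtain rfl | h1 := h1.eq_or_lt
    · exact absurd h2 hk
    · exact h.complete v h1 h2

theorem tri_lists {s : State} (h1 : s.reg rOne = 1)
    (hhead : ∀ v, s.reg rN ≤ v → s.arr aHead v = 0) :
    Tri Prog.lists s (13 * s.reg rN + 6) fun s' =>
      Lists (fun v => s.arr aHead v ≠ 0) 0 (s'.reg rNV) (s'.arr aVl) ∧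
      Lists (fun v => s.arr aHead v ≠ 0 ∧ s.arr aTerm v ≠ 0) 0 (s'.reg rNT) (s'.arr aTl) := by
  refine Tri.of_wp ?_
  simp only [Prog.lists, wp_block_cons, wp_const, wp_copy]
  set s₁ := State.setReg _ _ _ with hs₁
  have harr₁ : s₁.arr = s.arr := rfl
  have hx : s₁.reg rX = s.reg rN := by simp [hs₁]
  have hone : s₁.reg rOne = 1 := by simp [hs₁, h1]
  have hnv : s₁.reg rNV = 0 := by simp [hs₁]
  have hnt : s₁.reg rNT = 0 := by simp [hs₁]
  clear_value s₁
  refine Tri.wp (Tri.down (b := 12) (k₀ := s.reg rN) (fun k s' =>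
    Lists (fun v => s.arr aHead v ≠ 0) k (s'.reg rNV) (s'.arr aVl) ∧
    Lists (fun v => s.arr aHead v ≠ 0 ∧ s.arr aTerm v ≠ 0) k (s'.reg rNT) (s'.arr aTl)) ?_ hx ?_) ?_
  · rintro k s₂ hf ⟨a1, a2⟩ a3
    have hone₂ : s₂.reg rOne = 1 := by rw [hf.reg _ rfl, hone]
    refine Tri.of_wp ?_
    simp [Prog.listStep, hone₂, a3, hf.arr aHead rfl, hf.arr aTerm rfl, harr₁]
    refine ⟨fun h2 => ⟨fun h3 => ?_, fun h3 => ?_⟩, fun h2 => ?_⟩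
    · exact ⟨a1.push h2, a2.push ⟨h2, h3⟩⟩
    · exact ⟨a1.push h2, a2.skip fun h => h.2 h3⟩
    · exact ⟨a1.skip fun h => h h2, a2.skip fun h => h.1 h2⟩
  · rw [hnv, hnt]
    exact ⟨⟨by omega, fun v h2 h3 => absurd (hhead v h2) h3, by omega⟩,
      ⟨by omega, fun v h2 h3 => absurd (hhead v h2) h3.1, by omega⟩⟩
  · rintro s' t' a1 hf ht
    rw [wp_block_nil]
    exact ⟨a1, by omega⟩

/-! ### Arithmetic of the parameters and the complete program -/

namespace Prog

/-- Adds the number in `x` to `r`. -/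
def bump (r x : ℕ) : Prog := .loop x (block [.add r r rOne, .sub x x rOne])

/-- Adds the number in `a` to `r`, `rV` times. -/
def mulBump (r a : ℕ) : Prog := .loop rV (block [.copy rQ a, bump r rQ, .sub rV rV rOne])

/-- Multiplies the number of guesses by the base. -/
def powerStep : Prog := block [
  .copy rV rGuesses, .const rGuesses 0, mulBump rGuesses rBase, .sub rX rX rOne]

/-- Computes the parameters of the search. -/
def numbers : Prog := block [
  .const rPred 1, .copy rV rC, mulBump rPred rC, .add rBase rPred rOne,
  .const rLen 3, .copy rQ rC, bump rLen rQ, .copy rQ rC, bump rLen rQ, .copy rQ rC, bump rLen rQ,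
  .const rGuesses 1, .copy rX rLen, .loop rX powerStep]

/-- Determines on which side terminals are sought, and how many. -/
def parameters : Prog :=
  .ite rC0 (block [.copy rC rC0, .const rSwap 1]) (block [.copy rC rC1, .const rSwap 0])

/-- Searches for a cut when no vertex makes the problem unsolvable. -/
def answer : Prog := block [
  edges, lists, numbers, main, .ite rSucc (.const rN 1) (.const rN 0)]

/-- Solves the problem if register `rOne` contains `1`. -/
def solveBody : Prog := block [
  .const rTwo 2, parameters, labels, .ite rOkay answer (.const rN 0)]

/-- Solves the problem. -/
def solve : Prog := .seq (.const rOne 1) solveBody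

end Prog

theorem tri_bump {s : State} (h1 : s.reg rOne = 1) {r x : ℕ} (hr : r ≠ rOne) (hx : x ≠ rOne)
    (hrx : r ≠ x) : Tri (Prog.bump r x) s (4 * s.reg x + 1) fun s' =>
      s'.reg r = s.reg r + s.reg x := by
  refine (Tri.down (b := 3) (k₀ := s.reg x) (fun k s' => s'.reg r + k = s.reg r + s.reg x) ?_ rfl
    rfl).mono (by omega) fun s' h _ => h
  intro k s₁ hf h2 h3
  have h4 : s₁.reg rOne = 1 := by
    rw [hf.reg _ (by simp [Prog.block, Prog.writesReg, hr.symm, hx.symm]), h1]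
  refine Tri.of_wp ?_
  simp [h3, h4, hr.symm, hrx, hrx.symm]
  omega

theorem tri_mulBump {s : State} (h1 : s.reg rOne = 1) {r a : ℕ} (hr : r ≠ rOne) (hrV : r ≠ rV)
    (hrQ : r ≠ rQ) (hra : a ≠ r) (haV : a ≠ rV) (haQ : a ≠ rQ) :
    Tri (Prog.mulBump r a) s (s.reg rV * (4 * s.reg a + 5) + 1) fun s' =>
      s'.reg r = s.reg r + s.reg rV * s.reg a := by
  refine (Tri.down (b := 4 * s.reg a + 4) (k₀ := s.reg rV)
    (fun k s' => s'.reg r + k * s.reg a = s.reg r + s.reg rV * s.reg a) ?_ rfl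
    rfl).mono le_rfl fun s' h _ => by simpa using h
  intro k s₁ hf h2 h3
  have h4 : s₁.reg rOne = 1 := by
    rw [hf.reg _ (by simp [Prog.block, Prog.writesReg, Prog.bump, hr.symm]), h1]
  have h5 : s₁.reg a = s.reg a :=
    hf.reg _ (by simp [Prog.block, Prog.writesReg, Prog.bump, hra, haV, haQ])
  refine Tri.of_wp ?_
  simp only [wp_block_cons, wp_copy]
  set s₂ := State.setReg _ _ _ with hs₂
  have b1 : s₂.reg rOne = 1 := by simp [hs₂, h4]
  have b2 : s₂.reg rQ = s.reg a := by simp [hs₂, h5]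
  have b3 : s₂.reg rV = k + 1 := by simp [hs₂, h3]
  have b4 : s₂.reg r = s₁.reg r := by simp [hs₂, hrQ]
  clear_value s₂
  refine (tri_bump b1 hr (x := rQ) (by omega) hrQ).wp ?_
  intro s₃ t₃ h6 hf₃ ht₃
  have c1 : s₃.reg rOne = 1 := by
    rw [hf₃.reg _ (by simp [Prog.block, Prog.writesReg, Prog.bump, hr.symm]), b1]
  have c2 : s₃.reg rV = k + 1 := by
    rw [hf₃.reg _ (by simp [Prog.block, Prog.writesReg, Prog.bump, hrV.symm]), b3]
  rw [b4, b2] at h6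
  rw [b2] at ht₃
  simp [c1, c2, hrV, h6]
  rw [add_mul, one_mul] at h2
  omega

/-- Products are built by adding ones, which costs time linear in the result but keeps every created
number within the initial numbers plus the elapsed time. -/
theorem tri_numbers {s : State} (h1 : s.reg rOne = 1) {c G : ℕ} (hc : s.reg rC = c)
    (hG : G = (c * c + 2) ^ (3 * c + 3)) :
    Tri Prog.numbers s (4 * (c * c) + 17 * c + 20 + (3 * c + 3) * (9 * G + 6)) fun s' =>
      s'.reg rPred = c * c + 1 ∧ s'.reg rBase = c * c + 2 ∧ s'.reg rLen = 3 * c + 3 ∧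
      s'.reg rGuesses = G := by
  refine Tri.of_wp ?_
  simp only [Prog.numbers, wp_block_cons, wp_const, wp_copy]
  set s₁ := State.setReg _ _ _ with hs₁
  have a1 : s₁.reg rOne = 1 := by simp [hs₁, h1]
  have a2 : s₁.reg rC = c := by simp [hs₁, hc]
  have a3 : s₁.reg rV = c := by simp [hs₁, hc]
  have a4 : s₁.reg rPred = 1 := by simp [hs₁]
  clear_value s₁
  refine (tri_mulBump a1 (r := rPred) (a := rC) (by omega) (by omega) (by omega) (by omega)
    (by omega) (by omega)).wp ?_
  rw [a2, a3, a4]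
  intro s₂ t₂ h2 hf₂ ht₂
  simp only [wp_block_cons, wp_const, wp_copy, wp_add]
  set s₃ := State.setReg _ _ _ with hs₃
  have b1 : s₃.reg rOne = 1 := by simp [hs₃, hf₂.reg rOne rfl, a1]
  have b2 : s₃.reg rC = c := by simp [hs₃, hf₂.reg rC rfl, a2]
  have b3 : s₃.reg rQ = c := by simp [hs₃, hf₂.reg rC rfl, a2]
  have b4 : s₃.reg rPred = c * c + 1 := by simp [hs₃, h2, add_comm]
  have b5 : s₃.reg rBase = c * c + 2 := by simp [hs₃, h2, hf₂.reg rOne rfl, a1]; omega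
  have b6 : s₃.reg rLen = 3 := by simp [hs₃]
  clear_value s₃
  refine (tri_bump b1 (r := rLen) (x := rQ) (by omega) (by omega) (by omega)).wp ?_
  rw [b3, b6]
  intro s₄ t₄ h4 hf₄ ht₄
  simp only [wp_block_cons, wp_copy]
  refine (tri_bump (r := rLen) (x := rQ) (by simp [hf₄.reg rOne rfl, b1]) (by omega) (by omega)
    (by omega)).wp ?_
  intro s₅ t₅ h5 hf₅ ht₅
  simp [hf₄.reg rC rfl, b2] at h5 ht₅
  simp only [wp_block_cons, wp_copy]
  refine (tri_bump (r := rLen) (x := rQ) (by simp [hf₅.reg rOne rfl, hf₄.reg rOne rfl, b1])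
    (by omega) (by omega) (by omega)).wp ?_
  intro s₆ t₆ h6 hf₆ ht₆
  simp [hf₅.reg rC rfl, hf₄.reg rC rfl, b2] at h6 ht₆
  simp only [wp_block_cons, wp_const, wp_copy]
  set s₇ := State.setReg _ _ _ with hs₇
  have c1 : s₇.reg rOne = 1 := by
    simp [hs₇, hf₆.reg rOne rfl, hf₅.reg rOne rfl, hf₄.reg rOne rfl, b1]
  have c2 : s₇.reg rX = 3 * c + 3 := by simp [hs₇]; omega
  have c3 : s₇.reg rBase = c * c + 2 := by
    simp [hs₇, hf₆.reg rBase rfl, hf₅.reg rBase rfl, hf₄.reg rBase rfl, b5]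
  have c4 : s₇.reg rPred = c * c + 1 := by
    simp [hs₇, hf₆.reg rPred rfl, hf₅.reg rPred rfl, hf₄.reg rPred rfl, b4]
  have c5 : s₇.reg rLen = 3 * c + 3 := by simp [hs₇]; omega
  have c6 : s₇.reg rGuesses = 1 := by simp [hs₇]
  clear_value s₇
  set B := c * c + 2 with hB
  have hBG : ∀ k, k + 1 ≤ 3 * c + 3 → B ^ (3 * c + 3 - (k + 1)) * B ≤ G := fun k hk => by
    rw [hG, ← pow_succ]
    exact Nat.pow_le_pow_right (by omega) (by omega)
  refine Tri.wp (Tri.down (b := 9 * G + 5) (k₀ := 3 * c + 3) (fun k s' => k ≤ 3 * c + 3 ∧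
    s'.reg rGuesses = B ^ (3 * c + 3 - k)) ?_ c2 ⟨le_rfl, by rw [c6, Nat.sub_self, pow_zero]⟩) ?_
  · rintro k s₈ hf ⟨d0, d1⟩ d2
    have d3 : s₈.reg rOne = 1 := by rw [hf.reg _ rfl, c1]
    have d4 : s₈.reg rBase = B := by rw [hf.reg _ rfl, c3]
    refine Tri.of_wp ?_
    simp only [Prog.powerStep, wp_block_cons, wp_const, wp_copy]
    set s₉ := State.setReg _ _ _ with hs₉
    have e1 : s₉.reg rOne = 1 := by simp [hs₉, d3]
    have e2 : s₉.reg rBase = B := by simp [hs₉, d4]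
    have e3 : s₉.reg rV = B ^ (3 * c + 3 - (k + 1)) := by simp [hs₉, d1]
    have e4 : s₉.reg rGuesses = 0 := by simp [hs₉]
    have e5 : s₉.reg rX = k + 1 := by simp [hs₉, d2]
    clear_value s₉
    refine (tri_mulBump e1 (r := rGuesses) (a := rBase) (by omega) (by omega) (by omega) (by omega)
      (by omega) (by omega)).wp ?_
    rw [e2, e3, e4, zero_add, ← pow_succ, show 3 * c + 3 - (k + 1) + 1 = 3 * c + 3 - k by omega]
    intro s₁₀ t₁₀ h10 hf₁₀ ht₁₀
    simp [hf₁₀.reg rX rfl, hf₁₀.reg rOne rfl, e1, e5, h10]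
    have f1 := hBG k d0
    set X := B ^ (3 * c + 3 - (k + 1))
    have f2 : X * (4 * B + 5) = 4 * (X * B) + 5 * X := by ring
    have f3 : X * 1 ≤ X * B := Nat.mul_le_mul_left _ (by omega)
    omega
  · rintro s₈ t₈ ⟨-, d1⟩ hf ht
    rw [wp_block_nil, hf.reg _ rfl, hf.reg rBase rfl, hf.reg rLen rfl, c3, c4, c5, d1]
    refine ⟨⟨rfl, rfl, rfl, hG.symm⟩, ?_⟩
    have f1 : c * (4 * c + 5) = 4 * (c * c) + 5 * c := by ring
    rw [f1] at ht₂
    have f2 : (3 * c + 3) * (9 * G + 5 + 1) = (3 * c + 3) * (9 * G + 6) := rfl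
    rw [f2] at ht
    omega

/-- The layout represents the input. -/
structure Setup (Λ : Layout) (s₀ : State) : Prop where
  n : Λ.n = s₀.reg rN
  N : Λ.N = 2 * s₀.reg rM
  l : Λ.l = s₀.reg rL
  c : Λ.c = if s₀.reg rC0 = 0 then s₀.reg rC1 else s₀.reg rC0
  swap : Λ.swap = if s₀.reg rC0 = 0 then 0 else 1
  mem_T : ∀ v, v ∈ Λ.T ↔ s₀.arr aTerm v ≠ 0
  lab₀ : ∀ v, Λ.lab₀ v = labelOf Λ.swap (s₀.arr aQ0 v) (s₀.arr aQ1 v)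
  paired : Paired (s₀.arr aFst) (s₀.arr aSnd) Λ.src Λ.dst Λ.rev (s₀.reg rM)

/-- The memory after setup is read back as a mathematical object. Compatibility enters because a
terminal must never be forbidden, and the adjacency heads are nonzero precisely at ends of edges. -/
theorem exists_layout {s s₀ : State} (h₀ : Fresh s₀) {c swap : ℕ}
    (hc : c = if s₀.reg rC0 = 0 then s₀.reg rC1 else s₀.reg rC0)
    (hswap : swap = if s₀.reg rC0 = 0 then 0 else 1) (hl : s₀.reg rL ≤ c)
    (h1 : ∀ v, s.arr aLab0 v = labelOf swap (s₀.arr aQ0 v) (s₀.arr aQ1 v))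
    (h2 : ∀ v, Compatible (s₀.arr aQ0 v) (s₀.arr aQ1 v) (s₀.arr aTerm v))
    (h3 : s.reg rHalf = 2 * s₀.reg rM)
    (h4 : Chained (2 * s₀.reg rM) (s.arr aSrc) (s.arr aNxt) (s.arr aHead))
    (h5 : Paired (s₀.arr aFst) (s₀.arr aSnd) (s.arr aSrc) (s.arr aDst) (s.arr aRev) (s₀.reg rM))
    (h6 : Lists (fun v => s.arr aHead v ≠ 0) 0 (s.reg rNV) (s.arr aVl))
    (h7 : Lists (fun v => s.arr aHead v ≠ 0 ∧ s₀.arr aTerm v ≠ 0) 0 (s.reg rNT) (s.arr aTl))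
    (h8 : s.reg rN = s₀.reg rN ∧ s.reg rL = s₀.reg rL ∧ s.reg rOne = 1 ∧ s.reg rTwo = 2 ∧
      s.reg rC = c ∧ s.reg rSwap = swap ∧ s.arr aTerm = s₀.arr aTerm)
    (h9 : s.reg rPred = c * c + 1 ∧ s.reg rBase = c * c + 2 ∧ s.reg rLen = 3 * c + 3 ∧
      s.reg rGuesses = (c * c + 2) ^ (3 * c + 3)) :
    ∃ Λ : Layout, Λ.In s ∧ Setup Λ s₀ := by
  -- Edge `j` owns the half-edges `2 * j + 1` and `2 * j + 2`; the shift reserves `0` as the end of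
  -- a list.
  have hp : ∀ p ∈ Finset.Icc 1 (2 * s₀.reg rM), ∃ j < s₀.reg rM, p = 2 * j + 1 ∨ p = 2 * j + 2 :=
    fun p hp => ⟨(p - 1) / 2, by simp only [Finset.mem_Icc] at hp; omega,
      by simp only [Finset.mem_Icc] at hp; omega⟩
  let D : Net :=
    { N := 2 * s₀.reg rM
      src := s.arr aSrc
      dst := s.arr aDst
      rev := s.arr aRev
      rev_mem := fun p h => by
        obtain ⟨j, hj, rfl | rfl⟩ := hp p h
        · rw [(h5 j hj).1.2.2, Finset.mem_Icc]
          omega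
        · rw [(h5 j hj).2.2.2, Finset.mem_Icc]
          omega
      rev_ne := fun p h => by
        obtain ⟨j, hj, rfl | rfl⟩ := hp p h
        · rw [(h5 j hj).1.2.2]
          omega
        · rw [(h5 j hj).2.2.2]
          omega
      rev_rev := fun p h => by
        obtain ⟨j, hj, rfl | rfl⟩ := hp p h
        · rw [(h5 j hj).1.2.2, (h5 j hj).2.2.2]
        · rw [(h5 j hj).2.2.2, (h5 j hj).1.2.2]
      src_rev := fun p h => by
        obtain ⟨j, hj, rfl | rfl⟩ := hp p h
        · rw [(h5 j hj).1.2.2, (h5 j hj).2.1, (h5 j hj).1.2.1]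
        · rw [(h5 j hj).2.2.2, (h5 j hj).1.1, (h5 j hj).2.2.1] }
  have hverts : ∀ v, v ∈ D.verts ↔ s.arr aHead v ≠ 0 := fun v => by
    constructor
    · intro h
      obtain ⟨p, hp, rfl⟩ := Finset.mem_image.1 h
      have := h4.le_head p hp
      have := (Finset.mem_Icc.1 hp).1
      change s.arr aHead (s.arr aSrc p) ≠ 0
      omega
    · intro h
      obtain ⟨h10, h11⟩ := h4.head_mem v h
      exact Finset.mem_image.2 ⟨_, h10, h11⟩
  have hT : ∀ v, v ∈ (Finset.range (s₀.reg rN)).filter (fun v => s₀.arr aTerm v ≠ 0) ↔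
      s₀.arr aTerm v ≠ 0 := fun v => by
    simp only [Finset.mem_filter, Finset.mem_range, and_iff_right_iff_imp]
    intro h
    by_contra h'
    exact h (h₀.term v (by omega))
  have hhead : ∀ p ∈ Finset.Icc 1 (2 * s₀.reg rM), s.arr aHead (s.arr aSrc p) ≠ 0 := fun p hp =>
    (hverts _).1 (D.src_mem_verts hp)
  let Λ : Layout :=
    { D with
      T := (Finset.range (s₀.reg rN)).filter (fun v => s₀.arr aTerm v ≠ 0)
      NT := s.reg rNT
      tl := s.arr aTl
      c := c
      l := s₀.reg rL
      base := c * c + 2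
      len := 3 * c + 3
      tl_mem := fun i a b => ⟨(hT _).2 (h7.mem i a b).2.2, (hverts _).2 (h7.mem i a b).2.1⟩
      exists_tl := fun v a b => h7.complete v (Nat.zero_le _) ⟨(hverts v).1 b, (hT v).1 a⟩
      tl_inj := h7.inj
      l_le := hl
      base_eq := rfl
      len_eq := rfl
      n := s₀.reg rN
      NV := s.reg rNV
      swap := swap
      nxt := s.arr aNxt
      head := s.arr aHead
      vl := s.arr aVl
      lab₀ := s.arr aLab0
      T_lt := fun v h => Finset.mem_range.1 (Finset.mem_filter.1 h).1
      nxt_le := h4.nxt_le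
      src_nxt := h4.src_nxt
      le_nxt := h4.le_nxt
      head_mem := fun p h => (h4.head_mem _ (hhead p h)).1
      src_head := fun p h => (h4.head_mem _ (hhead p h)).2
      le_head := h4.le_head
      vl_mem := fun i a b => (hverts _).2 (h6.mem i a b).2
      exists_vl := fun v h => h6.complete v (Nat.zero_le _) ((hverts v).1 h)
      vl_inj := h6.inj
      lab₀_le := fun v => by
        rw [h1, labelOf]
        split_ifs <;> omega
      lab₀_ne := fun v h => by
        obtain ⟨-, a, b⟩ := h2 v
        rw [h1, labelOf]
        have := (hT v).1 h
        split_ifs <;> omega }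
  refine ⟨Λ, ?_, ?_⟩
  · obtain ⟨a1, a2, a3, a4, a5, a6, a7⟩ := h8
    obtain ⟨b1, b2, b3, b4⟩ := h9
    constructor
    any_goals first | assumption | rfl
    intro v
    rw [a7]
    exact (hT v).symm
  · exact ⟨rfl, rfl, rfl, hc, hswap, hT, h1, h5⟩

theorem tri_parameters (s : State) : Tri Prog.parameters s 4 fun s' =>
    s'.reg rC = (if s.reg rC0 = 0 then s.reg rC1 else s.reg rC0) ∧
      s'.reg rSwap = if s.reg rC0 = 0 then 0 else 1 := by
  refine Tri.of_wp ?_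
  simp [Prog.parameters]
  exact ⟨fun h => by simp [h], fun h => by simp [h]⟩

theorem head_eq_zero {s₀ : State} (h₀ : Fresh s₀) {src dst rev nxt head : ℕ → ℕ}
    (h4 : Chained (2 * s₀.reg rM) src nxt head)
    (h5 : Paired (s₀.arr aFst) (s₀.arr aSnd) src dst rev (s₀.reg rM)) {v : ℕ}
    (hv : s₀.reg rN ≤ v) : head v = 0 := by
  by_contra h
  obtain ⟨h1, h2⟩ := h4.head_mem v h
  rw [Finset.mem_Icc] at h1
  obtain ⟨j, hj, h3 | h3⟩ : ∃ j < s₀.reg rM, head v = 2 * j + 1 ∨ head v = 2 * j + 2 :=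
    ⟨(head v - 1) / 2, by omega, by omega⟩
  · rw [h3, (h5 j hj).1.1] at h2
    have := h₀.fst_lt j hj
    omega
  · rw [h3, (h5 j hj).2.1] at h2
    have := h₀.snd_lt j hj
    omega

/-- The result of the search is in memory. -/
def Outcome (Λ : Layout) (s : State) : Prop :=
  (s.reg rN = 1 ∧ ∃ A, Λ.IsSide Λ.lab₀ A ∧ Λ.Describes A (s.arr aFst)) ∨
    s.reg rN = 0 ∧ ¬ ∃ A, Λ.IsSide Λ.lab₀ A

/-- A bound on the time for setting up the data structures. -/
def setupCost (n m c : ℕ) : ℕ :=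
  36 * n + 23 * m + (4 * (c * c) + 17 * c + 60 +
    (3 * c + 3) * (9 * (c * c + 2) ^ (3 * c + 3) + 6))

theorem wp_answer {s s₀ : State} (h₀ : Fresh s₀) {c swap t : ℕ}
    (hc : c = if s₀.reg rC0 = 0 then s₀.reg rC1 else s₀.reg rC0)
    (hswap : swap = if s₀.reg rC0 = 0 then 0 else 1) (hl : s₀.reg rL ≤ c)
    (h1 : ∀ v, s.arr aLab0 v = labelOf swap (s₀.arr aQ0 v) (s₀.arr aQ1 v))
    (h2 : ∀ v, Compatible (s₀.arr aQ0 v) (s₀.arr aQ1 v) (s₀.arr aTerm v))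
    (h3 : s.reg rN = s₀.reg rN ∧ s.reg rM = s₀.reg rM ∧ s.reg rL = s₀.reg rL ∧ s.reg rOne = 1 ∧
      s.reg rTwo = 2 ∧ s.reg rC = c ∧ s.reg rSwap = swap ∧ s.reg rSucc = 0)
    (h4 : s.arr aTerm = s₀.arr aTerm ∧ s.arr aFst = s₀.arr aFst ∧ s.arr aSnd = s₀.arr aSnd ∧
      ∀ v, s.arr aHead v = 0)
    (h5 : s.arr aLab = s.arr aLab0) (h6 : ∀ v, s.arr aVis v = s.arr aLab0 v - 1)
    (ht : t ≤ 23 * s₀.reg rN + 12) :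
    wp Prog.answer (fun s' t => ∃ Λ, Setup Λ s₀ ∧ Outcome Λ s' ∧
      t ≤ setupCost (s₀.reg rN) (s₀.reg rM) c + Λ.mainCost) s t := by
  obtain ⟨a1, a2, a3, a4, a5, a6, a7, a8⟩ := h3
  obtain ⟨b1, b2, b3, b4⟩ := h4
  rw [Prog.answer, wp_block_cons]
  refine (tri_edges a4 a2 b2 b3 b4).wp ?_
  rintro s₁ t₁ ⟨c1, c2, c3⟩ hf₁ ht₁
  rw [wp_block_cons]
  have d1 : s₁.reg rN = s₀.reg rN := by rw [hf₁.reg _ rfl, a1]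
  refine (tri_lists (by rw [hf₁.reg _ rfl, a4]) fun v hv => head_eq_zero h₀ c2 c3 (d1 ▸ hv)).wp ?_
  rintro s₂ t₂ ⟨e1, e2⟩ hf₂ ht₂
  rw [wp_block_cons]
  refine (tri_numbers (by rw [hf₂.reg _ rfl, hf₁.reg _ rfl, a4])
    (by rw [hf₂.reg _ rfl, hf₁.reg _ rfl, a6]) rfl).wp ?_
  rintro s₃ t₃ e3 hf₃ ht₃
  rw [hf₁.arr aTerm rfl, b1] at e2
  have hreg : ∀ r, Prog.edges.writesReg r = false → Prog.lists.writesReg r = false →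
      Prog.numbers.writesReg r = false → s₃.reg r = s.reg r := fun r x y z => by
    rw [hf₃.reg r z, hf₂.reg r y, hf₁.reg r x]
  have harr : ∀ A, Prog.edges.writesArr A = false → Prog.lists.writesArr A = false →
      Prog.numbers.writesArr A = false → s₃.arr A = s.arr A := fun r x y z => by
    rw [hf₃.arr r z, hf₂.arr r y, hf₁.arr r x]
  have harr' : ∀ A, Prog.lists.writesArr A = false →
      Prog.numbers.writesArr A = false → s₃.arr A = s₁.arr A := fun r y z => by
    rw [hf₃.arr r z, hf₂.arr r y]
  obtain ⟨Λ, hΛ, hS⟩ := exists_layout (s := s₃) h₀ hc hswap hl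
    (by rw [harr _ rfl rfl rfl]; exact h1) h2
    (by rw [hf₃.reg _ rfl, hf₂.reg _ rfl, c1])
    (by rw [harr' _ rfl rfl, harr' _ rfl rfl, harr' _ rfl rfl]; exact c2)
    (by rw [harr' _ rfl rfl, harr' _ rfl rfl, harr' _ rfl rfl]; exact c3)
    (by rw [harr' _ rfl rfl, hf₃.reg _ rfl, hf₃.arr _ rfl]; exact e1)
    (by rw [harr' _ rfl rfl, hf₃.reg _ rfl, hf₃.arr _ rfl]; exact e2)
    ⟨by rw [hreg _ rfl rfl rfl, a1], by rw [hreg _ rfl rfl rfl, a3],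
      by rw [hreg _ rfl rfl rfl, a4], by rw [hreg _ rfl rfl rfl, a5],
      by rw [hreg _ rfl rfl rfl, a6], by rw [hreg _ rfl rfl rfl, a7],
      by rw [harr _ rfl rfl rfl, b1]⟩ e3
  have hlab₃ : s₃.arr aLab = Λ.lab₀ := by
    rw [← hΛ.lab₀, harr _ rfl rfl rfl, harr _ rfl rfl rfl, h5]
  have hvis₃ : Λ.IsVis (s₃.arr aVis) := fun v _ => by
    have := Λ.lab₀_le v
    rw [harr _ rfl rfl rfl, h6, ← harr aLab0 rfl rfl rfl, hΛ.lab₀]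
    split_ifs <;> omega
  rw [wp_block_cons]
  refine (Layout.tri_main hΛ (hlab₃ ▸ Layout.extends_lab₀.isLab) hvis₃
    (by rw [hreg _ rfl rfl rfl, a8])).wp ?_
  rintro s₄ t₄ ⟨f1, f2⟩ hf₄ ht₄
  have hcost : t₄ + 4 ≤ setupCost (s₀.reg rN) (s₀.reg rM) c + Λ.mainCost := by
    unfold setupCost
    rw [d1] at ht₂
    omega
  simp only [wp_block_cons, wp_block_nil, wp_ite, wp_const]
  refine ⟨fun h => ⟨Λ, hS, Or.inl ⟨by simp, by simpa using f1 h⟩, by omega⟩,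
    fun h => ⟨Λ, hS, Or.inr ⟨by simp, f2 h⟩, by omega⟩⟩

theorem wp_solveBody {s₀ : State} (h₀ : Fresh s₀)
    (hl : s₀.reg rL ≤ if s₀.reg rC0 = 0 then s₀.reg rC1 else s₀.reg rC0) :
    wp Prog.solveBody (fun s' t =>
      ((¬ ∀ v, Compatible (s₀.arr aQ0 v) (s₀.arr aQ1 v) (s₀.arr aTerm v)) ∧ s'.reg rN = 0 ∧
        t ≤ 23 * s₀.reg rN + 14) ∨
      (∀ v, Compatible (s₀.arr aQ0 v) (s₀.arr aQ1 v) (s₀.arr aTerm v)) ∧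
        ∃ Λ, Setup Λ s₀ ∧ Outcome Λ s' ∧ t ≤ setupCost (s₀.reg rN) (s₀.reg rM)
          (if s₀.reg rC0 = 0 then s₀.reg rC1 else s₀.reg rC0) + Λ.mainCost + 1)
      (s₀.setReg rOne 1) 0 := by
  simp only [Prog.solveBody, wp_block_cons, wp_const]
  set s₁ := State.setReg _ _ _ with hs₁
  have harr₁ : s₁.arr = s₀.arr := rfl
  have hreg₁ : ∀ r, r ≠ rOne → r ≠ rTwo → s₁.reg r = s₀.reg r := fun r h h' => by simp [hs₁, h, h']
  have hone₁ : s₁.reg rOne = 1 := by simp [hs₁]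
  have htwo₁ : s₁.reg rTwo = 2 := by simp [hs₁]
  clear_value s₁
  refine (tri_parameters s₁).wp ?_
  rw [hreg₁ rC0 (by omega) (by omega), hreg₁ rC1 (by omega) (by omega)]
  rintro s₂ t₂ ⟨a1, a2⟩ hf₂ ht₂
  have harr₂ : s₂.arr = s₀.arr := funext fun A => by rw [hf₂.arr A rfl, harr₁]
  rw [wp_block_cons]
  refine (tri_labels h₀ (by rw [hf₂.reg _ rfl, hone₁])
    (by rw [hf₂.reg _ rfl, hreg₁ _ (by omega) (by omega)]) harr₂).wp ?_
  rintro s₃ t₃ ⟨b1, b2, b3, b4⟩ hf₃ ht₃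
  have hreg₃ : ∀ r, r ≠ rOne → r ≠ rTwo → Prog.parameters.writesReg r = false →
      Prog.labels.writesReg r = false → s₃.reg r = s₀.reg r := fun r x y z w => by
    rw [hf₃.reg r w, hf₂.reg r z, hreg₁ r x y]
  have harr₃ : ∀ A, Prog.labels.writesArr A = false → s₃.arr A = s₀.arr A := fun A x => by
    rw [hf₃.arr A x, harr₂]
  rw [a2] at b1
  simp only [wp_block_cons, wp_ite, wp_const, wp_block_nil]
  refine ⟨fun h => ?_, fun h => Or.inl ⟨fun h' => b4.2 h' h, by simp, by omega⟩⟩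
  obtain ⟨s₄, t₄, h1, Λ, h2, h3, h4⟩ := wp_answer (t := t₃ + 1) h₀ rfl rfl hl b1 (b4.1 h)
    ⟨hreg₃ _ (by omega) (by omega) rfl rfl, hreg₃ _ (by omega) (by omega) rfl rfl,
      hreg₃ _ (by omega) (by omega) rfl rfl, by rw [hf₃.reg _ rfl, hf₂.reg _ rfl, hone₁],
      by rw [hf₃.reg _ rfl, hf₂.reg _ rfl, htwo₁], by rw [hf₃.reg _ rfl, a1],
      by rw [hf₃.reg _ rfl, a2],
      by rw [hreg₃ _ (by omega) (by omega) rfl rfl, h₀.reg _ (by omega)]⟩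
    ⟨harr₃ _ rfl, harr₃ _ rfl, harr₃ _ rfl,
      fun v => by rw [harr₃ _ rfl, h₀.arr _ (by omega)]⟩ b2 b3 (by omega)
  refine ⟨s₄, t₄, h1, ?_⟩
  rw [wp_block_nil]
  exact Or.inr ⟨b4.1 h, Λ, h2, h3, by omega⟩

/-- The condition is syntactic and decided by evaluation. The instruction that puts `1` into
register `5` is left out, since it violates the condition itself. -/
theorem increments_solveBody : Prog.solveBody.increments = true := by
  decide

/-! ### The running time -/

namespace Layout

variable (Λ : Layout)

/-- A bound on the running time in terms of the number of guesses. -/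
theorem cost_le {m u : ℕ} (hN : Λ.N = 2 * m) (hu : Λ.NT * (m + 1) ≤ u) (hu' : Λ.n + m + 1 ≤ u) :
    setupCost Λ.n m Λ.c + Λ.mainCost + 2 ≤ 1000 * (Λ.guesses ^ 5 * u) := by
  have hbase := Λ.base_eq
  have hlen := Λ.len_eq
  have hl := Λ.l_le
  have hguess : Λ.guesses = (Λ.c * Λ.c + 2) ^ (3 * Λ.c + 3) := by rw [Inst.guesses, hbase, hlen]
  -- All factors that depend on `c` alone are absorbed into powers of the number of guesses `g`: two
  -- for an enumeration, a third for the loop over its guesses, a fourth for the levels and a fifth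
  -- for the outer guesses.
  have h1 : Λ.len + 1 ≤ Λ.guesses := by
    rw [hguess, ← hlen]
    exact Nat.lt_pow_self (by omega)
  have h2 : Λ.base + 3 ≤ Λ.guesses := by
    have h3 : (Λ.c * Λ.c + 2) ^ 3 ≤ Λ.guesses := by
      rw [hguess]
      exact Nat.pow_le_pow_right (by omega) (by omega)
    have h4 : 2 * 2 * (Λ.c * Λ.c + 2) ≤ (Λ.c * Λ.c + 2) ^ 3 := by
      rw [pow_succ, sq]
      exact Nat.mul_le_mul_right _ (Nat.mul_le_mul (by omega) (by omega))
    omega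
  set g := Λ.guesses with hg
  have hg1 : 1 ≤ g := by omega
  have hpow : ∀ a b x : ℕ, a ≤ b → g ^ a * x ≤ g ^ b * x := fun a b x h =>
    Nat.mul_le_mul_right _ (Nat.pow_le_pow_right hg1 h)
  have hone : ∀ b x : ℕ, x ≤ g ^ b * x := fun b x => Nat.le_mul_of_pos_left x (Nat.pow_pos hg1)
  have hext : Λ.extCost ≤ 248 * (g ^ 2 * (m + 1)) := by
    calc Λ.extCost ≤ g * (g * (160 * (m + 1)) + 32 * (m + 1) + 6 * g + 50) := by
          unfold extCost
          rw [hN]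
          exact Nat.mul_le_mul h1 (Nat.add_le_add (Nat.add_le_add (Nat.add_le_add
            (Nat.mul_le_mul h2 (by omega)) (by omega)) le_rfl) le_rfl)
      _ = 160 * (g ^ 2 * (m + 1)) + 32 * (g ^ 1 * (m + 1)) + 6 * (g ^ 2 * 1) +
          50 * (g ^ 1 * 1) := by
          ring
      _ ≤ _ := by
          have a1 := hpow 1 2 (m + 1) (by omega)
          have a2 : g ^ 2 * 1 ≤ g ^ 2 * (m + 1) := Nat.mul_le_mul_left _ (by omega)
          have a3 := hpow 1 2 1 (by omega)
          omega
  have hcands : Λ.candsCost ≤ 437 * (g ^ 3 * u) := by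
    have a1 : g * (Λ.extCost + 36 * Λ.N + 41) + 6 ≤ 367 * (g ^ 3 * (m + 1)) := by
      have b1 := hone 2 (m + 1)
      have b2 := hone 3 (m + 1)
      have b3 : g * (Λ.extCost + 36 * Λ.N + 41) ≤ g * (361 * (g ^ 2 * (m + 1))) :=
        Nat.mul_le_mul_left _ (by omega)
      have b4 : g * (361 * (g ^ 2 * (m + 1))) = 361 * (g ^ 3 * (m + 1)) := by ring
      omega
    have a2 : Λ.NT * (g * (Λ.extCost + 36 * Λ.N + 41) + 6) ≤ 367 * (g ^ 3 * u) := by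
      refine (Nat.mul_le_mul_left _ a1).trans ?_
      calc Λ.NT * (367 * (g ^ 3 * (m + 1))) = 367 * (g ^ 3 * (Λ.NT * (m + 1))) := by ring
        _ ≤ _ := by gcongr
    have a3 := hone 3 u
    unfold candsCost
    rw [← hg]
    omega
  have hlevel : Λ.levelCost ≤ 690 * (g ^ 3 * u) := by
    have a1 : (Λ.l + 3) * (80 * Λ.N + 70) ≤ g * (160 * u) := Nat.mul_le_mul (by omega) (by omega)
    have a2 : g * (160 * u) = 160 * (g ^ 1 * u) := by ring
    have a3 := hpow 1 3 u (by omega)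
    have a4 := hone 3 u
    have a5 : g ≤ g ^ 1 * u := by
      rw [pow_one]
      exact Nat.le_mul_of_pos_right g (by omega)
    unfold levelCost
    rw [← hg]
    omega
  have hguessCost : Λ.guessCost ≤ 715 * (g ^ 4 * u) := by
    have a1 := hone 3 u
    have a2 : (Λ.c + 1) * (Λ.levelCost + 1) ≤ g * (691 * (g ^ 3 * u)) :=
      Nat.mul_le_mul (by omega) (by omega)
    have a3 : g * (691 * (g ^ 3 * u)) = 691 * (g ^ 4 * u) := by ring
    have a4 := hone 4 u
    unfold guessCost
    omega
  have hmain : Λ.mainCost ≤ 719 * (g ^ 5 * u) := by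
    have a1 := hone 4 u
    have a2 : g * (Λ.guessCost + 1) ≤ g * (716 * (g ^ 4 * u)) :=
      Nat.mul_le_mul_left _ (by omega)
    have a3 : g * (716 * (g ^ 4 * u)) = 716 * (g ^ 5 * u) := by ring
    have a4 := hone 5 u
    unfold mainCost
    rw [← hg]
    omega
  have hsetup : setupCost Λ.n m Λ.c ≤ 132 * (g ^ 5 * u) := by
    have a1 : (3 * Λ.c + 3) * (9 * g + 6) ≤ g * (9 * g + 6) := Nat.mul_le_mul_right _ (by omega)
    have a2 : g * (9 * g + 6) = 9 * (g ^ 2 * 1) + 6 * (g ^ 1 * 1) := by ring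
    have a3 := hpow 2 5 1 (by omega)
    have a4 := hpow 1 5 1 (by omega)
    have a5 := hone 5 u
    have a6 : g ^ 5 * 1 ≤ g ^ 5 * u := Nat.mul_le_mul_left _ (by omega)
    have a7 := pow_one g
    unfold setupCost
    rw [← hguess]
    omega
  have a5 := hone 5 u
  omega

/-- The base is at most `(c + 2) ^ 2`, so its logarithm is at most `2 * (c + 1)`; multiplied by the
`3 * c + 3` digits this is quadratic in `c`. -/
theorem guesses_le : Λ.guesses ≤ 2 ^ (12 * Λ.c ^ 2 + 12) := by
  have h1 : Λ.c + 2 ≤ 2 ^ (Λ.c + 1) := Nat.lt_pow_self (by omega)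
  have h2 : Λ.base ≤ (2 ^ (Λ.c + 1)) ^ 2 := by
    rw [Λ.base_eq]
    refine le_trans ?_ (Nat.pow_le_pow_left h1 2)
    have : (Λ.c + 2) ^ 2 = Λ.c * Λ.c + 4 * Λ.c + 4 := by ring
    omega
  rw [Inst.guesses, Λ.len_eq]
  refine (Nat.pow_le_pow_left h2 _).trans ?_
  rw [← pow_mul, ← pow_mul]
  refine Nat.pow_le_pow_right (by omega) ?_
  have h3 : (Λ.c + 1) * (2 * (3 * Λ.c + 3)) = 6 * Λ.c ^ 2 + 12 * Λ.c + 6 := by ring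
  have h4 : 2 * Λ.c ≤ Λ.c ^ 2 + 1 := by
    zify
    nlinarith [sq_nonneg ((Λ.c : ℤ) - 1)]
  omega

end Layout

/-! ### From memory to graphs -/

namespace TerminalGraph

variable {n m : ℕ} (G : TerminalGraph n m)

theorem card_le_of_noIsolated (h : G.NoIsolated) : n ≤ 2 * m := by
  classical
  have h1 : (Finset.univ : Finset (Fin n)) ⊆
      Finset.univ.image G.fst ∪ Finset.univ.image G.snd := fun v _ => by
    obtain ⟨e, he | he⟩ := h v
    · exact Finset.mem_union_left _ (Finset.mem_image.2 ⟨e, Finset.mem_univ _, he⟩)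
    · exact Finset.mem_union_right _ (Finset.mem_image.2 ⟨e, Finset.mem_univ _, he⟩)
  have h2 := (Finset.card_le_card h1).trans (Finset.card_union_le _ _)
  have h3 := (Finset.univ : Finset (Fin m)).card_image_le (f := G.fst)
  have h4 := (Finset.univ : Finset (Fin m)).card_image_le (f := G.snd)
  simp only [Finset.card_univ, Fintype.card_fin] at h2 h3 h4
  omega

end TerminalGraph

theorem tabulate_of_lt {N : ℕ} {f : Fin N → ℕ} {i : ℕ} (h : i < N) : tabulate f i = f ⟨i, h⟩ :=
  dif_pos h

theorem tabulate_fin {N : ℕ} {f : Fin N → ℕ} (i : Fin N) : tabulate f i = f i :=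
  dif_pos i.2

theorem tabulate_of_le {N : ℕ} {f : Fin N → ℕ} {i : ℕ} (h : N ≤ i) : tabulate f i = 0 :=
  dif_neg (by omega)

theorem tabulate_le {N b : ℕ} {f : Fin N → ℕ} (h : ∀ i, f i ≤ b) (i : ℕ) : tabulate f i ≤ b := by
  unfold tabulate
  split_ifs
  · exact h _
  · exact Nat.zero_le _

section Input

variable {n m : ℕ} (G : TerminalGraph n m) (Q₀ Q₁ : Finset (Fin n)) (c₀ c₁ ℓ : ℕ)

theorem fresh_inputState : Fresh (inputState G Q₀ Q₁ c₀ c₁ ℓ) where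
  reg r hr := by
    obtain ⟨r, rfl⟩ := Nat.exists_eq_add_of_le' hr
    rfl
  arr A hA i := by
    obtain ⟨A, rfl⟩ := Nat.exists_eq_add_of_le' hA
    rfl
  fst_lt e he := by
    simp only [inputState] at he ⊢
    rw [tabulate_of_lt he]
    exact (G.fst _).2
  snd_lt e he := by
    simp only [inputState] at he ⊢
    rw [tabulate_of_lt he]
    exact (G.snd _).2
  term v hv := by
    simp only [inputState] at hv ⊢
    exact tabulate_of_le hv
  q0 v hv := by
    simp only [inputState] at hv ⊢
    exact tabulate_of_le hv
  q1 v hv := by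
    simp only [inputState] at hv ⊢
    exact tabulate_of_le hv

theorem bounded_inputState {c : ℕ} (h₀ : c₀ ≤ c) (h₁ : c₁ ≤ c) (hℓ : ℓ ≤ c) :
    ((inputState G Q₀ Q₁ c₀ c₁ ℓ).setReg 5 1).Bounded (n + m + c + 3) := by
  refine State.Bounded.setReg (N := n + m + c + 3) ⟨fun r => ?_, fun A i => ?_⟩ le_rfl (by omega) 5
  · match r with
    | 0 | 1 | 2 | 3 | 4 => simp only [inputState]; omega
    | r + 5 => exact Nat.zero_le _
  · match A with
    | 0 =>
      simp only [inputState]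
      exact tabulate_le (fun e => by have := (G.fst e).2; omega) i
    | 1 =>
      simp only [inputState]
      exact tabulate_le (fun e => by have := (G.snd e).2; omega) i
    | 2 | 3 | 4 =>
      simp only [inputState]
      exact tabulate_le (fun v => by split_ifs <;> omega) i
    | A + 5 => exact Nat.zero_le _

variable {G Q₀ Q₁ c₀ c₁ ℓ}

theorem compatible_iff : (∀ v, Compatible ((inputState G Q₀ Q₁ c₀ c₁ ℓ).arr aQ0 v)
    ((inputState G Q₀ Q₁ c₀ c₁ ℓ).arr aQ1 v) ((inputState G Q₀ Q₁ c₀ c₁ ℓ).arr aTerm v)) ↔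
    ∀ v : Fin n, (v ∉ Q₀ ∨ v ∉ Q₁) ∧ (v ∉ Q₀ ∨ v ∉ G.T) ∧ (v ∉ Q₁ ∨ v ∉ G.T) := by
  constructor
  · intro h v
    have := h v
    simpa only [Compatible, inputState, tabulate_fin, ite_eq_right_iff, one_ne_zero,
      imp_false] using this
  · intro h v
    by_cases hv : v < n
    · have := h ⟨v, hv⟩
      simpa only [Compatible, inputState, tabulate_of_lt hv, ite_eq_right_iff, one_ne_zero,
        imp_false] using this
    · simp [Compatible, inputState, tabulate_of_le (not_lt.1 hv)]

theorem not_isValidCut (h : ¬ ∀ v : Fin n, (v ∉ Q₀ ∨ v ∉ Q₁) ∧ (v ∉ Q₀ ∨ v ∉ G.T) ∧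
    (v ∉ Q₁ ∨ v ∉ G.T)) : ¬ ∃ A₀ A₁ : Finset (Fin n), G.IsValidCut Q₀ Q₁ c₀ c₁ ℓ A₀ A₁ := by
  rintro ⟨A₀, A₁, hA⟩
  refine h fun v => ⟨?_, ?_, ?_⟩
  · by_contra! h'
    exact Finset.disjoint_left.1 hA.disjoint (Finset.mem_sdiff.1 (hA.left_subset h'.1)).1
      (Finset.mem_sdiff.1 (hA.right_subset h'.2)).1
  · by_contra! h'
    exact (Finset.mem_sdiff.1 (hA.left_subset h'.1)).2 h'.2
  · by_contra! h'
    exact (Finset.mem_sdiff.1 (hA.right_subset h'.1)).2 h'.2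

theorem sum_Icc_two_mul (f : ℕ → ℕ) (m : ℕ) : ∑ p ∈ Finset.Icc 1 (2 * m), f p =
    ∑ j ∈ Finset.range m, (f (2 * j + 1) + f (2 * j + 2)) := by
  induction m with
  | zero => rfl
  | succ m ih =>
    rw [Finset.sum_range_succ, ← ih, show 2 * (m + 1) = 2 * m + 1 + 1 by ring,
      Finset.sum_Icc_succ_top (by omega), Finset.sum_Icc_succ_top (by omega), add_assoc]

/-- Of the two half-edges of an edge, exactly one leaves `A` if the edge crosses and none otherwise.
Loops contribute to neither count. -/
theorem cut_eq {Λ : Layout} (hΛ : Setup Λ (inputState G Q₀ Q₁ c₀ c₁ ℓ)) {A : Set ℕ}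
    {X : Finset (Fin n)} (hX : ∀ v : Fin n, v ∈ X ↔ (v : ℕ) ∈ A) :
    Λ.cut A = (G.edgesBetween X Xᶜ).card := by
  classical
  rw [Net.cut, Net.flux, hΛ.N, sum_Icc_two_mul, TerminalGraph.edgesBetween, Finset.card_filter]
  change ∑ j ∈ Finset.range m, _ = _
  rw [Finset.sum_range]
  refine Finset.sum_congr rfl fun e _ => ?_
  obtain ⟨⟨a1, a2, -⟩, a3, a4, -⟩ := hΛ.paired e e.2
  have b1 : (inputState G Q₀ Q₁ c₀ c₁ ℓ).arr aFst e = G.fst e := by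
    simp only [inputState, tabulate_fin]
  have b2 : (inputState G Q₀ Q₁ c₀ c₁ ℓ).arr aSnd e = G.snd e := by
    simp only [inputState, tabulate_fin]
  rw [a1, a2, a3, a4, b1, b2]
  simp only [Set.mem_compl_iff, ← hX, Finset.mem_compl, Pi.one_apply]
  by_cases c1 : G.fst e ∈ X <;> by_cases c2 : G.snd e ∈ X <;> simp [c1, c2]

end Input

namespace TerminalGraph

variable {n m : ℕ} {G : TerminalGraph n m}

theorem edgesBetween_comm (A B : Finset (Fin n)) : G.edgesBetween A B = G.edgesBetween B A := by
  simp only [edgesBetween, or_comm]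

theorem IsValidCut.eq_compl {Q₀ Q₁ : Finset (Fin n)} {c₀ c₁ ℓ : ℕ} {A₀ A₁ : Finset (Fin n)}
    (h : G.IsValidCut Q₀ Q₁ c₀ c₁ ℓ A₀ A₁) : A₁ = A₀ᶜ :=
  (IsCompl.of_eq h.disjoint.eq_bot h.cover).symm.eq_compl

theorem isValidCut_compl_iff {Q₀ Q₁ : Finset (Fin n)} {c₀ c₁ ℓ : ℕ} {A : Finset (Fin n)}
    (h : ∀ v : Fin n, (v ∉ Q₀ ∨ v ∉ Q₁) ∧ (v ∉ Q₀ ∨ v ∉ G.T) ∧ (v ∉ Q₁ ∨ v ∉ G.T)) :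
    G.IsValidCut Q₀ Q₁ c₀ c₁ ℓ A Aᶜ ↔ (∀ v, (v ∈ Q₀ → v ∈ A) ∧ (v ∈ Q₁ → v ∉ A)) ∧
      c₀ ≤ (A ∩ G.T).card ∧ c₁ ≤ (Aᶜ ∩ G.T).card ∧ (G.edgesBetween A Aᶜ).card ≤ ℓ := by
  constructor
  · intro hA
    refine ⟨fun v => ⟨fun hv => ?_, fun hv => ?_⟩, hA.left_card, hA.right_card, hA.size_le⟩
    · exact (Finset.mem_sdiff.1 (hA.left_subset hv)).1
    · exact Finset.mem_compl.1 (Finset.mem_sdiff.1 (hA.right_subset hv)).1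
  · rintro ⟨h1, h2, h3, h4⟩
    refine ⟨disjoint_compl_right, Finset.union_compl A, fun v hv => ?_, fun v hv => ?_, h2, h3, h4⟩
    · exact Finset.mem_sdiff.2 ⟨(h1 v).1 hv, (h v).2.1.resolve_left fun h' => h' hv⟩
    · exact Finset.mem_sdiff.2 ⟨Finset.mem_compl.2 ((h1 v).2 hv),
        (h v).2.2.resolve_left fun h' => h' hv⟩

end TerminalGraph

/-! ### Sides of the network and valid constrained cuts -/

section Input

variable {n m : ℕ} {G : TerminalGraph n m} {Q₀ Q₁ : Finset (Fin n)} {c₀ c₁ ℓ : ℕ} {Λ : Layout}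

theorem mem_T_iff (hΛ : Setup Λ (inputState G Q₀ Q₁ c₀ c₁ ℓ)) (v : Fin n) :
    (v : ℕ) ∈ Λ.T ↔ v ∈ G.T := by
  rw [hΛ.mem_T]
  simp [inputState, tabulate_fin]

theorem lt_of_mem_T (hΛ : Setup Λ (inputState G Q₀ Q₁ c₀ c₁ ℓ)) {v : ℕ} (hv : v ∈ Λ.T) : v < n := by
  have := Λ.T_lt v hv
  rwa [hΛ.n] at this

theorem tcount_eq (hΛ : Setup Λ (inputState G Q₀ Q₁ c₀ c₁ ℓ)) {A : Set ℕ} {X : Finset (Fin n)}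
    (hX : ∀ v : Fin n, v ∈ X ↔ (v : ℕ) ∈ A) : Λ.tcount A = (X ∩ G.T).card := by
  classical
  rw [Inst.tcount, ← Finset.card_map Fin.valEmbedding]
  congr 1
  ext v
  simp only [Finset.mem_filter, Finset.mem_map, Finset.mem_inter, Fin.valEmbedding_apply]
  constructor
  · rintro ⟨h1, h2⟩
    have hv := lt_of_mem_T hΛ h1
    exact ⟨⟨v, hv⟩, ⟨(hX _).2 h2, (mem_T_iff hΛ ⟨v, hv⟩).1 h1⟩, rfl⟩
  · rintro ⟨w, ⟨h1, h2⟩, rfl⟩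
    exact ⟨(mem_T_iff hΛ w).2 h2, (hX w).1 h1⟩

theorem NT_le_card (hΛ : Setup Λ (inputState G Q₀ Q₁ c₀ c₁ ℓ)) : Λ.NT ≤ G.T.card := by
  have h1 : (Finset.Icc 1 Λ.NT).card ≤ Λ.T.card := by
    refine Finset.card_le_card_of_injOn Λ.tl ?_ ?_
    · intro i hi
      simp only [Finset.coe_Icc, Set.mem_Icc] at hi
      exact (Λ.tl_mem i hi.1 hi.2).1
    · intro i hi j hj h
      simp only [Finset.coe_Icc, Set.mem_Icc] at hi hj
      exact Λ.tl_inj i j hi.1 hi.2 hj.1 hj.2 h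
  have h2 : Λ.T ⊆ G.T.map Fin.valEmbedding := fun v hv =>
    Finset.mem_map.2 ⟨⟨v, lt_of_mem_T hΛ hv⟩, (mem_T_iff hΛ ⟨v, lt_of_mem_T hΛ hv⟩).1 hv, rfl⟩
  have h3 := Finset.card_le_card h2
  rw [Finset.card_map] at h3
  simp only [Nat.card_Icc, Nat.add_sub_cancel] at h1
  exact h1.trans h3

theorem sep_lab₀_iff (hΛ : Setup Λ (inputState G Q₀ Q₁ c₀ c₁ ℓ)) {A : Set ℕ} {X : Finset (Fin n)}
    (hX : ∀ v : Fin n, v ∈ X ↔ (v : ℕ) ∈ A) (h : ∀ v : Fin n, v ∉ Q₀ ∨ v ∉ Q₁) :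
    Sep Λ.lab₀ A ↔ ∀ v, (v ∈ Q₀ → if Λ.swap = 0 then v ∉ X else v ∈ X) ∧
      (v ∈ Q₁ → if Λ.swap = 0 then v ∈ X else v ∉ X) := by
  have h1 : ∀ v : Fin n, Λ.lab₀ v =
      labelOf Λ.swap (if v ∈ Q₀ then 1 else 0) (if v ∈ Q₁ then 1 else 0) := fun v => by
    rw [hΛ.lab₀]
    simp only [inputState, tabulate_fin]
  constructor
  · intro hA v
    have h2 := hA v
    rw [h1, ← hX] at h2
    have h3 := h v
    by_cases a : v ∈ Q₀ <;> by_cases b : v ∈ Q₁ <;> by_cases c : Λ.swap = 0 <;>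
      simp_all [labelOf]
  · intro hA v
    by_cases hv : v < n
    · have h2 := h1 ⟨v, hv⟩
      have h3 := h ⟨v, hv⟩
      have h4 := hA ⟨v, hv⟩
      have h5 := hX ⟨v, hv⟩
      simp only at h2 h5
      rw [h2, ← h5]
      by_cases a : (⟨v, hv⟩ : Fin n) ∈ Q₀ <;> by_cases b : (⟨v, hv⟩ : Fin n) ∈ Q₁ <;>
        by_cases c : Λ.swap = 0 <;> simp_all [labelOf]
    · rw [hΛ.lab₀]
      simp [inputState, tabulate_of_le (not_lt.1 hv), labelOf]

/-- The sought side is `A₁` when `swap` is `0`, so `A₀` is then its complement, and it is `A₀`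
itself otherwise. The other side carries the demand `0`, which is void. -/
theorem isSide_iff (hΛ : Setup Λ (inputState G Q₀ Q₁ c₀ c₁ ℓ)) {A : Set ℕ} {X : Finset (Fin n)}
    (hX : ∀ v : Fin n, v ∈ X ↔ (v : ℕ) ∈ A) (hc : c₀ = 0 ∨ c₁ = 0)
    (h : ∀ v : Fin n, (v ∉ Q₀ ∨ v ∉ Q₁) ∧ (v ∉ Q₀ ∨ v ∉ G.T) ∧ (v ∉ Q₁ ∨ v ∉ G.T)) :
    Λ.IsSide Λ.lab₀ A ↔ G.IsValidCut Q₀ Q₁ c₀ c₁ ℓ (if Λ.swap = 0 then Xᶜ else X)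
      (if Λ.swap = 0 then Xᶜ else X)ᶜ := by
  have h1 := hΛ.c
  have h2 := hΛ.swap
  have h3 : Λ.l = ℓ := hΛ.l
  simp only [inputState] at h1 h2
  have h4 : Λ.IsSide Λ.lab₀ A ↔ Sep Λ.lab₀ A ∧ Λ.cut A ≤ ℓ ∧ Λ.c ≤ Λ.tcount A :=
    ⟨fun h => ⟨h.sep, h3 ▸ h.cut_le, h.le_tcount⟩, fun h => ⟨h.1, h3 ▸ h.2.1, h.2.2⟩⟩
  rw [h4, TerminalGraph.isValidCut_compl_iff h, sep_lab₀_iff hΛ hX fun v => (h v).1,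
    cut_eq hΛ hX, tcount_eq hΛ hX]
  by_cases h5 : c₀ = 0
  · rw [if_pos h5] at h1 h2
    simp only [h2, h1, h5, if_true, compl_compl, Finset.mem_compl, not_not, Nat.zero_le, true_and,
      TerminalGraph.edgesBetween_comm Xᶜ X]
    tauto
  · rw [if_neg h5] at h1 h2
    simp only [h2, h1, hc.resolve_left h5, one_ne_zero, if_false, Nat.zero_le, true_and]
    tauto

theorem correctOutput (hΛ : Setup Λ (inputState G Q₀ Q₁ c₀ c₁ ℓ)) (hc : c₀ = 0 ∨ c₁ = 0)
    (h : ∀ v : Fin n, (v ∉ Q₀ ∨ v ∉ Q₁) ∧ (v ∉ Q₀ ∨ v ∉ G.T) ∧ (v ∉ Q₁ ∨ v ∉ G.T)) {s : State}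
    (hs : Outcome Λ s) : CorrectOutput G Q₀ Q₁ c₀ c₁ ℓ s := by
  classical
  obtain ⟨h1, A, h2, h3⟩ | ⟨h1, h2⟩ := hs
  · left
    refine ⟨h1, ?_⟩
    have h4 := (isSide_iff hΛ (X := Finset.univ.filter fun v : Fin n => (v : ℕ) ∈ A)
      (by simp) hc h).1 h2
    have h5 : outputSet n s = if Λ.swap = 0 then (Finset.univ.filter fun v : Fin n => (v : ℕ) ∈ A)ᶜ
        else Finset.univ.filter fun v : Fin n => (v : ℕ) ∈ A := by
      ext v
      have h6 : (v : ℕ) < Λ.n := hΛ.n ▸ v.2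
      have h7 := h3 v h6
      split_ifs with h8
      · rw [if_pos h8] at h7
        simp [outputSet, h7]
      · rw [if_neg h8] at h7
        simp [outputSet, h7]
    rwa [h5]
  · right
    refine ⟨h1, ?_⟩
    rintro ⟨A₀, A₁, hA⟩
    obtain rfl := hA.eq_compl
    refine h2 ⟨{v | ∃ w ∈ if Λ.swap = 0 then A₀ᶜ else A₀, (w : ℕ) = v}, (isSide_iff hΛ
      (X := if Λ.swap = 0 then A₀ᶜ else A₀) (fun v => ?_) hc h).2 ?_⟩
    · simp only [Set.mem_ofPred_eq]
      exact ⟨fun h => ⟨v, h, rfl⟩, fun ⟨w, h, e⟩ => Fin.ext e ▸ h⟩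
    · split_ifs with h3
      · rwa [compl_compl]
      · exact hA

/-- The program solves the problem in the time claimed. -/
theorem exists_run (hc : c₀ = 0 ∨ c₁ = 0) {c : ℕ} (hcc : (if c₀ = 0 then c₁ else c₀) = c)
    (hl : ℓ ≤ c) : ∃ s t, Run Prog.solveBody ((inputState G Q₀ Q₁ c₀ c₁ ℓ).setReg 5 1) s t ∧
      CorrectOutput G Q₀ Q₁ c₀ c₁ ℓ s ∧
      t + 1 ≤ 2000 * 2 ^ (60 * c ^ 2 + 60) * (G.T.card ^ 2 * m + n + m + 1) := by
  have h₀ := fresh_inputState G Q₀ Q₁ c₀ c₁ ℓ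
  obtain ⟨s, t, h1, h2⟩ := wp_solveBody h₀ (by simpa only [inputState, hcc] using hl)
  rw [zero_add, compatible_iff] at h2
  refine ⟨s, t, h1, ?_⟩
  obtain ⟨h2, h3, h4⟩ | ⟨h2, Λ, hΛ, h3, h4⟩ := h2
  · refine ⟨Or.inr ⟨h3, not_isValidCut h2⟩, ?_⟩
    simp only [inputState] at h4
    have h5 : 1 * (G.T.card ^ 2 * m + n + m + 1) ≤
        2 ^ (60 * c ^ 2 + 60) * (G.T.card ^ 2 * m + n + m + 1) :=
      Nat.mul_le_mul_right _ Nat.one_le_two_pow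
    rw [mul_assoc]
    omega
  · refine ⟨correctOutput hΛ hc h2 h3, ?_⟩
    have h5 : Λ.c = c := by rw [← hcc]; exact hΛ.c
    have h6 : Λ.n = n := hΛ.n
    have h7 : Λ.N = 2 * m := hΛ.N
    simp only [inputState, hcc] at h4
    -- If a terminal is listed, it is an end of an edge, so `m ≥ 1` and `m + 1 ≤ 2 * m`; the count
    -- of listed terminals is then at most the square of the number of terminals.
    have h8 : Λ.NT * (m + 1) ≤ 2 * (G.T.card ^ 2 * m) := by
      have a1 := NT_le_card hΛ
      have a2 := Λ.NT_le
      obtain a3 | a3 := Nat.eq_zero_or_pos Λ.NT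
      · rw [a3, zero_mul]
        exact Nat.zero_le _
      · have a4 : G.T.card * 1 ≤ G.T.card * G.T.card := Nat.mul_le_mul_left _ (by omega)
        calc Λ.NT * (m + 1) ≤ G.T.card ^ 2 * (m + m) := by
              refine Nat.mul_le_mul ?_ (by omega)
              rw [sq]
              omega
          _ = 2 * (G.T.card ^ 2 * m) := by ring
    have h9 := Λ.cost_le h7 (u := 2 * (G.T.card ^ 2 * m + n + m + 1)) (by omega) (by omega)
    rw [h5, h6] at h9
    have h10 : Λ.guesses ^ 5 ≤ 2 ^ (60 * c ^ 2 + 60) := by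
      refine (Nat.pow_le_pow_left Λ.guesses_le 5).trans ?_
      rw [← pow_mul, h5]
      exact Nat.pow_le_pow_right (by omega) (by omega)
    calc t + 1 ≤ 1000 * (Λ.guesses ^ 5 * (2 * (G.T.card ^ 2 * m + n + m + 1))) := by omega
      _ ≤ 1000 * (2 ^ (60 * c ^ 2 + 60) * (2 * (G.T.card ^ 2 * m + n + m + 1))) := by gcongr
      _ = _ := by ring

end Input

end ConstrainedCut

theorem mainTheorem7 :
    ∃ (P : ConstrainedCut.Prog) (K : ℕ),
      ∀ (n m : ℕ) (G : ConstrainedCut.TerminalGraph n m) (Q₀ Q₁ : Finset (Fin n))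
        (c ℓ c₀ c₁ : ℕ), ℓ ≤ c → ((c₀ = 0 ∧ c₁ = c) ∨ (c₀ = c ∧ c₁ = 0)) →
        ∃ (s : ConstrainedCut.State) (t : ℕ),
          ConstrainedCut.Exec (K * 2 ^ (K * c ^ 2) * (n + m + 1) ^ K) P
            (ConstrainedCut.inputState G Q₀ Q₁ c₀ c₁ ℓ) s t ∧
          ConstrainedCut.CorrectOutput G Q₀ Q₁ c₀ c₁ ℓ s ∧
          t ≤ K * 2 ^ (K * c ^ 2) * (G.T.card ^ 2 * m + n + m + 1) ∧
          (1 ≤ G.T.card → G.NoIsolated →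
            t ≤ K * 2 ^ (K * c ^ 2) * (G.T.card ^ 2 * m)) := by
  -- One constant must absorb the additive `60` in the exponent as a factor, dominate the
  -- coefficient of `c ^ 2`, and serve as the degree of the word bound. Only its lower bound is
  -- kept, so that the numeral is never unfolded.
  obtain ⟨K, hK⟩ : ∃ K, 20000 * 2 ^ 60 ≤ K := ⟨_, le_rfl⟩
  refine ⟨ConstrainedCut.Prog.solve, K, ?_⟩
  intro n m G Q₀ Q₁ c ℓ c₀ c₁ hl hc
  have hcc : (if c₀ = 0 then c₁ else c₀) = c := by
    split_ifs <;> omega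
  obtain ⟨s, t, h1, h2, h3⟩ := ConstrainedCut.exists_run (G := G) (Q₀ := Q₀) (Q₁ := Q₁)
    (c₀ := c₀) (c₁ := c₁) (by omega) hcc hl
  have hK1 : 1 ≤ K := by omega
  have hpow : 20000 * 2 ^ (60 * c ^ 2 + 60) ≤ K * 2 ^ (K * c ^ 2) := by
    rw [pow_add, mul_comm (2 ^ (60 * c ^ 2)), ← mul_assoc]
    exact Nat.mul_le_mul hK (Nat.pow_le_pow_right (by omega) (Nat.mul_le_mul_right _ (by omega)))
  set F := 2 ^ (60 * c ^ 2 + 60) with hF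
  set R := K * 2 ^ (K * c ^ 2) with hR
  have hF1 : 1 ≤ F := Nat.one_le_two_pow
  have hcF : c ≤ F := by
    refine le_trans ?_ (Nat.lt_two_pow_self (n := 60 * c ^ 2 + 60)).le
    nlinarith
  have hk : G.T.card ≤ n := by simpa using Finset.card_le_univ G.T
  set k := G.T.card with hkdef
  -- Every number created is at most the largest input number plus the running time, and the latter
  -- is at most `2^{O(c^2)}` times a cubic polynomial in `n + m + 1`.
  have hbig : n + m + c + 3 + t + 1 < R * (n + m + 1) ^ K := by
    have a1 : k ^ 2 * m + n + m + 1 ≤ 2 * (n + m + 1) ^ 3 := by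
      have b1 : k ^ 2 * m ≤ (n + m + 1) ^ 3 :=
        (Nat.mul_le_mul (Nat.pow_le_pow_left (by omega) 2) (by omega)).trans_eq (pow_succ _ 2).symm
      have b2 : (n + m + 1) ^ 1 ≤ (n + m + 1) ^ 3 := Nat.pow_le_pow_right (by omega) (by omega)
      rw [pow_one] at b2
      omega
    have a2 : (n + m + 1) ^ 3 ≤ (n + m + 1) ^ K := Nat.pow_le_pow_right (by omega) (by omega)
    have a3 : n + m + 1 ≤ (n + m + 1) ^ K := by
      calc n + m + 1 = (n + m + 1) ^ 1 := (pow_one _).symm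
        _ ≤ _ := Nat.pow_le_pow_right (by omega) hK1
    set Y := (n + m + 1) ^ K
    have a4 : 2000 * F * (k ^ 2 * m + n + m + 1) ≤ 2000 * F * (2 * Y) :=
      Nat.mul_le_mul_left _ (by omega)
    have a5 : 20000 * F * Y ≤ R * Y := Nat.mul_le_mul_right _ hpow
    have a6 : 1 * Y ≤ F * Y := Nat.mul_le_mul_right _ hF1
    have a7 : F * 1 ≤ F * Y := Nat.mul_le_mul_left _ (by omega)
    have a8 : 2000 * F * (2 * Y) = 4000 * (F * Y) := by ring
    have a9 : 20000 * F * Y = 20000 * (F * Y) := by ring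
    omega
  have hexec := (h1.exec ConstrainedCut.increments_solveBody (by simp) (by omega)
    (ConstrainedCut.bounded_inputState G Q₀ Q₁ c₀ c₁ ℓ (c := c) (by omega) (by omega) hl)).2.2
    (R * (n + m + 1) ^ K) (by omega)
  have hle : t + 1 ≤ R * (k ^ 2 * m + n + m + 1) :=
    h3.trans (Nat.mul_le_mul_right _ (by omega))
  refine ⟨s, 1 + t, .seq (.const _ 5 1 (by omega)) hexec, h2, by omega, fun hk1 hG => ?_⟩
  have hn := G.card_le_of_noIsolated hG
  have a1 : 1 * m ≤ k ^ 2 * m := Nat.mul_le_mul_right _ (Nat.one_le_pow _ _ hk1)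
  calc 1 + t ≤ 2000 * F * (5 * (k ^ 2 * m)) := by
        -- A terminal exists and no vertex is isolated, so `m ≥ 1` and `n ≤ 2 * m`. Hence `n + m + 1
        -- ≤ 4 * m ≤ 4 * (k ^ 2 * m)`, which together with the main term gives the factor `5`.
        refine le_trans (by omega) (h3.trans (Nat.mul_le_mul_left _ ?_))
        omega
    _ = 10000 * F * (k ^ 2 * m) := by ring
    _ ≤ _ := Nat.mul_le_mul_right _ (by omega)
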